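/- **Setting.** Isotropic 3-space $\mathbb{I}^3$ is $\{(l,x,y)\}=\mathbb{R}^3$ with the degenerate metric $dx^2+dy^2$, identified with the hyperplane $\{(l,x,y,l)\}=\mathfrak p^\perp$ of Minkowski space $\mathbb{R}^{3,1}$ (signature $(-,+,+,+)$), $\mathfrak p=(1,0,0,1)$. Its isometries are the maps $$(l,x,y)\mapsto(l+ax+by+c,\ x\cos\varphi-y\sin\varphi+p,\ x\sin\varphi+y\cos\varphi+q);$$ homotheties are $P\mapsto kP$ with real $k\neq0$. A smooth immersion $X$ of a connected open set of $\mathbb{R}^2=\mathbb{C}$ is spacelike if its induced metric $\mathrm I$ is Riemannian; its lightlike Gauss map $n$ is given by $\langle n,n\rangle=0$, $\langle n,\mathfrak p\rangle=1$, $\langle dX,n\rangle=0$, its second fundamental form is $\mathrm{II}(\xi,\zeta)=\langle D^2X(\xi,\zeta),n\rangle$, and its mean curvature is $\frac12\operatorname{tr}(\mathrm I^{-1}\mathrm{II})$. A curvature line is a smooth regular curve through non-umbilic points that is everywhere tangent to a principal direction. $X$ is called *a zero mean curvature surface with planar curvature lines* if it is a spacelike immersion with vanishing mean curvature, the image of every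 curvature line lies in a plane, and $X$ itself does not lie in a plane. For meromorphic $h$ and holomorphic $\eta$ on $\mathbb{C}$ with $h^2\eta$ holomorphic, let $$X_{(h,\eta)}(z)=\operatorname{Re}\int_0^z(h,1,-i)\,\eta\,dz .$$ **Theorem.** For $t\in[0,3]$ define $(h_t,\eta_t)$ as follows. * $0\le t<1$: with $r=2$ and $\theta=\pi t/2$, $$h_t=\frac{2e^{2i\theta}\cos\theta}{e^{-r\cos\theta\,z}(\cos\theta+1)-\sin\theta},\qquad \eta_t=\frac{e^{-2i\theta}\bigl(\cos\theta\sinh(r\cos\theta\,z)-\cosh(r\cos\theta\,z)+\sin\theta\bigr)}{r\cos^2\theta}.$$ * $t=1$: $h_t=\frac{2}{2z-1}$, $\eta_t=\frac{(2z-1)^2}{4}$. * $1<t\le2$: with $\alpha=2(t-1)$, $\beta=2$ and $s=\frac{2-t}{2}+\frac{(t-1)\pi i}{2}$, $$h_t=\tfrac{\alpha}{\beta}\coth\tfrac{\alpha(z-s)}{2},\qquad \eta_t=\tfrac{2\beta}{\alpha^2}\sinh^2\tfrac{\alpha(z-s)}{2}.$$ * $2<t<3$: with $\alpha=2(3-t)$,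 $h_t=\frac2\alpha\tanh\frac{\alpha z}{2}$, $\eta_t=-\cosh^2\frac{\alpha z}{2}$ (at $t=2$ these formulas agree with the preceding ones). * $t=3$: $h_t=z$, $\eta_t=-1$. Then every $(h_t,\eta_t)$ is Weierstrass data ($h_t$ meromorphic, $\eta_t$ and $h_t^2\eta_t$ holomorphic on $\mathbb{C}$), and $X_t:=X_{(h_t,\eta_t)}:\mathbb{C}\to\mathbb{I}^3$, $t\in[0,3]$, is a continuous deformation consisting exactly of the zero mean curvature surfaces with planar curvature lines: 1. (Continuity) For every $t_0\in[0,3]$, $X_t\to X_{t_0}$ uniformly on compact subsets of $\mathbb{C}$ as $t\to t_0$ in $[0,3]$. 2. (Members) For every $t\in[0,3]$, $X_t$ restricted to $\Omega_t=\{z:\eta_t(z)\neq0\}$ is a zero mean curvature surface with planar curvature lines. 3. (Completeness) Every zero mean curvature surface with planar curvature lines $X:S\to\mathbb{I}^3$, $S\subset\mathbb{C}$ open and connected, is a piece of some member, up to an isometry and a homothety: there are $t\in[0,3]$ and a composition $\Phi$ of an isometry and a homothety such that every point of $S$ has an open neighbourhood $U\subset S$ and a smooth $\psi:U\to\Omega_t$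 with injective differentials and $X=\Phi\circ X_t\circ\psi$ on $U$. 4. (Surfaces connected) Up to isometries, homotheties and affine changes $z\mapsto az+b$ ($a\ne0$) of the complex parameter, $X_0$ is the catenoid with data $(e^z,e^{-z}dz)$; $X_1$ is the Enneper-type surface $(\frac1z,z^2dz)$; $X_3$ is the trivial Enneper surface $(z,dz)$; and, for $t\in(0,1)\cup(1,3)$, $X_t$ is the Bonnet-type surface $\bigl(\frac\alpha\beta\coth\frac{\alpha z}2,\frac{2\beta}{\alpha^2}\sinh^2\frac{\alpha z}2\,dz\bigr)$ with $(\alpha,\beta)=(2\cos\frac{\pi t}2,2\sin\frac{\pi t}2)$ for $0<t<1$, $(\alpha,\beta)=(2(t-1),2)$ for $1<t\le2$, and $\alpha=2(3-t)$, $\beta=\alpha^2/2$ for $2\le t<3$. Every Bonnet-type surface ($\alpha,\beta>0$) occurs in this sense for some $t\in(0,1)$. -/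

import Mathlib

open Set Filter Topology
open scoped ContDiff

noncomputable section

namespace Isotropic

/-! Isotropic 3-space -/

/-- Coordinate space of isotropic 3-space; the coordinates `0, 1, 2` are `(l, x, y)`,
with `l` the vertical one. -/
abbrev I3 : Type := Fin 3 → ℝ

/-- The bilinear form of signature `(-, +, +, +)` of Minkowski 4-space. -/
def lorentz (a b : Fin 4 → ℝ) : ℝ := -(a 0 * b 0) + a 1 * b 1 + a 2 * b 2 + a 3 * b 3

/-- The fixed null vector `(1, 0, 0, 1)`. -/
def nullVec : Fin 4 → ℝ := ![1, 0, 0, 1]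

/-- Isotropic 3-space as the hyperplane of Minkowski space orthogonal to `nullVec`:
`(l, x, y)` stands for `(l, x, y, l)`. -/
def toMinkowski (P : I3) : Fin 4 → ℝ := ![P 0, P 1, P 2, P 0]

theorem lorentz_toMinkowski_nullVec (P : I3) : lorentz (toMinkowski P) nullVec = 0 := by
  simp [lorentz, toMinkowski, nullVec]

/-- The induced (degenerate) metric is `dx² + dy²`. -/
theorem lorentz_toMinkowski (P R : I3) :
    lorentz (toMinkowski P) (toMinkowski R) = P 1 * R 1 + P 2 * R 2 := by
  simp [lorentz, toMinkowski]
  ring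

/-- Isometries (isotropic motions) of isotropic 3-space: the maps induced by the Lorentz
transformations of determinant `1` that fix `nullVec`, composed with translations. -/
def IsMotion (Φ : I3 → I3) : Prop :=
  ∃ φ a b c p q : ℝ, ∀ P : I3, Φ P =
    ![P 0 + a * P 1 + b * P 2 + c,
      Real.cos φ * P 1 - Real.sin φ * P 2 + p,
      Real.sin φ * P 1 + Real.cos φ * P 2 + q]

/-- Compositions of isometries and homotheties (of ratio `k ≠ 0`). -/
def IsSimilarity (Φ : I3 → I3) : Prop :=
  ∃ Ψ : I3 → I3, IsMotion Ψ ∧ ∃ k : ℝ, k ≠ 0 ∧ ∀ P : I3, Φ P = k • Ψ P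

/-- The set `A` lies in some affine plane. -/
def InPlane (A : Set I3) : Prop :=
  ∃ c : Fin 3 → ℝ, c ≠ 0 ∧ ∃ d : ℝ, ∀ P ∈ A, ∑ i, c i * P i = d

/-! Surfaces, parametrized over open subsets of `ℂ = ℝ²` -/

/-- First fundamental form of `X` at `z`. -/
def firstForm (X : ℂ → I3) (z ξ ζ : ℂ) : ℝ :=
  lorentz (toMinkowski (fderiv ℝ X z ξ)) (toMinkowski (fderiv ℝ X z ζ))

/-- Smooth spacelike immersion of the open set `S`: the induced metric is Riemannian. -/
def IsSpacelikeImmersion (S : Set ℂ) (X : ℂ → I3) : Prop :=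
  ContDiffOn ℝ ∞ X S ∧ ∀ z ∈ S, ∀ ξ : ℂ, ξ ≠ 0 → 0 < firstForm X z ξ ξ

/-- The determinant of the projection `(x, y)` of `X`. -/
def projDet (X : ℂ → I3) (z : ℂ) : ℝ :=
  fderiv ℝ X z 1 1 * fderiv ℝ X z Complex.I 2 - fderiv ℝ X z Complex.I 1 * fderiv ℝ X z 1 2

def gaussOne (X : ℂ → I3) (z : ℂ) : ℝ :=
  -(fderiv ℝ X z 1 0 * fderiv ℝ X z Complex.I 2
    - fderiv ℝ X z Complex.I 0 * fderiv ℝ X z 1 2) / projDet X z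

def gaussTwo (X : ℂ → I3) (z : ℂ) : ℝ :=
  -(fderiv ℝ X z 1 1 * fderiv ℝ X z Complex.I 0
    - fderiv ℝ X z Complex.I 1 * fderiv ℝ X z 1 0) / projDet X z

/-- The lightlike Gauss map, written out; see `eq_gaussMap_iff` for its characterization. -/
def gaussMap (X : ℂ → I3) (z : ℂ) : Fin 4 → ℝ :=
  ![-(1 + gaussOne X z ^ 2 + gaussTwo X z ^ 2) / 2, gaussOne X z, gaussTwo X z,
    (1 - gaussOne X z ^ 2 - gaussTwo X z ^ 2) / 2]

theorem projDet_ne_zero {X : ℂ → I3} {z : ℂ}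
    (h : ∀ ξ : ℂ, ξ ≠ 0 → 0 < firstForm X z ξ ξ) : projDet X z ≠ 0 := by
  intro hd
  have key : ∀ s t : ℝ, (s ≠ 0 ∨ t ≠ 0) →
      0 < (s * fderiv ℝ X z 1 1 + t * fderiv ℝ X z Complex.I 1) ^ 2
        + (s * fderiv ℝ X z 1 2 + t * fderiv ℝ X z Complex.I 2) ^ 2 := by
    intro s t hst
    have hne : (s • (1 : ℂ) + t • Complex.I) ≠ 0 := by
      intro h0
      have h1 := congrArg Complex.re h0
      have h2 := congrArg Complex.im h0
      simp at h1 h2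
      rcases hst with hs | ht
      · exact hs h1
      · exact ht h2
    have := h _ hne
    simp only [firstForm, lorentz_toMinkowski, map_add, map_smul, Pi.add_apply, Pi.smul_apply,
      smul_eq_mul] at this
    nlinarith [this]
  unfold projDet at hd
  have h1 := key 1 0 (by simp)
  have h2 := key (fderiv ℝ X z Complex.I 1) (-fderiv ℝ X z 1 1)
  have h3 := key (fderiv ℝ X z Complex.I 2) (-fderiv ℝ X z 1 2)
  by_cases hx : fderiv ℝ X z 1 1 = 0
  · by_cases hy : fderiv ℝ X z 1 2 = 0
    · rw [hx, hy] at h1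
      norm_num at h1
    · have := h3 (Or.inr (by simpa using hy))
      have e1 : fderiv ℝ X z Complex.I 2 * fderiv ℝ X z 1 1
          + -fderiv ℝ X z 1 2 * fderiv ℝ X z Complex.I 1 = 0 := by linarith
      have e2 : fderiv ℝ X z Complex.I 2 * fderiv ℝ X z 1 2
          + -fderiv ℝ X z 1 2 * fderiv ℝ X z Complex.I 2 = 0 := by ring
      rw [e1, e2] at this
      norm_num at this
  · have := h2 (Or.inr (by simpa using hx))
    have e1 : fderiv ℝ X z Complex.I 1 * fderiv ℝ X z 1 1
        + -fderiv ℝ X z 1 1 * fderiv ℝ X z Complex.I 1 = 0 := by ring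
    have e2 : fderiv ℝ X z Complex.I 1 * fderiv ℝ X z 1 2
        + -fderiv ℝ X z 1 1 * fderiv ℝ X z Complex.I 2 = 0 := by linarith
    rw [e1, e2] at this
    norm_num at this

/-- For a spacelike immersion, `gaussMap X z` is the unique null vector `ν` that is orthogonal
to the tangent plane and satisfies `⟨ν, nullVec⟩ = 1`. -/
theorem eq_gaussMap_iff {X : ℂ → I3} {z : ℂ}
    (h : ∀ ξ : ℂ, ξ ≠ 0 → 0 < firstForm X z ξ ξ) (ν : Fin 4 → ℝ) :
    ν = gaussMap X z ↔
      lorentz ν ν = 0 ∧ lorentz ν nullVec = 1 ∧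
        ∀ ξ : ℂ, lorentz (toMinkowski (fderiv ℝ X z ξ)) ν = 0 := by
  have hd := projDet_ne_zero h
  have hlin : ∀ ξ : ℂ, ∀ i, fderiv ℝ X z ξ i
      = ξ.re * fderiv ℝ X z 1 i + ξ.im * fderiv ℝ X z Complex.I i := by
    intro ξ i
    have e : ξ = ξ.re • (1 : ℂ) + ξ.im • Complex.I := by
      apply Complex.ext <;> simp
    conv_lhs => rw [e]
    simp only [map_add, map_smul, Pi.add_apply, Pi.smul_apply, smul_eq_mul]
  constructor
  · rintro rfl
    refine ⟨?_, ?_, ?_⟩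
    · simp [lorentz, gaussMap]
      ring
    · simp [lorentz, gaussMap, nullVec]
      ring
    · have g1 : gaussOne X z * projDet X z = -(fderiv ℝ X z 1 0 * fderiv ℝ X z Complex.I 2
          - fderiv ℝ X z Complex.I 0 * fderiv ℝ X z 1 2) := by
        unfold gaussOne
        field_simp
      have g2 : gaussTwo X z * projDet X z = -(fderiv ℝ X z 1 1 * fderiv ℝ X z Complex.I 0
          - fderiv ℝ X z Complex.I 1 * fderiv ℝ X z 1 0) := by
        unfold gaussTwo
        field_simp
      intro ξ
      have e : lorentz (toMinkowski (fderiv ℝ X z ξ)) (gaussMap X z)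
          = fderiv ℝ X z ξ 0 + fderiv ℝ X z ξ 1 * gaussOne X z
            + fderiv ℝ X z ξ 2 * gaussTwo X z := by
        simp [lorentz, gaussMap, toMinkowski]
        ring
      rw [e]
      have : (fderiv ℝ X z ξ 0 + fderiv ℝ X z ξ 1 * gaussOne X z
            + fderiv ℝ X z ξ 2 * gaussTwo X z) * projDet X z = 0 := by
        have r : (fderiv ℝ X z ξ 0 + fderiv ℝ X z ξ 1 * gaussOne X z
            + fderiv ℝ X z ξ 2 * gaussTwo X z) * projDet X z
            = fderiv ℝ X z ξ 0 * projDet X z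
              + fderiv ℝ X z ξ 1 * (gaussOne X z * projDet X z)
              + fderiv ℝ X z ξ 2 * (gaussTwo X z * projDet X z) := by ring
        rw [r, g1, g2, hlin ξ 0, hlin ξ 1, hlin ξ 2]
        unfold projDet
        ring
      exact (mul_eq_zero.mp this).resolve_right hd
  · rintro ⟨h1, h2, h3⟩
    have hu := h3 1
    have hv := h3 Complex.I
    simp only [lorentz, toMinkowski, nullVec] at h1 h2 hu hv
    simp at h1 h2 hu hv
    have n1 : ν 1 = gaussOne X z := by
      unfold gaussOne
      rw [eq_div_iff hd]
      unfold projDet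
      linear_combination fderiv ℝ X z Complex.I 2 * hu - fderiv ℝ X z 1 2 * hv
        - (fderiv ℝ X z 1 0 * fderiv ℝ X z Complex.I 2
          - fderiv ℝ X z Complex.I 0 * fderiv ℝ X z 1 2) * h2
    have n2 : ν 2 = gaussTwo X z := by
      unfold gaussTwo
      rw [eq_div_iff hd]
      unfold projDet
      linear_combination fderiv ℝ X z 1 1 * hv - fderiv ℝ X z Complex.I 1 * hu
        - (fderiv ℝ X z 1 1 * fderiv ℝ X z Complex.I 0
          - fderiv ℝ X z Complex.I 1 * fderiv ℝ X z 1 0) * h2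
    have n3 : ν 3 = 1 + ν 0 := by linarith
    rw [n3, n1, n2] at h1
    have n0 : ν 0 = -(1 + gaussOne X z ^ 2 + gaussTwo X z ^ 2) / 2 := by linarith
    funext i
    fin_cases i
    · simpa [gaussMap] using n0
    · simpa [gaussMap] using n1
    · simpa [gaussMap] using n2
    · simp [gaussMap]
      rw [n3, n0]
      ring

/-- Second fundamental form of `X` at `z`. -/
def secondForm (X : ℂ → I3) (z ξ ζ : ℂ) : ℝ :=
  lorentz (toMinkowski (fderiv ℝ (fun w => fderiv ℝ X w ξ) z ζ)) (gaussMap X z)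

/-- Mean curvature: half the trace of the second fundamental form with respect to the first. -/
def meanCurvature (X : ℂ → I3) (z : ℂ) : ℝ :=
  (firstForm X z 1 1 * secondForm X z Complex.I Complex.I
    - 2 * firstForm X z 1 Complex.I * secondForm X z 1 Complex.I
    + firstForm X z Complex.I Complex.I * secondForm X z 1 1) /
  (2 * (firstForm X z 1 1 * firstForm X z Complex.I Complex.I - firstForm X z 1 Complex.I ^ 2))

def IsUmbilic (X : ℂ → I3) (z : ℂ) : Prop :=
  ∃ κ : ℝ, ∀ ξ ζ : ℂ, secondForm X z ξ ζ = κ * firstForm X z ξ ζ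

/-- `ξ` is a principal (curvature) direction of `X` at `z`. -/
def IsPrincipal (X : ℂ → I3) (z ξ : ℂ) : Prop :=
  ξ ≠ 0 ∧ ∃ κ : ℝ, ∀ ζ : ℂ, secondForm X z ξ ζ = κ * firstForm X z ξ ζ

/-- `γ`, restricted to the interval `(a, b)`, is a curvature line of `X` on `S`: a regular curve
through non-umbilic points, everywhere tangent to a principal direction. -/
def IsCurvatureLine (S : Set ℂ) (X : ℂ → I3) (γ : ℝ → ℂ) (a b : ℝ) : Prop :=
  ContDiffOn ℝ ∞ γ (Ioo a b) ∧
    ∀ s ∈ Ioo a b, γ s ∈ S ∧ ¬ IsUmbilic X (γ s) ∧ IsPrincipal X (γ s) (deriv γ s)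

/-- Every curvature line of `X` on `S` lies in a plane. -/
def HasPlanarCurvatureLines (S : Set ℂ) (X : ℂ → I3) : Prop :=
  ∀ (γ : ℝ → ℂ) (a b : ℝ), IsCurvatureLine S X γ a b →
    InPlane ((fun s => X (γ s)) '' Ioo a b)

/-- `X` on the domain `S` is a (non-planar) zero mean curvature surface with planar
curvature lines. -/
structure IsZMCWithPlanarLines (S : Set ℂ) (X : ℂ → I3) : Prop where
  isOpen : IsOpen S
  isConnected : IsConnected S
  spacelike : IsSpacelikeImmersion S X
  zeroMeanCurvature : ∀ z ∈ S, meanCurvature X z = 0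
  planarLines : HasPlanarCurvatureLines S X
  notPlanar : ¬ InPlane (X '' S)

/-- Up to one fixed isometry and homothety, the surface `X` on `S` is a piece of the surface `Y`
on `T`: near every point of `S` it is a smooth regular reparametrization of a part of `Y`. -/
def IsPieceOf (S : Set ℂ) (X : ℂ → I3) (T : Set ℂ) (Y : ℂ → I3) : Prop :=
  ∃ Φ : I3 → I3, IsSimilarity Φ ∧ ∀ p ∈ S, ∃ U : Set ℂ, IsOpen U ∧ p ∈ U ∧ U ⊆ S ∧
    ∃ ψ : ℂ → ℂ, ContDiffOn ℝ ∞ ψ U ∧ (∀ z ∈ U, Function.Injective (fderiv ℝ ψ z)) ∧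
      MapsTo ψ U T ∧ ∀ z ∈ U, X z = Φ (Y (ψ z))

/-- The surfaces `X` and `Y`, both parametrized over `ℂ`, agree up to an isometry, a homothety
and an affine change of the complex parameter. -/
def SameSurface (X Y : ℂ → I3) : Prop :=
  ∃ Φ : I3 → I3, IsSimilarity Φ ∧ ∃ a b : ℂ, a ≠ 0 ∧ ∀ z : ℂ, X z = Φ (Y (a * z + b))

/-! Weierstrass data -/

/-- `h` is meromorphic, `η dz` is a holomorphic 1-form, and `h² η` is holomorphic (after removal
of the singularities at the poles of `h`, where the value of `h` in Lean is immaterial). -/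
def IsWeierstrassData (h η : ℂ → ℂ) : Prop :=
  MeromorphicOn h univ ∧ Differentiable ℂ η ∧
    ∃ g : ℂ → ℂ, Differentiable ℂ g ∧ (fun z => h z ^ 2 * η z) =ᶠ[codiscrete ℂ] g

/-- The integral of `F dz` along the segment from `0` to `z`. -/
def segmentIntegral (F : ℂ → ℂ) (z : ℂ) : ℂ := ∫ s in (0 : ℝ)..1, F (s * z) * z

/-- The surface `Re ∫ (h, 1, -i) η dz`, the integral starting from `0`. -/
def weierstrassSurface (h η : ℂ → ℂ) (z : ℂ) : I3 :=
  ![(segmentIntegral (fun w => h w * η w) z).re,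
    (segmentIntegral η z).re,
    (segmentIntegral (fun w => -Complex.I * η w) z).re]

def catenoid : ℂ → I3 :=
  weierstrassSurface (fun z => Complex.exp z) (fun z => Complex.exp (-z))

def enneperType : ℂ → I3 := weierstrassSurface (fun z => 1 / z) (fun z => z ^ 2)

def trivialEnneper : ℂ → I3 := weierstrassSurface (fun z => z) (fun _ => 1)

def bonnetH (α β : ℝ) (z : ℂ) : ℂ :=
  (α / β : ℂ) * (Complex.cosh (α * z / 2) / Complex.sinh (α * z / 2))

def bonnetEta (α β : ℝ) (z : ℂ) : ℂ := (2 * β / α ^ 2 : ℂ) * Complex.sinh (α * z / 2) ^ 2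

def bonnetType (α β : ℝ) : ℂ → I3 := weierstrassSurface (bonnetH α β) (bonnetEta α β)

/-! The deformation -/

/-- First stage, `0 ≤ θ < π / 2`, with a constant `r > 0`. -/
def stageOneH (r θ : ℝ) (z : ℂ) : ℂ :=
  2 * Complex.exp (2 * Complex.I * θ) * Real.cos θ /
    (Complex.exp (-(r * Real.cos θ * z)) * (Real.cos θ + 1) - Real.sin θ)

def stageOneEta (r θ : ℝ) (z : ℂ) : ℂ :=
  Complex.exp (-(2 * Complex.I * θ)) *
    (Real.cos θ * Complex.sinh (r * Real.cos θ * z) - Complex.cosh (r * Real.cos θ * z)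
      + Real.sin θ) / (r * Real.cos θ ^ 2)

/-- Third stage, `α > 0`. -/
def stageThreeH (α : ℝ) (z : ℂ) : ℂ := (2 / α : ℂ) * Complex.tanh (α * z / 2)

def stageThreeEta (α : ℝ) (z : ℂ) : ℂ := -Complex.cosh (α * z / 2) ^ 2

/-- The centre of the parameter in the second stage, moving from `1 / 2` to `i π / 2`. -/
def centre (t : ℝ) : ℂ := (2 - t) / 2 + (t - 1) * (Real.pi * Complex.I / 2)

/-- The functions `h` of the deformation, `0 ≤ t ≤ 3`. -/
def deformationH (t : ℝ) (z : ℂ) : ℂ :=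
  if t < 1 then stageOneH 2 (Real.pi * t / 2) z
  else if t = 1 then 2 / (2 * z - 1)
  else if t ≤ 2 then bonnetH (2 * (t - 1)) 2 (z - centre t)
  else if t < 3 then stageThreeH (2 * (3 - t)) z
  else z

/-- The 1-forms `η dz` of the deformation, `0 ≤ t ≤ 3`. -/
def deformationEta (t : ℝ) (z : ℂ) : ℂ :=
  if t < 1 then stageOneEta 2 (Real.pi * t / 2) z
  else if t = 1 then (2 * z - 1) ^ 2 / 4
  else if t ≤ 2 then bonnetEta (2 * (t - 1)) 2 (z - centre t)
  else if t < 3 then stageThreeEta (2 * (3 - t)) z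
  else -1

/-- The members of the deformation. -/
def deformation (t : ℝ) : ℂ → I3 := weierstrassSurface (deformationH t) (deformationEta t)

/-- The points at which the induced metric `|η|² |dz|²` of a member does not degenerate. -/
def regularSet (t : ℝ) : Set ℂ := {z | deformationEta t z ≠ 0}

end Isotropic

end

open Set Filter Topology
open scoped ContDiff

noncomputable section

namespace Isotropic

/-! Write a surface as height `Re L` and complex projection `W = x + iy`, with `L' = F = hη` and `W'
= η` holomorphic. The metric is `|η|²|dz|²` and the second fundamental form is `Re(h'η dz²)`. If the
Hopf differential `h'η` is a nonzero real constant, which in terms of `(F, η)` is the Wronskian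
identity of `IsCanonical`, the curvature lines are exactly the horizontal and vertical lines of the
parameter. Everything is then governed by one linear equation: with `η = Cf²`, the curvature lines
are planar if `f'' = κf` for a real constant `κ`.

Members. Every `(h_t, η_t)` has the form `h = g/f`, `η = Cf²` with `f'' = κf` and `C(g'f - gf') =
-1` (`isSpinorial_deformation`). Along a line in direction `d`, with `d²` real, `y = Re(d(c₀F +
cη))` satisfies a real equation `y''' = λy'`. The constants can be chosen nontrivially so that `y,
y', y''` vanish at one point, hence `y = 0` and the line is mapped into a plane
(`exists_linear_relation`).

Completeness. A spacelike immersion is locally a graph over the `(x, y)`-plane whose second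
fundamental form is the Hessian of the height, so zero mean curvature makes the height a harmonic
function `Re H` (`exists_graph_chart`). Off the zeros of `H''`, which are the umbilics, there is a
coordinate in which the Hopf differential is `-1`; put `η = φ²` there. Planarity of the horizontal
lines, differentiated three times, gives `Im(φ''/φ) = 0`, so the holomorphic function `φ''/φ` is a
real constant. Its solutions are constants, linear functions, exponentials and sums of two
exponentials, and each is matched with a member having `t ∈ [0, 1] ∪ {3}` (`exists_member`).
Equality of `η` up to a factor and an affine change of parameter already determines the surface up
to similarity, because the Wronskian identity fixes `F` up to a multiple of `η`
(`IsCanonical.exists_similarity`); this also identifies the named surfaces.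

Two global points remain. Umbilics cannot occur: the equation for `H''` rules out isolated zeros, so
an umbilic would make a chart, and by continuation the whole surface, planar (`not_isUmbilic`).
Moreover one `t` and one similarity serve all of `S`: two canonical parametrizations of the same
piece differ by an affine map, which extends over the chart (`exists_affine_of_isPieceAt`).

Continuity holds because `η_t` and `h_tη_t`, rewritten without their removable singularities at `t =
1` and `t = 3`, are jointly continuous in `(t, z)`. -/

/-- Linear forms `v ↦ v₀ + ν₁ v₁ + ν₂ v₂` that vanish on the tangent plane compute the product
with the lightlike Gauss map. -/
theorem lorentz_gaussMap {X : ℂ → I3} {z : ℂ} (h : ∀ ξ : ℂ, ξ ≠ 0 → 0 < firstForm X z ξ ξ)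
    {ν₁ ν₂ : ℝ} (hν : ∀ ξ : ℂ, fderiv ℝ X z ξ 0 + ν₁ * fderiv ℝ X z ξ 1
      + ν₂ * fderiv ℝ X z ξ 2 = 0) (v : I3) :
    lorentz (toMinkowski v) (gaussMap X z) = v 0 + ν₁ * v 1 + ν₂ * v 2 := by
  have key : (![-(1 + ν₁ ^ 2 + ν₂ ^ 2) / 2, ν₁, ν₂, (1 - ν₁ ^ 2 - ν₂ ^ 2) / 2] : Fin 4 → ℝ)
      = gaussMap X z := by
    rw [eq_gaussMap_iff h]
    refine ⟨?_, ?_, fun ξ => ?_⟩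
    · simp [lorentz]; ring
    · simp [lorentz, nullVec]; ring
    · rw [← hν ξ]; simp [lorentz, toMinkowski]; ring
  rw [← key]
  simp [lorentz, toMinkowski]; ring

/-! ### Fundamental forms of surfaces given by two holomorphic functions. -/

/-- The surface with height `Re L` and projection `W`. -/
def surf (L W : ℂ → ℂ) (z : ℂ) : I3 := ![(L z).re, (W z).re, (W z).im]

/-- The differential of `surf L W` for holomorphic `L`, `W` with derivatives `a`, `b`. -/
def surfDeriv (a b : ℂ) : ℂ →L[ℝ] I3 :=
  ContinuousLinearMap.pi ![Complex.reCLM ∘L (ContinuousLinearMap.mul ℝ ℂ a),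
    Complex.reCLM ∘L (ContinuousLinearMap.mul ℝ ℂ b),
    Complex.imCLM ∘L (ContinuousLinearMap.mul ℝ ℂ b)]

theorem surfDeriv_apply (a b ξ : ℂ) :
    surfDeriv a b ξ = ![(a * ξ).re, (b * ξ).re, (b * ξ).im] := by
  funext i
  fin_cases i <;> simp [surfDeriv]

theorem hasFDerivAt_surf {L W : ℂ → ℂ} {z a b : ℂ} (hL : HasDerivAt L a z)
    (hW : HasDerivAt W b z) : HasFDerivAt (surf L W) (surfDeriv a b) z := by
  have h1 := hL.hasFDerivAt.restrictScalars ℝ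
  have h2 := hW.hasFDerivAt.restrictScalars ℝ
  rw [hasFDerivAt_pi']
  intro i
  fin_cases i
  · refine (Complex.reCLM.hasFDerivAt.comp z h1).congr_fderiv ?_
    ext ξ; simp [surfDeriv_apply]; ring
  · refine (Complex.reCLM.hasFDerivAt.comp z h2).congr_fderiv ?_
    ext ξ; simp [surfDeriv_apply]; ring
  · refine (Complex.imCLM.hasFDerivAt.comp z h2).congr_fderiv ?_
    ext ξ; simp [surfDeriv_apply]; ring

theorem fderiv_surf {L W : ℂ → ℂ} {z a b : ℂ} (hL : HasDerivAt L a z)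
    (hW : HasDerivAt W b z) (ξ : ℂ) :
    fderiv ℝ (surf L W) z ξ = ![(a * ξ).re, (b * ξ).re, (b * ξ).im] := by
  rw [(hasFDerivAt_surf hL hW).fderiv, surfDeriv_apply]

theorem firstForm_surf {L W : ℂ → ℂ} {z a b : ℂ} (hL : HasDerivAt L a z)
    (hW : HasDerivAt W b z) (ξ ζ : ℂ) :
    firstForm (surf L W) z ξ ζ = Complex.normSq b * (ξ.re * ζ.re + ξ.im * ζ.im) := by
  rw [firstForm, lorentz_toMinkowski, fderiv_surf hL hW, fderiv_surf hL hW]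
  simp [Complex.normSq_apply]
  ring

theorem firstForm_surf_pos {L W : ℂ → ℂ} {z a b : ℂ} (hL : HasDerivAt L a z)
    (hW : HasDerivAt W b z) (hb : b ≠ 0) (ξ : ℂ) (hξ : ξ ≠ 0) :
    0 < firstForm (surf L W) z ξ ξ := by
  rw [firstForm_surf hL hW]
  exact mul_pos (Complex.normSq_pos.2 hb) (Complex.normSq_pos.2 hξ)

theorem secondForm_surf {L W F η : ℂ → ℂ} {z a b : ℂ} (hL : ∀ᶠ w in 𝓝 z, HasDerivAt L (F w) w)
    (hW : ∀ᶠ w in 𝓝 z, HasDerivAt W (η w) w) (hF : HasDerivAt F a z) (hη : HasDerivAt η b z)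
    (h0 : η z ≠ 0) (ξ ζ : ℂ) :
    secondForm (surf L W) z ξ ζ = ((a - F z / η z * b) * (ξ * ζ)).re := by
  have e : (fun w => fderiv ℝ (surf L W) w ξ) =ᶠ[𝓝 z]
      surf (fun w => F w * ξ) (fun w => η w * ξ) := by
    filter_upwards [hL, hW] with w h1 h2
    rw [fderiv_surf h1 h2]; rfl
  have hpos := firstForm_surf_pos hL.self_of_nhds hW.self_of_nhds h0
  rw [secondForm, e.fderiv_eq, fderiv_surf (hF.mul_const ξ) (hη.mul_const ξ),
    lorentz_gaussMap hpos (ν₁ := -(F z / η z).re) (ν₂ := (F z / η z).im)]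
  · simp
    ring
  · intro ξ
    rw [fderiv_surf hL.self_of_nhds hW.self_of_nhds]
    have : (F z * ξ).re = (F z / η z * (η z * ξ)).re := by field_simp
    simp only [Matrix.cons_val_zero, Matrix.cons_val_one, Matrix.cons_val]
    rw [this, Complex.mul_re (F z / η z)]
    ring

/-! Integration of entire functions from the origin -/

/-- An entire function has a primitive `P`, and the integral along the segment is `P z - P 0`. -/
theorem hasDerivAt_segmentIntegral {F : ℂ → ℂ} (hF : Differentiable ℂ F) (z : ℂ) :
    HasDerivAt (segmentIntegral F) (F z) z := by
  obtain ⟨P, hP⟩ := hF.isExactOn_univ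
  have e : segmentIntegral F = fun z => P z - P 0 := by
    funext z
    have h := intervalIntegral.integral_eq_sub_of_hasDerivAt (a := 0) (b := 1)
      (f := fun s : ℝ => P (s * z)) (f' := fun s : ℝ => F (s * z) * z) ?_ ?_
    · simpa [segmentIntegral] using h
    · intro s _
      have h1 : HasDerivAt (fun s : ℝ => (s : ℂ) * z) z s := by
        simpa using (Complex.ofRealCLM.hasDerivAt (x := s)).mul_const z
      exact (hP _ (mem_univ _)).comp s h1
    · apply Continuous.intervalIntegrable
      have := hF.continuous
      fun_prop
  rw [e]
  exact (hP z (mem_univ z)).sub_const _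

/-- Since `Re(-iw) = Im w`, the last two coordinates merge into the single holomorphic function `∫
η`. -/
theorem weierstrassSurface_eq_surf {h η F : ℂ → ℂ} (hF : ∀ z, h z * η z = F z) :
    weierstrassSurface h η = surf (segmentIntegral F) (segmentIntegral η) := by
  have e : (fun w => h w * η w) = F := funext hF
  have e2 : ∀ z, segmentIntegral (fun w => -Complex.I * η w) z
      = -Complex.I * segmentIntegral η z := by
    intro z
    simp only [segmentIntegral, mul_assoc]
    exact intervalIntegral.integral_const_mul _ _
  funext z
  rw [weierstrassSurface, surf, e2]
  simp [e]

/-! Similarities -/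

/-- The projection to the `(x, y)`-plane, as a complex number. -/
def proj (P : I3) : ℂ := ⟨P 1, P 2⟩

/-- Similarities in complex notation. -/
def simMap (k : ℝ) (c : ℂ) (d : ℝ) (μ e : ℂ) (P : I3) : I3 :=
  ![k * P 0 + (c * proj P).re + d, (μ * proj P + e).re, (μ * proj P + e).im]

theorem isSimilarity_simMap {k : ℝ} {μ : ℂ} (hk : k ≠ 0) (hμ : ‖μ‖ = |k|) (c : ℂ) (d : ℝ) (e : ℂ) :
    IsSimilarity (simMap k c d μ e) := by
  have hk' : (k : ℂ) ≠ 0 := by exact_mod_cast hk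
  -- `μ / k` has modulus one, so it is a rotation; this also covers negative `k`.
  obtain ⟨φ, hφ⟩ : ∃ φ : ℝ, μ = k * Complex.exp (φ * Complex.I) := by
    have h1 : ‖μ / k‖ = 1 := by
      rw [norm_div, hμ, Complex.norm_real, Real.norm_eq_abs, div_self (abs_ne_zero.2 hk)]
    obtain ⟨φ, hφ⟩ := Complex.norm_eq_one_iff _ |>.1 h1
    refine ⟨φ, ?_⟩
    rw [hφ]; field_simp
  refine ⟨fun P => ![P 0 + c.re / k * P 1 + (-c.im / k) * P 2 + d / k,
      Real.cos φ * P 1 - Real.sin φ * P 2 + e.re / k,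
      Real.sin φ * P 1 + Real.cos φ * P 2 + e.im / k], ⟨φ, _, _, _, _, _, fun P => rfl⟩, k, hk, ?_⟩
  intro P
  have hre : (Complex.exp (φ * Complex.I)).re = Real.cos φ := Complex.exp_ofReal_mul_I_re φ
  have him : (Complex.exp (φ * Complex.I)).im = Real.sin φ := Complex.exp_ofReal_mul_I_im φ
  funext i
  fin_cases i
  · simp [simMap, proj]; field_simp; ring
  · simp [simMap, proj, hφ, -Complex.exp_ofReal_mul_I_re, -Complex.exp_ofReal_mul_I_im, hre, him]; field_simp
  · simp [simMap, proj, hφ, -Complex.exp_ofReal_mul_I_re, -Complex.exp_ofReal_mul_I_im, hre, him]; field_simp; ring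

theorem IsSimilarity.exists_simMap {Φ : I3 → I3} (h : IsSimilarity Φ) :
    ∃ (k : ℝ) (c : ℂ) (d : ℝ) (μ e : ℂ), k ≠ 0 ∧ ‖μ‖ = |k| ∧ Φ = simMap k c d μ e := by
  obtain ⟨Ψ, ⟨φ, a, b, c, p, q, hΨ⟩, k, hk, hΦ⟩ := h
  refine ⟨k, ⟨k * a, -k * b⟩, k * c, k * Complex.exp (φ * Complex.I), ⟨k * p, k * q⟩, hk, ?_, ?_⟩
  · rw [norm_mul, Complex.norm_exp_ofReal_mul_I, Complex.norm_real, mul_one, Real.norm_eq_abs]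
  · have hre : (Complex.exp (φ * Complex.I)).re = Real.cos φ := Complex.exp_ofReal_mul_I_re φ
    have him : (Complex.exp (φ * Complex.I)).im = Real.sin φ := Complex.exp_ofReal_mul_I_im φ
    funext P i
    rw [hΦ, hΨ]
    fin_cases i
    · simp [simMap, proj]; ring
    · simp [simMap, proj, -Complex.exp_ofReal_mul_I_re, -Complex.exp_ofReal_mul_I_im, hre, him]; ring
    · simp [simMap, proj, -Complex.exp_ofReal_mul_I_re, -Complex.exp_ofReal_mul_I_im, hre, him]; ring

theorem simMap_surf (k : ℝ) (c : ℂ) (d : ℝ) (μ e : ℂ) (L W : ℂ → ℂ) (z : ℂ) :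
    simMap k c d μ e (surf L W z)
      = surf (fun z => k * L z + c * W z + d) (fun z => μ * W z + e) z := by
  funext i
  fin_cases i <;> simp [simMap, surf, proj]

/-! ### Constant Hopf differential: `η` determines the surface. -/

/-- Data `(F, η) = (h η, η)` whose Hopf differential `h' η dz²` is the real constant `ε`. -/
structure IsCanonical (U : Set ℂ) (ε : ℝ) (F η : ℂ → ℂ) : Prop where
  diffF : DifferentiableOn ℂ F U
  diffη : DifferentiableOn ℂ η U
  wronskian : ∀ z ∈ U, deriv F z * η z - F z * deriv η z = ε * η z

/-- Two holomorphic functions with vanishing Wronskian are proportional. -/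
theorem exists_eq_const_mul {U : Set ℂ} (hU : IsOpen U) (hc : IsPreconnected U) {G η : ℂ → ℂ}
    (hG : DifferentiableOn ℂ G U) (hη : DifferentiableOn ℂ η U)
    (hw : ∀ z ∈ U, deriv G z * η z - G z * deriv η z = 0) (hne : ∃ z ∈ U, η z ≠ 0) :
    ∃ c : ℂ, ∀ z ∈ U, G z = c * η z := by
  obtain ⟨z₀, hz₀, h0⟩ := hne
  have hnear : ∀ᶠ z in 𝓝 z₀, z ∈ U ∧ η z ≠ 0 :=
    (hU.eventually_mem hz₀).and ((hη.continuousOn.continuousAt (hU.mem_nhds hz₀)).eventually_ne h0)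
  obtain ⟨r, hr, hball⟩ := Metric.eventually_nhds_iff_ball.1 hnear
  refine ⟨G z₀ / η z₀, ?_⟩
  -- The quotient is constant on a ball where `η` has no zeros; the identity theorem carries the
  -- relation across the zeros of `η`.
  have hconst : ∀ z ∈ Metric.ball z₀ r, G z / η z = G z₀ / η z₀ := by
    intro z hz
    refine Metric.isOpen_ball.is_const_of_deriv_eq_zero (f := fun z => G z / η z)
      (convex_ball z₀ r).isPreconnected ?_ ?_ hz (Metric.mem_ball_self hr)
    · intro w hw
      exact ((hG.differentiableAt (hU.mem_nhds (hball w hw).1)).div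
        (hη.differentiableAt (hU.mem_nhds (hball w hw).1)) (hball w hw).2).differentiableWithinAt
    · intro w hw'
      obtain ⟨h1, h2⟩ := hball w hw'
      have := deriv_fun_div (hG.differentiableAt (hU.mem_nhds h1))
        (hη.differentiableAt (hU.mem_nhds h1)) h2
      rw [this, hw w h1, zero_div]; rfl
  have hev : G =ᶠ[𝓝 z₀] fun z => G z₀ / η z₀ * η z := by
    filter_upwards [Metric.ball_mem_nhds z₀ hr] with z hz
    rw [← hconst z hz, div_mul_cancel₀ _ (hball z hz).2]
  exact (hG.analyticOnNhd hU).eqOn_of_preconnected_of_eventuallyEq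
    ((hη.const_mul _).analyticOnNhd hU) hc hz₀ hev

theorem exists_eq_add_const {U : Set ℂ} (hU : IsOpen U) (hc : IsPreconnected U)
    {P Q P' : ℂ → ℂ} (hP : ∀ z ∈ U, HasDerivAt P (P' z) z) (hQ : ∀ z ∈ U, HasDerivAt Q (P' z) z) :
    ∃ e : ℂ, ∀ z ∈ U, P z = Q z + e := by
  obtain ⟨e, he⟩ := hU.exists_is_const_of_deriv_eq_zero (f := fun z => P z - Q z) hc
    (fun z hz => ((hP z hz).fun_sub (hQ z hz)).differentiableAt.differentiableWithinAt)
    (fun z hz => by rw [((hP z hz).fun_sub (hQ z hz)).deriv]; simp)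
  exact ⟨e, fun z hz => by rw [← he z hz]; ring⟩

/-- Surfaces with constant Hopf differential are determined, up to similarity, by `η`, up to a
constant factor and an affine change of the parameter. -/
theorem IsCanonical.exists_similarity {U : Set ℂ} (hU : IsOpen U) (hc : IsPreconnected U)
    {ε ε₁ : ℝ} (hε : ε ≠ 0) (hε₁ : ε₁ ≠ 0) {F η F₁ η₁ L W L₁ W₁ : ℂ → ℂ}
    (h : IsCanonical U ε F η) (h₁ : IsCanonical univ ε₁ F₁ η₁) {a b ν : ℂ} (ha0 : a ≠ 0)
    (ha : (a ^ 2).im = 0) (hν : ‖ν‖ * ‖a‖ * |ε₁| = |ε|) (hη : ∀ z ∈ U, η z = ν * η₁ (a * z + b))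
    (hne : ∃ z ∈ U, η z ≠ 0) (hL : ∀ z ∈ U, HasDerivAt L (F z) z)
    (hW : ∀ z ∈ U, HasDerivAt W (η z) z) (hL₁ : ∀ z, HasDerivAt L₁ (F₁ z) z)
    (hW₁ : ∀ z, HasDerivAt W₁ (η₁ z) z) :
    ∃ Φ, IsSimilarity Φ ∧ ∀ z ∈ U, surf L W z = Φ (surf L₁ W₁ (a * z + b)) := by
  have hεc : (ε : ℂ) ≠ 0 := by exact_mod_cast hε
  have hε₁c : (ε₁ : ℂ) ≠ 0 := by exact_mod_cast hε₁
  have hlin : ∀ z : ℂ, HasDerivAt (fun z => a * z + b) a z := fun z => by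
    simpa using ((hasDerivAt_id z).const_mul a).add_const b
  have hF₁ : ∀ z, HasDerivAt (fun z => F₁ (a * z + b)) (deriv F₁ (a * z + b) * a) z := fun z =>
    ((h₁.diffF.differentiableAt univ_mem).hasDerivAt).comp z (hlin z)
  have hη₁ : ∀ z, HasDerivAt (fun z => η₁ (a * z + b)) (deriv η₁ (a * z + b) * a) z := fun z =>
    ((h₁.diffη.differentiableAt univ_mem).hasDerivAt).comp z (hlin z)
  -- The factor `ε / (aε₁)` makes the Wronskians with `η` cancel, so the difference is a multiple of
  -- `η`; this multiple becomes the shear of the similarity.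
  obtain ⟨c, hcF⟩ : ∃ c : ℂ, ∀ z ∈ U, F z - ε / (a * ε₁) * F₁ (a * z + b) = c * η z := by
    refine exists_eq_const_mul hU hc (h.diffF.sub ?_) h.diffη ?_ hne
    · exact fun z _ => ((hF₁ z).const_mul _).differentiableAt.differentiableWithinAt
    · intro z hz
      have hFz := (h.diffF.differentiableAt (hU.mem_nhds hz)).hasDerivAt
      have e : deriv η z = ν * (deriv η₁ (a * z + b) * a) := by
        have : η =ᶠ[𝓝 z] fun z => ν * η₁ (a * z + b) :=
          eventually_of_mem (hU.mem_nhds hz) hη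
        rw [this.deriv_eq, ((hη₁ z).const_mul ν).deriv]
      rw [(hFz.fun_sub ((hF₁ z).const_mul _)).deriv]
      have w0 := h.wronskian z hz
      have w1 := h₁.wronskian (a * z + b) (mem_univ _)
      rw [e, hη z hz] at w0 ⊢
      have h2 : (ε : ℂ) / (a * ε₁) * a * ε₁ = ε := by field_simp
      linear_combination w0 - ε / (a * ε₁) * a * ν * w1 - ν * η₁ (a * z + b) * h2
  obtain ⟨e, he⟩ := exists_eq_add_const hU hc (P := W) (Q := fun z => ν / a * W₁ (a * z + b)) hW
    (fun z hz => by
      refine (((hW₁ (a * z + b)).comp z (hlin z)).const_mul (ν / a)).congr_deriv ?_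
      rw [hη z hz]; field_simp)
  -- The height is scaled by `ε / (ε₁a²)`, which is real because `a²` is; the hypothesis `hν` says
  -- that the projection is scaled by the same modulus, `|ν/a| = |k|`.
  set k : ℝ := ε / (ε₁ * (a ^ 2).re) with hk
  have ha2 : ((a ^ 2).re : ℂ) = a ^ 2 := by
    apply Complex.ext <;> simp [ha]
  have ha2' : (a ^ 2).re ≠ 0 := by
    intro h0
    rw [h0] at ha2
    exact pow_ne_zero 2 ha0 (by simpa using ha2.symm)
  have hkc : (k : ℂ) = ε / (ε₁ * a ^ 2) := by
    rw [hk]; push_cast; rw [ha2]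
  obtain ⟨d, hd⟩ := exists_eq_add_const hU hc (P := L)
    (Q := fun z => k * L₁ (a * z + b) + c * W z) hL (fun z hz => by
      refine ((((hL₁ (a * z + b)).comp z (hlin z)).const_mul (k : ℂ)).add
        ((hW z hz).const_mul c)).congr_deriv ?_
      rw [← hcF z hz, hkc]; field_simp; ring)
  refine ⟨simMap k (c * (ν / a)) ((c * e).re + d.re) (ν / a) e, isSimilarity_simMap ?_ ?_ _ _ _,
    fun z hz => ?_⟩
  · exact div_ne_zero hε (mul_ne_zero hε₁ ha2')
  · have hn : |(a ^ 2).re| = ‖a‖ ^ 2 := by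
      rw [← norm_pow, ← Real.norm_eq_abs, ← Complex.norm_real, ha2]
    have ha0' := norm_ne_zero_iff.2 ha0
    rw [hk, abs_div, abs_mul, hn, norm_div, ← hν]
    field_simp
  · rw [simMap_surf]
    have h1 := hd z hz
    have h2 := he z hz
    funext i
    fin_cases i
    · simp [surf, h1, h2]; ring
    · simp [surf, h2]
    · simp [surf, h2]

/-! The surfaces with constant Hopf differential -/

theorem contDiff_surf {L W F η : ℂ → ℂ} (hL : ∀ z, HasDerivAt L (F z) z)
    (hW : ∀ z, HasDerivAt W (η z) z) : ContDiff ℝ ∞ (surf L W) := by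
  have h1 : ContDiff ℝ ∞ L :=
    (Differentiable.contDiff (n := ∞) fun z => (hL z).differentiableAt).restrict_scalars ℝ
  have h2 : ContDiff ℝ ∞ W :=
    (Differentiable.contDiff (n := ∞) fun z => (hW z).differentiableAt).restrict_scalars ℝ
  rw [contDiff_pi]
  intro i
  fin_cases i
  · exact Complex.reCLM.contDiff.comp h1
  · exact Complex.reCLM.contDiff.comp h2
  · exact Complex.imCLM.contDiff.comp h2

/-- Allows a factor `η` to be cancelled from differential identities although `η` may have zeros. -/
theorem eq_zero_of_mul_eq_zero {G η : ℂ → ℂ} (hG : Differentiable ℂ G) (hη : Continuous η)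
    (hne : ∃ z, η z ≠ 0) (h : ∀ z, G z * η z = 0) (z : ℂ) : G z = 0 := by
  obtain ⟨z₀, h0⟩ := hne
  have hev : G =ᶠ[𝓝 z₀] 0 := by
    filter_upwards [hη.continuousAt.eventually_ne h0] with w hw
    exact (mul_eq_zero.1 (h w)).resolve_right hw
  exact (hG.differentiableOn.analyticOnNhd isOpen_univ).eqOn_zero_of_preconnected_of_eventuallyEq_zero
    isPreconnected_univ (mem_univ z₀) hev (mem_univ z)

/-- The zeros are discrete, hence countable, and removing a countable set from the real plane leaves
it connected. -/
theorem isConnected_ne_zero {η : ℂ → ℂ} (hη : Differentiable ℂ η) (hne : ∃ z, η z ≠ 0) :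
    IsConnected {z | η z ≠ 0} := by
  obtain ⟨z₀, h0⟩ := hne
  have hcod : η ⁻¹' {0}ᶜ ∈ codiscreteWithin (univ : Set ℂ) :=
    (hη.differentiableOn.analyticOnNhd isOpen_univ).preimage_zero_mem_codiscreteWithin h0
      (mem_univ _) isConnected_univ
  have hcount : {z | η z = 0}.Countable := by
    have h2 := mem_codiscrete'.1 hcod
    have : IsDiscrete {z | η z = 0} := by
      convert h2.2 using 1
      ext z; simp
    exact (HereditarilyLindelofSpace.isLindelof _).countable_of_isDiscrete this
  have := hcount.isConnected_compl_of_one_lt_rank (by rw [Complex.rank_real_complex]; norm_num)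
  exact this

/-- Uniqueness for the Lipschitz first-order system of `(y, y')`. -/
theorem eq_zero_of_deriv2_eq {lam : ℝ} {y y' : ℝ → ℝ} (hy : ∀ s, HasDerivAt y (y' s) s)
    (hy' : ∀ s, HasDerivAt y' (lam * y s) s) (h0 : y 0 = 0) (h0' : y' 0 = 0) (s : ℝ) : y s = 0 := by
  have hlip : ∀ _t : ℝ, LipschitzOnWith (max 1 ‖lam‖₊) (fun p : ℝ × ℝ => (p.2, lam * p.1)) univ := by
    intro _
    have h1 : LipschitzWith 1 (fun p : ℝ × ℝ => p.2) := LipschitzWith.prod_snd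
    have h2 : LipschitzWith ‖lam‖₊ (fun p : ℝ × ℝ => lam * p.1) := by
      have := (lipschitzWith_smul lam).comp (LipschitzWith.prod_fst (α := ℝ) (β := ℝ))
      simpa using! this
    exact (h1.prodMk h2).lipschitzOnWith
  have key := ODE_solution_unique_univ (v := fun _ p => (p.2, lam * p.1)) (s := fun _ => univ)
    (f := fun s => (y s, y' s)) (g := fun _ => (0, 0)) (t₀ := 0) hlip
    (fun t => ⟨(hy t).prodMk (hy' t), mem_univ _⟩)
    (fun t => ⟨by simpa using! hasDerivAt_const t ((0 : ℝ), (0 : ℝ)), mem_univ _⟩) (by simp [h0, h0'])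
  exact congrArg Prod.fst (congrFun key s)

theorem differentiable_deriv {f : ℂ → ℂ} (hf : Differentiable ℂ f) : Differentiable ℂ (deriv f) :=
  fun _ => (hf.differentiableOn.deriv isOpen_univ).differentiableAt univ_mem

/-- Differentiating the equation `η'' η - η'² / 2 = K η²`. -/
theorem deriv3_eq {η : ℂ → ℂ} (hη : Differentiable ℂ η) (hne : ∃ z, η z ≠ 0) {K : ℂ}
    (hK : ∀ z, deriv (deriv η) z * η z - deriv η z ^ 2 / 2 = K * η z ^ 2) (z : ℂ) :
    deriv (deriv (deriv η)) z = 2 * K * deriv η z := by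
  have h1 := differentiable_deriv hη
  have h2 := differentiable_deriv h1
  have h3 := differentiable_deriv h2
  have := eq_zero_of_mul_eq_zero (G := fun z => deriv (deriv (deriv η)) z - 2 * K * deriv η z)
    (h3.sub (h1.const_mul _)) hη.continuous hne ?_ z
  · exact sub_eq_zero.1 this
  · intro z
    have e : (fun z => deriv (deriv η) z * η z - deriv η z ^ 2 / 2) = fun z => K * η z ^ 2 :=
      funext hK
    have d1 := (((h2 z).hasDerivAt.mul (hη z).hasDerivAt).fun_sub
      (((h1 z).hasDerivAt.fun_pow 2).div_const 2))
    have d2 := ((hη z).hasDerivAt.fun_pow 2).const_mul K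
    have := (e ▸ d1).unique d2
    push_cast at this
    linear_combination this

/-- The combinations of `F` and `η` satisfy the same linear equation of third order as `η`. -/
theorem deriv3_comb {F η : ℂ → ℂ} {ε : ℝ} (h : IsCanonical univ ε F η) (hne : ∃ z, η z ≠ 0) {K : ℂ}
    (hK : ∀ z, deriv (deriv η) z * η z - deriv η z ^ 2 / 2 = K * η z ^ 2) (c₀ c : ℂ) {P : ℂ → ℂ}
    (hP : P = fun z => c₀ * F z + c * η z) (z : ℂ) :
    deriv P z * η z = c₀ * ε * η z + P z * deriv η z ∧
    deriv (deriv P) z * η z = c₀ * ε * deriv η z + P z * deriv (deriv η) z ∧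
    deriv (deriv (deriv P)) z = 2 * K * deriv P z := by
  have hF : Differentiable ℂ F := differentiableOn_univ.1 h.diffF
  have hη : Differentiable ℂ η := differentiableOn_univ.1 h.diffη
  have dP : Differentiable ℂ P := hP ▸ (hF.const_mul c₀).add (hη.const_mul c)
  have h1 := differentiable_deriv hη
  have h2 := differentiable_deriv h1
  have p1 := differentiable_deriv dP
  have p2 := differentiable_deriv p1
  have p3 := differentiable_deriv p2
  have e1 : ∀ z, deriv P z * η z = c₀ * ε * η z + P z * deriv η z := by
    intro z
    have := h.wronskian z (mem_univ z)
    rw [hP, (((hF z).hasDerivAt.const_mul c₀).fun_add ((hη z).hasDerivAt.const_mul c)).deriv]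
    linear_combination c₀ * this
  have e2 : ∀ z, deriv (deriv P) z * η z = c₀ * ε * deriv η z + P z * deriv (deriv η) z := by
    intro z
    have d1 := (p1 z).hasDerivAt.fun_mul (hη z).hasDerivAt
    have d2 := ((hη z).hasDerivAt.const_mul (c₀ * ε)).fun_add
      ((dP z).hasDerivAt.fun_mul (h1 z).hasDerivAt)
    have e : (fun z => deriv P z * η z) = fun z => c₀ * ε * η z + P z * deriv η z := funext e1
    have := (e ▸ d1).unique d2
    linear_combination this
  refine ⟨e1 z, e2 z, ?_⟩
  have := eq_zero_of_mul_eq_zero (G := fun z => deriv (deriv (deriv P)) z - 2 * K * deriv P z)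
    (η := fun z => η z ^ 2) (p3.sub (p1.const_mul _)) (hη.continuous.pow 2)
    (hne.imp fun z hz => pow_ne_zero 2 hz) ?_ z
  · exact sub_eq_zero.1 this
  · intro z
    have d1 := (p2 z).hasDerivAt.fun_mul (hη z).hasDerivAt
    have d2 := ((h1 z).hasDerivAt.const_mul (c₀ * ε)).fun_add
      ((dP z).hasDerivAt.fun_mul (h2 z).hasDerivAt)
    have e : (fun z => deriv (deriv P) z * η z)
        = fun z => c₀ * ε * deriv η z + P z * deriv (deriv η) z := funext e2
    have e3 := (e ▸ d1).unique d2
    have e4 := deriv3_eq hη hne hK z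
    rw [e4] at e3
    linear_combination η z * e3 + (deriv (deriv η) z - 2 * K * η z) * e1 z - deriv η z * e2 z
      + 2 * c₀ * ε * hK z

theorem hasDerivAt_comp_line {G G' : ℂ → ℂ} (hG : ∀ z, HasDerivAt G (G' z) z) (z₀ d : ℂ) (s : ℝ) :
    HasDerivAt (fun s : ℝ => G (z₀ + d * s)) (d * G' (z₀ + d * s)) s := by
  have h1 : HasDerivAt (fun s : ℝ => z₀ + d * s) d s := by
    simpa using ((Complex.ofRealCLM.hasDerivAt (x := s)).const_mul d).const_add z₀
  simpa [mul_comm] using! (hG _).comp s h1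

theorem hasDerivAt_re_comp {f : ℝ → ℂ} {f' : ℂ} {s : ℝ} (h : HasDerivAt f f' s) :
    HasDerivAt (fun s => (f s).re) f'.re s := by
  simpa using! Complex.reCLM.hasFDerivAt.comp_hasDerivAt s h

/-- Along every line in a principal direction, the velocity of the surface stays in a plane. -/
theorem exists_linear_relation {F η : ℂ → ℂ} {ε : ℝ} (hε : ε ≠ 0) (h : IsCanonical univ ε F η)
    {K : ℝ} (hK : ∀ z, deriv (deriv η) z * η z - deriv η z ^ 2 / 2 = K * η z ^ 2) {d z₀ : ℂ}
    (hd0 : d ≠ 0) (hd : (d ^ 2).im = 0) (h0 : η z₀ ≠ 0) :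
    ∃ (c₀ : ℝ) (c : ℂ), (c₀ ≠ 0 ∨ c ≠ 0) ∧
      ∀ s : ℝ, (d * (c₀ * F (z₀ + d * s) + c * η (z₀ + d * s))).re = 0 := by
  obtain ⟨δ, hδ⟩ : ∃ δ : ℝ, d ^ 2 = δ := ⟨(d ^ 2).re, by apply Complex.ext <;> simp [hd]⟩
  have hδ0 : δ ≠ 0 := by
    rintro rfl
    exact pow_ne_zero 2 hd0 (by simpa using hδ)
  set q : ℂ := d * deriv η z₀ / η z₀ with hq
  set c₀ : ℝ := q.im / (δ * ε) with hc₀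
  have hc₀' : c₀ * ε * δ = q.im := by rw [hc₀]; field_simp
  set c : ℂ := Complex.I / (d * η z₀) - c₀ * F z₀ / η z₀ with hc
  have hne : ∃ z, η z ≠ 0 := ⟨z₀, h0⟩
  obtain ⟨P, hP⟩ : ∃ P : ℂ → ℂ, P = fun z => c₀ * F z + c * η z := ⟨_, rfl⟩
  have hF : Differentiable ℂ F := differentiableOn_univ.1 h.diffF
  have hη : Differentiable ℂ η := differentiableOn_univ.1 h.diffη
  have dP : Differentiable ℂ P := hP ▸ (hF.const_mul _).add (hη.const_mul c)
  have p1 := differentiable_deriv dP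
  have p2 := differentiable_deriv p1
  obtain ⟨e1, e2, -⟩ := deriv3_comb h hne hK c₀ c hP z₀
  have e3 := fun z => (deriv3_comb h hne hK c₀ c hP z).2.2
  have hP0 : P z₀ = Complex.I / d := by
    rw [hP, hc]; field_simp; ring
  have r0 : (d * P z₀).re = 0 := by
    rw [hP0, mul_div_cancel₀ _ hd0]; simp
  have v1 : deriv P z₀ * d ^ 2 = c₀ * ε * δ + Complex.I * q := by
    apply mul_right_cancel₀ h0
    rw [hP0] at e1
    rw [hq, ← hδ]
    field_simp
    field_simp at e1
    linear_combination e1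
  have v2 : deriv (deriv P) z₀ * d ^ 3 = c₀ * ε * δ * q + Complex.I * (δ * K + q ^ 2 / 2) := by
    apply mul_right_cancel₀ (pow_ne_zero 2 h0)
    have hk := hK z₀
    rw [hP0] at e2
    rw [hq, ← hδ]
    field_simp
    field_simp at e2 hk
    linear_combination 2 * η z₀ * e2 + Complex.I * hk
  have r1 : (d * (d * deriv P z₀)).re = 0 := by
    have : d * (d * deriv P z₀) = ((c₀ * ε * δ : ℝ) : ℂ) + Complex.I * q := by
      push_cast; rw [← v1]; ring
    rw [this, hc₀']; simp
  -- The third condition comes for free: its left side is `Im q · Re q - Im(q²)/2 = 0`, where `δK`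
  -- drops out because it is real.
  have r2 : (d * (d * (d * deriv (deriv P) z₀))).re = 0 := by
    have : d * (d * (d * deriv (deriv P) z₀))
        = ((c₀ * ε * δ : ℝ) : ℂ) * q + Complex.I * (((δ * K : ℝ) : ℂ) + q ^ 2 / 2) := by
      push_cast; rw [← v2]; ring
    rw [this, hc₀']; simp [pow_two]; ring
  have y0 : ∀ s : ℝ, HasDerivAt (fun s : ℝ => (d * P (z₀ + d * s)).re)
      (d * (d * deriv P (z₀ + d * s))).re s := fun s =>
    hasDerivAt_re_comp ((hasDerivAt_comp_line (fun z => (dP z).hasDerivAt) z₀ d s).const_mul d)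
  have y1 : ∀ s : ℝ, HasDerivAt (fun s : ℝ => (d * (d * deriv P (z₀ + d * s))).re)
      (d * (d * (d * deriv (deriv P) (z₀ + d * s)))).re s := fun s =>
    hasDerivAt_re_comp (((hasDerivAt_comp_line (fun z => (p1 z).hasDerivAt) z₀ d s).const_mul
      d).const_mul d)
  have y2 : ∀ s : ℝ, HasDerivAt (fun s : ℝ => (d * (d * (d * deriv (deriv P) (z₀ + d * s)))).re)
      (2 * K * δ * (d * (d * deriv P (z₀ + d * s))).re) s := fun s => by
    refine (hasDerivAt_re_comp (((((hasDerivAt_comp_line (fun z => (p2 z).hasDerivAt) z₀ d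
      s).const_mul d).const_mul d).const_mul d))).congr_deriv ?_
    rw [e3, ← Complex.re_ofReal_mul]
    congr 1
    push_cast
    rw [← hδ]; ring
  -- `y'` solves a second-order linear equation with zero initial data, so `y` is constant.
  have z1 := eq_zero_of_deriv2_eq y1 y2 (by simpa using r1) (by simpa using r2)
  refine ⟨c₀, c, ?_, fun s => ?_⟩
  · by_contra! hcon
    rw [hcon.1, hcon.2] at hc
    have := hc.symm
    simp [hd0, h0] at this
  · have := is_const_of_deriv_eq_zero (fun s => (y0 s).differentiableAt)
      (fun s => by rw [(y0 s).deriv, z1]) s 0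
    simp only [hP] at this
    rw [this]
    simpa [hP] using r0

theorem inPlane_of_re {A : Set I3} {c₀ : ℝ} {c : ℂ} (hc : c₀ ≠ 0 ∨ c ≠ 0) {d : ℝ}
    (h : ∀ P ∈ A, c₀ * P 0 + (c * proj P).re = d) : InPlane A := by
  refine ⟨![c₀, c.re, -c.im], ?_, d, fun P hP => ?_⟩
  · intro h0
    have h1 := congrFun h0 0
    have h2 := congrFun h0 1
    have h3 := congrFun h0 2
    simp at h1 h2 h3
    rcases hc with hc | hc
    · exact hc h1
    · exact hc (Complex.ext h2 h3)
  · rw [← h P hP]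
    simp [Fin.sum_univ_three, proj]; ring

theorem InPlane.exists_re {A : Set I3} (h : InPlane A) :
    ∃ (c₀ : ℝ) (c : ℂ) (d : ℝ), (c₀ ≠ 0 ∨ c ≠ 0) ∧ ∀ P ∈ A, c₀ * P 0 + (c * proj P).re = d := by
  obtain ⟨c, hc, d, h⟩ := h
  refine ⟨c 0, ⟨c 1, -c 2⟩, d, ?_, fun P hP => ?_⟩
  · by_contra! hcon
    apply hc
    have h1 := congrArg Complex.re hcon.2
    have h2 := congrArg Complex.im hcon.2
    simp at h1 h2
    funext i
    fin_cases i
    · exact hcon.1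
    · exact h1
    · exact h2
  · rw [← h P hP]
    simp [Fin.sum_univ_three, proj]; ring

/-- A regular plane curve all of whose tangents are horizontal or vertical lies on a line. -/
theorem exists_line_of_deriv {γ : ℝ → ℂ} {a b : ℝ} (hγ : ContDiffOn ℝ ∞ γ (Ioo a b))
    (h0 : ∀ s ∈ Ioo a b, deriv γ s ≠ 0)
    (h : ∀ s ∈ Ioo a b, (deriv γ s).re = 0 ∨ (deriv γ s).im = 0) {s₀ : ℝ} (hs₀ : s₀ ∈ Ioo a b) :
    ∃ d : ℂ, d ≠ 0 ∧ (d ^ 2).im = 0 ∧ ∀ s ∈ Ioo a b, ∃ τ : ℝ, γ s = γ s₀ + d * τ := by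
  have hc : ContinuousOn (deriv γ) (Ioo a b) :=
    hγ.continuousOn_deriv_of_isOpen isOpen_Ioo (by simp)
  have hdγ : ∀ s ∈ Ioo a b, HasDerivAt γ (deriv γ s) s := fun s hs =>
    ((hγ.differentiableOn (by simp)).differentiableAt (isOpen_Ioo.mem_nhds hs)).hasDerivAt
  have hu : IsOpen (Ioo a b ∩ deriv γ ⁻¹' {w | w.re ≠ 0}) :=
    hc.isOpen_inter_preimage isOpen_Ioo (isOpen_ne.preimage Complex.continuous_re)
  have hv : IsOpen (Ioo a b ∩ deriv γ ⁻¹' {w | w.im ≠ 0}) :=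
    hc.isOpen_inter_preimage isOpen_Ioo (isOpen_ne.preimage Complex.continuous_im)
  have hdis : Disjoint (Ioo a b ∩ deriv γ ⁻¹' {w | w.re ≠ 0})
      (Ioo a b ∩ deriv γ ⁻¹' {w | w.im ≠ 0}) := by
    rw [Set.disjoint_left]
    rintro s ⟨hs, h1⟩ ⟨-, h2⟩
    exact (h s hs).elim h1 h2
  have hcov : Ioo a b ⊆ (Ioo a b ∩ deriv γ ⁻¹' {w | w.re ≠ 0})
      ∪ (Ioo a b ∩ deriv γ ⁻¹' {w | w.im ≠ 0}) := by
    intro s hs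
    by_cases h1 : (deriv γ s).re = 0
    · exact Or.inr ⟨hs, fun h2 => h0 s hs (Complex.ext h1 h2)⟩
    · exact Or.inl ⟨hs, h1⟩
  -- An interval is not a union of two nonempty disjoint open sets, so the velocity is horizontal
  -- throughout or vertical throughout.
  rcases isPreconnected_Ioo.subset_or_subset hu hv hdis hcov with hs | hs
  · refine ⟨1, one_ne_zero, by simp, fun s hss => ⟨(γ s - γ s₀).re, ?_⟩⟩
    have him : (γ s).im = (γ s₀).im := by
      refine isOpen_Ioo.is_const_of_deriv_eq_zero (f := fun s => (γ s).im) isPreconnected_Ioo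
        (fun t ht => ?_) (fun t ht => ?_) hss hs₀
      · exact (Complex.imCLM.hasFDerivAt.comp_hasDerivAt t
          (hdγ t ht)).differentiableAt.differentiableWithinAt
      · have := (Complex.imCLM.hasFDerivAt.comp_hasDerivAt t (hdγ t ht)).deriv
        have h2 : (deriv γ t).im = 0 := (h t ht).resolve_left (hs ht).2
        simpa [h2] using! this
    apply Complex.ext <;> simp [him]
  · refine ⟨Complex.I, Complex.I_ne_zero, by simp, fun s hss => ⟨(γ s - γ s₀).im, ?_⟩⟩
    have hre : (γ s).re = (γ s₀).re := by
      refine isOpen_Ioo.is_const_of_deriv_eq_zero (f := fun s => (γ s).re) isPreconnected_Ioo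
        (fun t ht => ?_) (fun t ht => ?_) hss hs₀
      · exact (Complex.reCLM.hasFDerivAt.comp_hasDerivAt t
          (hdγ t ht)).differentiableAt.differentiableWithinAt
      · have := (Complex.reCLM.hasFDerivAt.comp_hasDerivAt t (hdγ t ht)).deriv
        have h2 : (deriv γ t).re = 0 := (h t ht).resolve_right (hs ht).2
        simpa [h2] using! this
    apply Complex.ext <;> simp [hre]

theorem secondForm_surf_canonical {U : Set ℂ} (hU : IsOpen U) {L W F η : ℂ → ℂ} {ε : ℝ}
    (h : IsCanonical U ε F η) (hL : ∀ z ∈ U, HasDerivAt L (F z) z)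
    (hW : ∀ z ∈ U, HasDerivAt W (η z) z) {z : ℂ} (hz : z ∈ U) (h0 : η z ≠ 0) (ξ ζ : ℂ) :
    secondForm (surf L W) z ξ ζ = ε * (ξ.re * ζ.re - ξ.im * ζ.im) := by
  rw [secondForm_surf (eventually_of_mem (hU.mem_nhds hz) hL)
    (eventually_of_mem (hU.mem_nhds hz) hW)
    ((h.diffF.differentiableAt (hU.mem_nhds hz)).hasDerivAt)
    ((h.diffη.differentiableAt (hU.mem_nhds hz)).hasDerivAt) h0]
  have : deriv F z - F z / η z * deriv η z = ε := by
    have := h.wronskian z hz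
    field_simp
    linear_combination this
  rw [this, Complex.re_ofReal_mul, Complex.mul_re]

theorem isZMCWithPlanarLines_surf {F η L W : ℂ → ℂ} {ε : ℝ} (hε : ε ≠ 0)
    (h : IsCanonical univ ε F η) (hne : ∃ z, η z ≠ 0) {K : ℝ}
    (hK : ∀ z, deriv (deriv η) z * η z - deriv η z ^ 2 / 2 = K * η z ^ 2)
    (hL : ∀ z, HasDerivAt L (F z) z) (hW : ∀ z, HasDerivAt W (η z) z) :
    IsZMCWithPlanarLines {z | η z ≠ 0} (surf L W) := by
  have hη : Differentiable ℂ η := differentiableOn_univ.1 h.diffη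
  have hopen : IsOpen {z | η z ≠ 0} := isOpen_ne.preimage hη.continuous
  have second : ∀ z, η z ≠ 0 → ∀ ξ ζ,
      secondForm (surf L W) z ξ ζ = ε * (ξ.re * ζ.re - ξ.im * ζ.im) := fun z hz =>
    secondForm_surf_canonical isOpen_univ h (fun z _ => hL z) (fun z _ => hW z) (mem_univ z) hz
  refine ⟨hopen, isConnected_ne_zero hη hne, ⟨(contDiff_surf hL hW).contDiffOn, ?_⟩, ?_, ?_, ?_⟩
  · exact fun z hz => firstForm_surf_pos (hL z) (hW z) hz
  · intro z hz
    simp [meanCurvature, second z hz, firstForm_surf (hL z) (hW z)]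
  · intro γ a b hγ
    rcases (Ioo a b).eq_empty_or_nonempty with he | ⟨s₀, hs₀⟩
    · exact inPlane_of_re (c₀ := 1) (c := 0) (d := 0) (Or.inl one_ne_zero) (by simp [he])
    obtain ⟨d, hd0, hd, hline⟩ := exists_line_of_deriv hγ.1 (fun s hs => (hγ.2 s hs).2.2.1) (by
      intro s hs
      obtain ⟨hz, -, -, κ, hκ⟩ := hγ.2 s hs
      have h1 := hκ 1
      have h2 := hκ Complex.I
      rw [second _ hz, firstForm_surf (hL _) (hW _)] at h1 h2
      simp at h1 h2
      -- With both components of the velocity nonzero, `κ|η|²` would equal both `ε` and `-ε`.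
      by_contra! hcon
      have e1 : ε = κ * Complex.normSq (η (γ s)) := by
        apply mul_right_cancel₀ hcon.1; linear_combination h1
      have e2 : -ε = κ * Complex.normSq (η (γ s)) := by
        apply mul_right_cancel₀ hcon.2; linear_combination h2
      exact hε (by linarith)) hs₀
    obtain ⟨c₀, c, hc, hrel⟩ := exists_linear_relation hε h hK hd0 hd (hγ.2 s₀ hs₀).1
    have hder : ∀ t : ℝ, HasDerivAt
        (fun t : ℝ => (c₀ * L (γ s₀ + d * t) + c * W (γ s₀ + d * t)).re) 0 t := fun t => by
      refine (hasDerivAt_re_comp (((hasDerivAt_comp_line hL (γ s₀) d t).const_mul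
        (c₀ : ℂ)).add ((hasDerivAt_comp_line hW (γ s₀) d t).const_mul c))).congr_deriv ?_
      rw [← hrel t]
      ring_nf
    refine inPlane_of_re hc (d := (c₀ * L (γ s₀) + c * W (γ s₀)).re) ?_
    rintro _ ⟨s, hs, rfl⟩
    obtain ⟨τ, hτ⟩ := hline s hs
    have := is_const_of_deriv_eq_zero (fun t => (hder t).differentiableAt)
      (fun t => (hder t).deriv) τ 0
    simp only [← hτ, Complex.ofReal_zero, mul_zero, add_zero] at this
    rw [← this]
    simp [surf, proj]
  · intro hplane
    obtain ⟨c₀, c, d, hc, hP⟩ := hplane.exists_re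
    obtain ⟨z₀, hz₀⟩ := hne
    have hG : ∀ z, HasDerivAt (fun z => c₀ * L z + c * W z) (c₀ * F z + c * η z) z := fun z =>
      ((hL z).const_mul (c₀ : ℂ)).fun_add ((hW z).const_mul c)
    have hre : ∀ z, η z ≠ 0 → (c₀ * L z + c * W z).re = d := fun z hz => by
      rw [← hP _ ⟨z, hz, rfl⟩]; simp [surf, proj]
    have hvel : ∀ z, η z ≠ 0 → c₀ * F z + c * η z = 0 := by
      intro z hz
      have h1 := Complex.reCLM.hasFDerivAt.comp z ((hG z).hasFDerivAt.restrictScalars ℝ)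
      have h2 : HasFDerivAt (fun _ : ℂ => d) (0 : ℂ →L[ℝ] ℝ) z := hasFDerivAt_const d z
      have h3 := h1.unique (h2.congr_of_eventuallyEq (eventually_of_mem (hopen.mem_nhds hz) hre))
      have h4 := DFunLike.congr_fun h3 1
      have h5 := DFunLike.congr_fun h3 Complex.I
      apply Complex.ext
      · simpa using h4
      · simp at h5 ⊢
        linarith
    have hvel' : (fun z => c₀ * F z + c * η z) =ᶠ[𝓝 z₀] fun _ => 0 :=
      eventually_of_mem (hopen.mem_nhds hz₀) hvel
    -- If `c₀F + cη` vanishes near `z₀`, the Wronskian identity reduces to `c₀εη = 0`, forcing `c₀ =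
    -- 0` and then `c = 0`.
    have h1 := (deriv3_comb h ⟨z₀, hz₀⟩ hK c₀ c rfl z₀).1
    rw [hvel'.deriv_eq, hvel z₀ hz₀] at h1
    have hc₀ : c₀ = 0 := by
      simpa [hε, hz₀] using h1
    have := hvel z₀ hz₀
    rw [hc₀] at this
    simp [hz₀] at this
    exact hc.elim (fun h => h hc₀) (fun h => h this)

/-! ### Data built from solutions of `f'' = κ f`. -/

/-- Weierstrass data `(h, η) = (g / f, C f²)` with entire functions `f`, `g` such that
`f'' = κ f` and `C (g' f - g f') = ε`. -/
def IsSpinorial (ε κ : ℝ) (h η : ℂ → ℂ) : Prop :=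
  ∃ (C : ℂ) (f f' g g' : ℂ → ℂ), C ≠ 0 ∧ (∀ z, HasDerivAt f (f' z) z) ∧
    (∀ z, HasDerivAt f' (κ * f z) z) ∧ (∀ z, HasDerivAt g (g' z) z) ∧
    (∀ z, C * (g' z * f z - g z * f' z) = ε) ∧ (∀ z, h z = g z / f z) ∧ ∀ z, η z = C * f z ^ 2

namespace IsSpinorial

variable {ε κ : ℝ} {h η : ℂ → ℂ}

theorem exists_ne_zero (hε : ε ≠ 0) (H : IsSpinorial ε κ h η) : ∃ z, η z ≠ 0 := by
  obtain ⟨C, f, f', g, g', hC, hf, hf', hg, hw, hh, hη⟩ := H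
  by_contra! hcon
  have hf0 : ∀ z, f z = 0 := fun z => by
    have := hcon z
    rw [hη z] at this
    simpa [hC] using this
  have h1 : f' 0 = 0 := by
    have := (hf 0).unique ((hasDerivAt_const (0 : ℂ) (0 : ℂ)).congr_of_eventuallyEq
      (Eventually.of_forall hf0))
    exact this
  have := hw 0
  rw [hf0, h1] at this
  simp at this
  exact hε (by exact_mod_cast this.symm)

theorem mul_eq (H : IsSpinorial ε κ h η) : ∃ (C : ℂ) (f f' g g' : ℂ → ℂ),
    (∀ z, HasDerivAt f (f' z) z) ∧ (∀ z, HasDerivAt g (g' z) z) ∧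
    (∀ z, C * (g' z * f z - g z * f' z) = ε) ∧ (∀ z, η z = C * f z ^ 2) ∧
    ∀ z, h z * η z = C * (f z * g z) := by
  obtain ⟨C, f, f', g, g', hC, hf, hf', hg, hw, hh, hη⟩ := H
  refine ⟨C, f, f', g, g', hf, hg, hw, hη, fun z => ?_⟩
  rw [hh, hη]
  -- At a zero of `f` the quotient `h` takes the value `0` by convention, and both sides vanish;
  -- thus `hη` is entire without exceptional points.
  by_cases h0 : f z = 0
  · simp [h0]
  · field_simp

theorem isCanonical (H : IsSpinorial ε κ h η) : IsCanonical univ ε (fun z => h z * η z) η := by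
  obtain ⟨C, f, f', g, g', hf, hg, hw, hη, hF⟩ := H.mul_eq
  have e1 : η = fun z => C * f z ^ 2 := funext hη
  have e2 : (fun z => h z * η z) = fun z => C * (f z * g z) := funext hF
  have d1 : ∀ z, HasDerivAt η (C * (2 * f z * f' z)) z := fun z => by
    rw [e1]; simpa using! ((hf z).fun_pow 2).const_mul C
  have d2 : ∀ z, HasDerivAt (fun z => h z * η z) (C * (f' z * g z + f z * g' z)) z := fun z => by
    rw [e2]; exact ((hf z).mul (hg z)).const_mul C
  refine ⟨fun z _ => (d2 z).differentiableAt.differentiableWithinAt,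
    fun z _ => (d1 z).differentiableAt.differentiableWithinAt, fun z _ => ?_⟩
  rw [(d1 z).deriv, (d2 z).deriv]
  linear_combination (C * (f' z * g z + f z * g' z) - ε) * hη z - 2 * C * f z * f' z * hF z
    + C * f z ^ 2 * hw z

theorem deriv_eq (H : IsSpinorial ε κ h η) (z : ℂ) :
    deriv (deriv η) z * η z - deriv η z ^ 2 / 2 = (2 * κ : ℝ) * η z ^ 2 := by
  obtain ⟨C, f, f', g, g', hC, hf, hf', hg, hw, hh, hη⟩ := H
  have e1 : η = fun z => C * f z ^ 2 := funext hη
  have d1 : ∀ z, HasDerivAt η (C * (2 * f z * f' z)) z := fun z => by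
    rw [e1]; simpa using! ((hf z).fun_pow 2).const_mul C
  have e2 : deriv η = fun z => C * (2 * f z * f' z) := funext fun z => (d1 z).deriv
  have d2 : HasDerivAt (deriv η) (C * (2 * f' z * f' z + 2 * f z * (κ * f z))) z := by
    rw [e2]; exact (((hf z).const_mul 2).mul (hf' z)).const_mul C
  rw [d2.deriv, (d1 z).deriv, hη]
  push_cast
  ring

theorem isWeierstrassData (hε : ε ≠ 0) (H : IsSpinorial ε κ h η) : IsWeierstrassData h η := by
  have hη' : Differentiable ℂ η := differentiableOn_univ.1 H.isCanonical.diffη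
  obtain ⟨z₀, hz₀⟩ := H.exists_ne_zero hε
  obtain ⟨C, f, f', g, g', hC, hf, hf', hg, hw, hh, hη⟩ := H
  have df : Differentiable ℂ f := fun z => (hf z).differentiableAt
  have dg : Differentiable ℂ g := fun z => (hg z).differentiableAt
  refine ⟨fun z _ => ?_, hη', fun z => C * g z ^ 2, (dg.pow 2).const_mul C, ?_⟩
  · have : h = fun z => g z / f z := funext hh
    rw [this]
    exact (dg.analyticAt z).meromorphicAt.div (df.analyticAt z).meromorphicAt
  -- `h²η` equals `Cg²` wherever `η ≠ 0`, that is, off a discrete set.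
  · have hcod : η ⁻¹' {0}ᶜ ∈ codiscreteWithin (univ : Set ℂ) :=
      (hη'.differentiableOn.analyticOnNhd isOpen_univ).preimage_zero_mem_codiscreteWithin hz₀
        (mem_univ _) isConnected_univ
    filter_upwards [hcod] with z hz
    have hf0 : f z ≠ 0 := by
      intro h0
      apply hz
      simp [hη, h0]
    rw [hh, hη]
    field_simp

theorem weierstrassSurface_eq (h η : ℂ → ℂ) : weierstrassSurface h η
    = surf (segmentIntegral fun z => h z * η z) (segmentIntegral η) :=
  weierstrassSurface_eq_surf fun _ => rfl

theorem hasDerivAt_height (H : IsSpinorial ε κ h η) (z : ℂ) :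
    HasDerivAt (segmentIntegral fun z => h z * η z) (h z * η z) z :=
  hasDerivAt_segmentIntegral (differentiableOn_univ.1 H.isCanonical.diffF) z

theorem hasDerivAt_proj (H : IsSpinorial ε κ h η) (z : ℂ) :
    HasDerivAt (segmentIntegral η) (η z) z :=
  hasDerivAt_segmentIntegral (differentiableOn_univ.1 H.isCanonical.diffη) z

theorem isZMCWithPlanarLines (hε : ε ≠ 0) (H : IsSpinorial ε κ h η) :
    IsZMCWithPlanarLines {z | η z ≠ 0} (weierstrassSurface h η) := by
  rw [weierstrassSurface_eq]
  exact isZMCWithPlanarLines_surf hε H.isCanonical (H.exists_ne_zero hε) H.deriv_eq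
    H.hasDerivAt_height H.hasDerivAt_proj

/-- Only the 1-forms have to be compared; the heights then agree up to similarity by
`IsCanonical.exists_similarity`. -/
theorem sameSurface {ε₁ κ₁ : ℝ} {h₁ η₁ : ℂ → ℂ} (hε : ε ≠ 0) (hε₁ : ε₁ ≠ 0)
    (H : IsSpinorial ε κ h η) (H₁ : IsSpinorial ε₁ κ₁ h₁ η₁) {a b ν : ℂ} (ha0 : a ≠ 0)
    (ha : (a ^ 2).im = 0) (hν : ‖ν‖ * ‖a‖ * |ε₁| = |ε|) (hη : ∀ z, η z = ν * η₁ (a * z + b)) :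
    SameSurface (weierstrassSurface h η) (weierstrassSurface h₁ η₁) := by
  obtain ⟨z₀, hz₀⟩ := H.exists_ne_zero hε
  obtain ⟨Φ, hΦ, hX⟩ := H.isCanonical.exists_similarity isOpen_univ isPreconnected_univ hε hε₁
    H₁.isCanonical ha0 ha hν (fun z _ => hη z) ⟨z₀, mem_univ _, hz₀⟩
    (fun z _ => H.hasDerivAt_height z) (fun z _ => H.hasDerivAt_proj z)
    H₁.hasDerivAt_height H₁.hasDerivAt_proj
  rw [weierstrassSurface_eq, weierstrassSurface_eq]
  exact ⟨Φ, hΦ, a, b, ha0, fun z => hX z (mem_univ z)⟩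

end IsSpinorial

/-! The data of the special surfaces -/

theorem isSpinorial_catenoid :
    IsSpinorial 1 (1 / 4) (fun z => Complex.exp z) (fun z => Complex.exp (-z)) := by
  have e1 : ∀ z, HasDerivAt (fun z => Complex.exp (-z / 2)) (-(1 / 2) * Complex.exp (-z / 2)) z :=
    fun z => by
      refine (((hasDerivAt_id z).neg.div_const 2).cexp).congr_deriv ?_
      simp; ring
  have e2 : ∀ z, HasDerivAt (fun z => Complex.exp (z / 2)) (1 / 2 * Complex.exp (z / 2)) z :=
    fun z => by
      refine (((hasDerivAt_id z).div_const 2).cexp).congr_deriv ?_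
      simp; ring
  refine ⟨1, _, _, _, _, one_ne_zero, e1, fun z => ?_, e2, fun z => ?_, fun z => ?_, fun z => ?_⟩
  · refine ((e1 z).const_mul _).congr_deriv ?_
    push_cast; ring
  · have : Complex.exp (z / 2) * Complex.exp (-z / 2) = 1 := by
      rw [← Complex.exp_add]; ring_nf; simp
    push_cast
    linear_combination this
  · rw [← Complex.exp_sub]; ring_nf
  · rw [← Complex.exp_nat_mul]; ring_nf

theorem isSpinorial_enneperType : IsSpinorial (-1) 0 (fun z => 1 / z) (fun z => z ^ 2) :=
  ⟨1, fun z => z, fun _ => 1, fun _ => 1, fun _ => 0, one_ne_zero, fun z => hasDerivAt_id z,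
    fun z => by simpa using hasDerivAt_const z (1 : ℂ), fun z => hasDerivAt_const z 1,
    fun z => by simp, fun z => rfl, fun z => by simp⟩

theorem isSpinorial_const {C : ℂ} {ε : ℝ} (hC : C ≠ 0) (hCε : C = ε) :
    IsSpinorial ε 0 (fun z => z) (fun _ => C) :=
  ⟨C, fun _ => 1, fun _ => 0, fun z => z, fun _ => 1, hC, fun z => hasDerivAt_const z 1,
    fun z => by simpa using hasDerivAt_const z (0 : ℂ), fun z => hasDerivAt_id z,
    fun z => by simp [hCε], fun z => by simp, fun z => by simp⟩

theorem hasDerivAt_sinh_affine (m b z : ℂ) :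
    HasDerivAt (fun z => Complex.sinh (m * (z - b))) (m * Complex.cosh (m * (z - b))) z := by
  refine (((hasDerivAt_id z).sub_const b).const_mul m).csinh.congr_deriv ?_
  simp; ring

theorem hasDerivAt_cosh_affine (m b z : ℂ) :
    HasDerivAt (fun z => Complex.cosh (m * (z - b))) (m * Complex.sinh (m * (z - b))) z := by
  refine (((hasDerivAt_id z).sub_const b).const_mul m).ccosh.congr_deriv ?_
  simp; ring

theorem isSpinorial_bonnet {α β : ℝ} (hα : α ≠ 0) (hβ : β ≠ 0) (b : ℂ) :
    IsSpinorial (-1) (α ^ 2 / 4) (fun z => bonnetH α β (z - b)) (fun z => bonnetEta α β (z - b)) := by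
  have hα' : (α : ℂ) ≠ 0 := by exact_mod_cast hα
  have hβ' : (β : ℂ) ≠ 0 := by exact_mod_cast hβ
  have e : ∀ z : ℂ, (α * (z - b) / 2 : ℂ) = α / 2 * (z - b) := fun z => by ring
  refine ⟨2 * β / α ^ 2, _, _, fun z => α / β * Complex.cosh (α / 2 * (z - b)), _, ?_,
    hasDerivAt_sinh_affine (α / 2) b, fun z => ?_,
    fun z => (hasDerivAt_cosh_affine (α / 2) b z).const_mul _, fun z => ?_, fun z => ?_, fun z => ?_⟩
  · simp [hα', hβ']
  · refine ((hasDerivAt_cosh_affine (α / 2) b z).const_mul _).congr_deriv ?_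
    push_cast; ring
  · have := Complex.cosh_sq_sub_sinh_sq (α / 2 * (z - b))
    beta_reduce
    generalize Complex.cosh (α / 2 * (z - b)) = x at *
    generalize Complex.sinh (α / 2 * (z - b)) = y at *
    push_cast
    field_simp
    linear_combination -this
  · simp only [bonnetH, e]
    ring
  · simp only [bonnetEta, e]

theorem isSpinorial_stageThree {α : ℝ} (hα : α ≠ 0) :
    IsSpinorial (-1) (α ^ 2 / 4) (stageThreeH α) (stageThreeEta α) := by
  have hα' : (α : ℂ) ≠ 0 := by exact_mod_cast hα
  have e : ∀ z : ℂ, (α * z / 2 : ℂ) = α / 2 * (z - 0) := fun z => by ring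
  refine ⟨-1, _, _, fun z => 2 / α * Complex.sinh (α / 2 * (z - 0)), _, by simp,
    hasDerivAt_cosh_affine (α / 2) 0, fun z => ?_,
    fun z => (hasDerivAt_sinh_affine (α / 2) 0 z).const_mul _, fun z => ?_, fun z => ?_, fun z => ?_⟩
  · refine ((hasDerivAt_sinh_affine (α / 2) 0 z).const_mul _).congr_deriv ?_
    push_cast; ring
  · have := Complex.cosh_sq_sub_sinh_sq (α / 2 * (z - 0))
    beta_reduce
    generalize Complex.cosh (α / 2 * (z - 0)) = x at *
    generalize Complex.sinh (α / 2 * (z - 0)) = y at *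
    push_cast
    field_simp
    linear_combination -this
  · simp only [stageThreeH, e, Complex.tanh_eq_sinh_div_cosh]
    ring
  · simp only [stageThreeEta, e]
    ring

/-- The numerator is a quadratic in `e^{±cz}`, `c = cos θ`, and `sin² θ = (1 - c)(1 + c)` makes it a
perfect square. This exhibits the function `f` of the spinorial form. -/
theorem stageOneEta_eq {θ : ℝ} (hc : Real.cos θ ≠ 0) (hc1 : Real.cos θ + 1 ≠ 0) (z : ℂ) :
    stageOneEta 2 θ z = -Complex.exp (-(2 * Complex.I * θ)) / (4 * (Real.cos θ + 1) * Real.cos θ ^ 2)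
      * ((Real.cos θ + 1) * Complex.exp (-(Real.cos θ * z))
        - Real.sin θ * Complex.exp (Real.cos θ * z)) ^ 2 := by
  have h1 : (Real.cos θ : ℂ) ≠ 0 := by exact_mod_cast hc
  have h2 : (Real.cos θ : ℂ) + 1 ≠ 0 := by exact_mod_cast hc1
  have h3 : (Real.sin θ : ℂ) ^ 2 + Real.cos θ ^ 2 = 1 := by
    exact_mod_cast Real.sin_sq_add_cos_sq θ
  have e1 : Complex.exp (2 * Real.cos θ * z) = Complex.exp (Real.cos θ * z) ^ 2 := by
    rw [← Complex.exp_nat_mul]; push_cast; ring_nf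
  have e2 : Complex.exp (-(2 * Real.cos θ * z)) = Complex.exp (-(Real.cos θ * z)) ^ 2 := by
    rw [← Complex.exp_nat_mul]; push_cast; ring_nf
  have e3 : Complex.exp (Real.cos θ * z) * Complex.exp (-(Real.cos θ * z)) = 1 := by
    rw [← Complex.exp_add]; simp
  rw [stageOneEta, Complex.sinh, Complex.cosh]
  push_cast [-Complex.ofReal_cos, -Complex.ofReal_sin]
  rw [e1, e2]
  generalize Complex.exp (Real.cos θ * z) = E at *
  generalize Complex.exp (-(Real.cos θ * z)) = E' at *
  generalize Complex.exp (-(2 * Complex.I * θ)) = A at *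
  generalize (Real.cos θ : ℂ) = c at *
  generalize (Real.sin θ : ℂ) = s at *
  field_simp
  linear_combination (-8 * A * s * (c + 1)) * e3 + 4 * A * E ^ 2 * h3

/-- Here `f = (c + 1)e^{-cz} - s e^{cz}` is the square root found in `stageOneEta_eq`. Multiplying
numerator and denominator of `h` by `e^{cz}` gives the denominator `f` and the numerator `g =
2e^{2iθ}c e^{cz}`. Both solve `y'' = c²y`, so their Wronskian is constant. -/
theorem isSpinorial_stageOne {θ : ℝ} (hc : Real.cos θ ≠ 0) (hc1 : Real.cos θ + 1 ≠ 0) :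
    IsSpinorial (-1) (Real.cos θ ^ 2) (stageOneH 2 θ) (stageOneEta 2 θ) := by
  have h1 : (Real.cos θ : ℂ) ≠ 0 := by exact_mod_cast hc
  have h2 : (Real.cos θ : ℂ) + 1 ≠ 0 := by exact_mod_cast hc1
  have hE : ∀ z, HasDerivAt (fun z => Complex.exp (Real.cos θ * z))
      (Real.cos θ * Complex.exp (Real.cos θ * z)) z := fun z => by
    refine (((hasDerivAt_id z).const_mul _).cexp).congr_deriv ?_
    simp; ring
  have hE' : ∀ z, HasDerivAt (fun z => Complex.exp (-(Real.cos θ * z)))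
      (-Real.cos θ * Complex.exp (-(Real.cos θ * z))) z := fun z => by
    refine (((hasDerivAt_id z).const_mul _).neg.cexp).congr_deriv ?_
    simp; ring
  have e3 : ∀ z, Complex.exp (Real.cos θ * z) * Complex.exp (-(Real.cos θ * z)) = 1 := fun z => by
    rw [← Complex.exp_add]; simp
  have e4 : Complex.exp (2 * Complex.I * θ) * Complex.exp (-(2 * Complex.I * θ)) = 1 := by
    rw [← Complex.exp_add]; simp
  have e5 : ∀ z, Complex.exp (-(2 * Real.cos θ * z)) = Complex.exp (-(Real.cos θ * z)) ^ 2 := by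
    intro z; rw [← Complex.exp_nat_mul]; push_cast; ring_nf
  refine ⟨-Complex.exp (-(2 * Complex.I * θ)) / (4 * (Real.cos θ + 1) * Real.cos θ ^ 2),
    _, _, fun z => 2 * Complex.exp (2 * Complex.I * θ) * Real.cos θ * Complex.exp (Real.cos θ * z), _,
    ?_, fun z => ((hE' z).const_mul (Real.cos θ + 1 : ℂ)).fun_sub ((hE z).const_mul (Real.sin θ : ℂ)),
    fun z => ?_, fun z => (hE z).const_mul _, fun z => ?_, fun z => ?_,
    fun z => stageOneEta_eq hc hc1 z⟩
  · exact div_ne_zero (neg_ne_zero.2 (Complex.exp_ne_zero _))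
      (mul_ne_zero (mul_ne_zero (by norm_num) h2) (pow_ne_zero 2 h1))
  · refine ((((hE' z).const_mul (-Real.cos θ : ℂ)).const_mul (Real.cos θ + 1 : ℂ)).fun_sub
      (((hE z).const_mul (Real.cos θ : ℂ)).const_mul (Real.sin θ : ℂ))).congr_deriv ?_
    push_cast [-Complex.ofReal_cos, -Complex.ofReal_sin]; ring
  · have e := e3 z
    beta_reduce
    generalize Complex.exp (Real.cos θ * z) = E at *
    generalize Complex.exp (-(Real.cos θ * z)) = E' at *
    generalize Complex.exp (-(2 * Complex.I * θ)) = A at *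
    generalize Complex.exp (2 * Complex.I * θ) = A' at *
    generalize (Real.cos θ : ℂ) = c at *
    generalize (Real.sin θ : ℂ) = s at *
    push_cast
    field_simp
    linear_combination (-4 * (c + 1) * (A' * A)) * e - 4 * (c + 1) * e4
  · have e := e3 z
    have hE0 : Complex.exp (Real.cos θ * z) ≠ 0 := Complex.exp_ne_zero _
    have : (Real.cos θ + 1 : ℂ) * Complex.exp (-(Real.cos θ * z))
        - Real.sin θ * Complex.exp (Real.cos θ * z)
        = (Complex.exp (-(2 * Real.cos θ * z)) * (Real.cos θ + 1) - Real.sin θ)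
          * Complex.exp (Real.cos θ * z) := by
      rw [e5 z]
      linear_combination -(Real.cos θ + 1 : ℂ) * Complex.exp (-(Real.cos θ * z)) * e
    rw [this, mul_div_mul_right _ _ hE0, stageOneH]
    push_cast
    rfl

theorem cos_pos_of_mem {t : ℝ} (ht : t ∈ Ico (0 : ℝ) 1) : 0 < Real.cos (Real.pi * t / 2) := by
  have := Real.pi_pos
  apply Real.cos_pos_of_mem_Ioo
  constructor <;> nlinarith [ht.1, ht.2]

/-- All members of the deformation have Hopf differential `-dz²`. -/
theorem isSpinorial_deformation {t : ℝ} (ht : t ∈ Icc (0 : ℝ) 3) :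
    ∃ κ, IsSpinorial (-1) κ (deformationH t) (deformationEta t) := by
  rcases lt_trichotomy t 1 with h1 | rfl | h1
  · have e1 : deformationH t = stageOneH 2 (Real.pi * t / 2) := by
      funext z; simp only [deformationH, if_pos h1]
    have e2 : deformationEta t = stageOneEta 2 (Real.pi * t / 2) := by
      funext z; simp only [deformationEta, if_pos h1]
    have := cos_pos_of_mem ⟨ht.1, h1⟩
    rw [e1, e2]
    exact ⟨_, isSpinorial_stageOne this.ne' (by linarith)⟩
  · have e1 : deformationH 1 = fun z => 2 / (2 * z - 1) := by
      funext z; simp [deformationH]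
    have e2 : deformationEta 1 = fun z => (2 * z - 1) ^ 2 / 4 := by
      funext z; simp [deformationEta]
    rw [e1, e2]
    refine ⟨0, 1, fun z => (2 * z - 1) / 2, fun _ => 1, fun _ => 1, fun _ => 0, one_ne_zero,
      fun z => ?_, fun z => by simpa using hasDerivAt_const z (1 : ℂ), fun z => hasDerivAt_const z 1,
      fun z => by simp, fun z => by simp, fun z => by ring⟩
    refine ((((hasDerivAt_id z).const_mul 2).sub_const 1).div_const 2).congr_deriv ?_
    norm_num
  · have h1' := h1.not_gt
    have h1'' := h1.ne'
    by_cases h2 : t ≤ 2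
    · have e1 : deformationH t = fun z => bonnetH (2 * (t - 1)) 2 (z - centre t) := by
        funext z; simp only [deformationH, if_neg h1', if_neg h1'', if_pos h2]
      have e2 : deformationEta t = fun z => bonnetEta (2 * (t - 1)) 2 (z - centre t) := by
        funext z; simp only [deformationEta, if_neg h1', if_neg h1'', if_pos h2]
      rw [e1, e2]
      exact ⟨_, isSpinorial_bonnet (by linarith) two_ne_zero _⟩
    · by_cases h3 : t < 3
      · have e1 : deformationH t = stageThreeH (2 * (3 - t)) := by
          funext z; simp only [deformationH, if_neg h1', if_neg h1'', if_neg h2, if_pos h3]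
        have e2 : deformationEta t = stageThreeEta (2 * (3 - t)) := by
          funext z; simp only [deformationEta, if_neg h1', if_neg h1'', if_neg h2, if_pos h3]
        rw [e1, e2]
        exact ⟨_, isSpinorial_stageThree (by linarith)⟩
      · have e1 : deformationH t = fun z => z := by
          funext z; simp only [deformationH, if_neg h1', if_neg h1'', if_neg h2, if_neg h3]
        have e2 : deformationEta t = fun _ => -1 := by
          funext z; simp only [deformationEta, if_neg h1', if_neg h1'', if_neg h2, if_neg h3]
        rw [e1, e2]
        exact ⟨0, isSpinorial_const (by simp) (by simp)⟩

theorem deformationEta_of_lt {t : ℝ} (h : t < 1) :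
    deformationEta t = stageOneEta 2 (Real.pi * t / 2) := by
  funext z; simp only [deformationEta, if_pos h]

theorem deformationH_of_lt {t : ℝ} (h : t < 1) :
    deformationH t = stageOneH 2 (Real.pi * t / 2) := by
  funext z; simp only [deformationH, if_pos h]

theorem deformationEta_one : deformationEta 1 = fun z => (2 * z - 1) ^ 2 / 4 := by
  funext z; simp [deformationEta]

theorem deformationH_one : deformationH 1 = fun z => 2 / (2 * z - 1) := by
  funext z; simp [deformationH]

theorem deformationEta_of_mem_Ioc {t : ℝ} (h : t ∈ Ioc (1 : ℝ) 2) :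
    deformationEta t = fun z => bonnetEta (2 * (t - 1)) 2 (z - centre t) := by
  funext z; simp only [deformationEta, if_neg h.1.not_gt, if_neg h.1.ne', if_pos h.2]

theorem deformationH_of_mem_Ioc {t : ℝ} (h : t ∈ Ioc (1 : ℝ) 2) :
    deformationH t = fun z => bonnetH (2 * (t - 1)) 2 (z - centre t) := by
  funext z; simp only [deformationH, if_neg h.1.not_gt, if_neg h.1.ne', if_pos h.2]

theorem deformationEta_of_mem_Ioo {t : ℝ} (h : t ∈ Ioo (2 : ℝ) 3) :
    deformationEta t = stageThreeEta (2 * (3 - t)) := by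
  have h1 : 1 < t := by linarith [h.1]
  funext z
  simp only [deformationEta, if_neg h1.not_gt, if_neg h1.ne', if_neg h.1.not_ge, if_pos h.2]

theorem deformationH_of_mem_Ioo {t : ℝ} (h : t ∈ Ioo (2 : ℝ) 3) :
    deformationH t = stageThreeH (2 * (3 - t)) := by
  have h1 : 1 < t := by linarith [h.1]
  funext z
  simp only [deformationH, if_neg h1.not_gt, if_neg h1.ne', if_neg h.1.not_ge, if_pos h.2]

theorem deformationEta_three : deformationEta 3 = fun _ => -1 := by
  funext z; norm_num [deformationEta]

theorem deformationH_three : deformationH 3 = fun z => z := by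
  funext z; norm_num [deformationH]

theorem centre_two : centre 2 = Real.pi * Complex.I / 2 := by
  simp only [centre]; push_cast; ring

/-- At the junction of the second and third stage the formulas agree. -/
theorem deformationEta_two : deformationEta 2 = stageThreeEta 2 := by
  rw [deformationEta_of_mem_Ioc (by norm_num)]
  funext z
  have e : (2 * z / 2 : ℂ) = z := by ring
  have e2 : (2 * (2 - 1) * (z - centre 2) / 2 : ℂ) = z - Real.pi / 2 * Complex.I := by
    rw [centre_two]; ring
  have e3 : Complex.sinh (z - Real.pi / 2 * Complex.I) = -Complex.I * Complex.cosh z := by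
    rw [Complex.sinh_sub, Complex.cosh_mul_I, Complex.sinh_mul_I]; simp; ring
  simp only [bonnetEta, stageThreeEta]
  push_cast
  rw [e, e2, e3]
  ring_nf
  simp

theorem deformationH_two : deformationH 2 = stageThreeH 2 := by
  rw [deformationH_of_mem_Ioc (by norm_num)]
  funext z
  have e : (2 * z / 2 : ℂ) = z := by ring
  have e2 : (2 * (2 - 1) * (z - centre 2) / 2 : ℂ) = z - Real.pi / 2 * Complex.I := by
    rw [centre_two]; ring
  have e3 : Complex.sinh (z - Real.pi / 2 * Complex.I) = -Complex.I * Complex.cosh z := by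
    rw [Complex.sinh_sub, Complex.cosh_mul_I, Complex.sinh_mul_I]; simp; ring
  have e4 : Complex.cosh (z - Real.pi / 2 * Complex.I) = -Complex.I * Complex.sinh z := by
    rw [Complex.cosh_sub, Complex.cosh_mul_I, Complex.sinh_mul_I]; simp; ring
  simp only [bonnetH, stageThreeH]
  push_cast
  rw [e, e2, e3, e4, mul_div_mul_left _ _ (neg_ne_zero.2 Complex.I_ne_zero),
    Complex.tanh_eq_sinh_div_cosh]
  norm_num

theorem deformationEta_of_mem_Ico {t : ℝ} (h : t ∈ Ico (2 : ℝ) 3) :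
    deformationEta t = stageThreeEta (2 * (3 - t)) := by
  rcases h.1.eq_or_lt with rfl | h2
  · rw [deformationEta_two]; norm_num
  · exact deformationEta_of_mem_Ioo ⟨h2, h.2⟩

theorem deformationH_of_mem_Ico {t : ℝ} (h : t ∈ Ico (2 : ℝ) 3) :
    deformationH t = stageThreeH (2 * (3 - t)) := by
  rcases h.1.eq_or_lt with rfl | h2
  · rw [deformationH_two]; norm_num
  · exact deformationH_of_mem_Ioo ⟨h2, h.2⟩

/-! The surfaces which the deformation connects -/

/-- The shift `l` with `e^{2l} = (cos θ + 1)/sin θ` balances the two exponentials of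
`stageOneEta_eq`, turning their difference into a multiple of `sinh`. -/
theorem stageOneEta_eq_sinh {θ : ℝ} (hc : 0 < Real.cos θ) (hs : 0 < Real.sin θ) (z : ℂ) :
    stageOneEta 2 θ z = -Complex.exp (-(2 * Complex.I * θ)) * (Real.sin θ / Real.cos θ ^ 2) *
      Complex.sinh (Real.cos θ * z
        - (Real.log ((Real.cos θ + 1) / Real.sin θ) / 2 : ℝ)) ^ 2 := by
  have hc1 : 0 < Real.cos θ + 1 := by linarith
  rw [stageOneEta_eq hc.ne' hc1.ne', Complex.sinh]
  set l : ℝ := Real.log ((Real.cos θ + 1) / Real.sin θ) / 2 with hl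
  have h1 : (Real.cos θ : ℂ) ≠ 0 := by exact_mod_cast hc.ne'
  have h2 : (Real.cos θ : ℂ) + 1 ≠ 0 := by exact_mod_cast hc1.ne'
  have h3 : Real.sin θ * Real.exp l ^ 2 = Real.cos θ + 1 := by
    rw [← Real.exp_nat_mul, hl, show ((2 : ℕ) : ℝ) * (Real.log ((Real.cos θ + 1) / Real.sin θ) / 2)
      = Real.log ((Real.cos θ + 1) / Real.sin θ) by push_cast; ring,
      Real.exp_log (div_pos hc1 hs)]
    field_simp
  have h3' : (Real.sin θ : ℂ) * Complex.exp l ^ 2 = Real.cos θ + 1 := by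
    rw [← Complex.ofReal_exp]; exact_mod_cast h3
  have h4 : Complex.exp (l : ℂ) ≠ 0 := Complex.exp_ne_zero _
  rw [neg_sub, Complex.exp_sub, Complex.exp_sub, Complex.exp_neg (Real.cos θ * z)]
  have h5 : Complex.exp (Real.cos θ * z) ≠ 0 := Complex.exp_ne_zero _
  generalize Complex.exp (Real.cos θ * z) = E at *
  generalize Complex.exp (-(2 * Complex.I * θ)) = A at *
  generalize Complex.exp (l : ℂ) = x at *
  generalize (Real.cos θ : ℂ) = c at *
  generalize (Real.sin θ : ℂ) = s at *
  rw [← h3']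
  rw [← h3'] at h2
  have h6 : s ≠ 0 := by rintro rfl; simp at h2
  field_simp
  ring

/-- Up to similarity a Bonnet-type surface depends only on the ratio of its parameters, a common
factor `lam` being absorbed by rescaling `z`. The value `lam = 1` gives the listed parameters; other
values reach arbitrary `α, β`. -/
theorem sameSurface_bonnet {t lam : ℝ} (ht : t ∈ Ioo (0 : ℝ) 1) (hlam : 0 < lam) :
    SameSurface (deformation t) (bonnetType (lam * (2 * Real.cos (Real.pi * t / 2)))
      (lam * (2 * Real.sin (Real.pi * t / 2)))) := by
  obtain ⟨κ, H⟩ := isSpinorial_deformation (t := t) ⟨ht.1.le, by linarith [ht.2]⟩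
  have hc := cos_pos_of_mem (t := t) ⟨ht.1.le, ht.2⟩
  have hs : 0 < Real.sin (Real.pi * t / 2) := by
    have := Real.pi_pos
    apply Real.sin_pos_of_pos_of_lt_pi <;> nlinarith [ht.1, ht.2]
  rw [deformation]
  rw [deformationEta_of_lt ht.2] at *
  set θ := Real.pi * t / 2
  have H₁ := isSpinorial_bonnet (mul_pos hlam (mul_pos two_pos hc)).ne'
    (mul_pos hlam (mul_pos two_pos hs)).ne' 0
  simp only [sub_zero] at H₁
  have hl : (lam : ℂ) ≠ 0 := by exact_mod_cast hlam.ne'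
  have h1 : (Real.cos θ : ℂ) ≠ 0 := by exact_mod_cast hc.ne'
  refine H.sameSurface (by simp) (by simp) H₁ (a := 1 / lam)
    (b := -(Real.log ((Real.cos θ + 1) / Real.sin θ) / 2 : ℝ) / (lam * Real.cos θ))
    (ν := -Complex.exp (-(2 * Complex.I * θ)) * lam) (by simpa using hl) ?_ ?_ fun z => ?_
  · rw [show (1 / lam : ℂ) ^ 2 = ((1 / lam ^ 2 : ℝ) : ℂ) by push_cast; ring, Complex.ofReal_im]
  · have : ‖Complex.exp (-(2 * Complex.I * θ))‖ = 1 := by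
      rw [show -(2 * Complex.I * (θ : ℂ)) = ((-2 * θ : ℝ) : ℂ) * Complex.I by push_cast; ring]
      exact Complex.norm_exp_ofReal_mul_I _
    rw [norm_mul, norm_neg, this, norm_div, Complex.norm_real, Real.norm_of_nonneg hlam.le]
    simp [hlam.ne']
  · rw [stageOneEta_eq_sinh hc hs, bonnetEta]
    generalize (Real.log ((Real.cos θ + 1) / Real.sin θ) / 2 : ℝ) = l
    have e : ((lam * (2 * Real.cos θ) : ℝ) : ℂ) * (1 / lam * z + -l / (lam * Real.cos θ)) / 2
        = Real.cos θ * z - l := by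
      push_cast [-Complex.ofReal_cos]; field_simp; ring
    rw [e]
    push_cast [-Complex.ofReal_cos, -Complex.ofReal_sin]
    field_simp

theorem sameSurface_zero_catenoid : SameSurface (deformation 0) catenoid := by
  obtain ⟨κ, H⟩ := isSpinorial_deformation (t := 0) (by norm_num)
  refine H.sameSurface (by simp) (by simp) isSpinorial_catenoid (a := 2) (b := 0) (ν := -(1 / 2))
    two_ne_zero (by norm_num [pow_two]) (by norm_num) fun z => ?_
  rw [deformationEta_of_lt (by norm_num), stageOneEta_eq (by simp) (by norm_num)]
  have e : Complex.exp (-(2 * z)) = Complex.exp (-z) ^ 2 := by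
    rw [← Complex.exp_nat_mul]; push_cast; ring_nf
  simp [e]
  ring

theorem sameSurface_one_enneperType : SameSurface (deformation 1) enneperType := by
  obtain ⟨κ, H⟩ := isSpinorial_deformation (t := 1) (by norm_num)
  refine H.sameSurface (by simp) (by simp) isSpinorial_enneperType (a := 1) (b := -(1 / 2)) (ν := 1)
    one_ne_zero (by simp) (by simp) fun z => ?_
  rw [deformationEta_one]
  ring

theorem sameSurface_three_trivialEnneper : SameSurface (deformation 3) trivialEnneper := by
  obtain ⟨κ, H⟩ := isSpinorial_deformation (t := 3) (by norm_num)
  refine H.sameSurface (by simp) one_ne_zero (isSpinorial_const one_ne_zero (by simp)) (a := 1)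
    (b := 0) (ν := -1) one_ne_zero (by simp) (by simp) fun z => ?_
  rw [deformationEta_three]
  ring

theorem sameSurface_second_stage {t : ℝ} (ht : t ∈ Ioc (1 : ℝ) 2) :
    SameSurface (deformation t) (bonnetType (2 * (t - 1)) 2) := by
  obtain ⟨κ, H⟩ := isSpinorial_deformation (t := t) ⟨by linarith [ht.1], by linarith [ht.2]⟩
  have H₁ := isSpinorial_bonnet (α := 2 * (t - 1)) (β := 2) (by linarith [ht.1]) two_ne_zero 0
  simp only [sub_zero] at H₁
  refine H.sameSurface (by simp) (by simp) H₁ (a := 1) (b := -centre t) (ν := 1)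
    one_ne_zero (by simp) (by simp) fun z => ?_
  rw [deformationEta_of_mem_Ioc ht]
  ring_nf

theorem sameSurface_third_stage {t : ℝ} (ht : t ∈ Ico (2 : ℝ) 3) :
    SameSurface (deformation t) (bonnetType (2 * (3 - t)) ((2 * (3 - t)) ^ 2 / 2)) := by
  obtain ⟨κ, H⟩ := isSpinorial_deformation (t := t) ⟨by linarith [ht.1], by linarith [ht.2]⟩
  have hα : 0 < 2 * (3 - t) := by linarith [ht.2]
  have H₁ := isSpinorial_bonnet hα.ne' (β := (2 * (3 - t)) ^ 2 / 2) (by positivity) 0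
  simp only [sub_zero] at H₁
  -- The shift by `πi/α` replaces `sinh(αz/2)` by `i cosh(αz/2)`, and `β = α²/2` makes the factor
  -- `2β/α²` equal to `1`.
  refine H.sameSurface (by simp) (by simp) H₁ (a := 1)
    (b := Real.pi * Complex.I / (2 * (3 - t) : ℝ)) (ν := 1)
    one_ne_zero (by simp) (by simp) fun z => ?_
  rw [deformationEta_of_mem_Ico ht]
  generalize 2 * (3 - t) = α at *
  have hα' : (α : ℂ) ≠ 0 := by exact_mod_cast hα.ne'
  have e : α * (1 * z + Real.pi * Complex.I / α) / 2 = α * z / 2 + Real.pi / 2 * Complex.I := by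
    field_simp
  rw [stageThreeEta, bonnetEta, e, Complex.sinh_add, Complex.cosh_mul_I, Complex.sinh_mul_I]
  simp
  field_simp
  simp

theorem exists_sameSurface_bonnet {α β : ℝ} (hα : 0 < α) (hβ : 0 < β) :
    ∃ t ∈ Ioo (0 : ℝ) 1, SameSurface (deformation t) (bonnetType α β) := by
  -- The ratio of the parameters at angle `θ` is `tan θ`, which takes every positive value on `(0,
  -- π/2)`.
  set θ := Real.arctan (β / α) with hθ
  have h1 : 0 < θ := Real.arctan_pos.2 (div_pos hβ hα)
  have h2 : θ < Real.pi / 2 := Real.arctan_lt_pi_div_two _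
  have hpi := Real.pi_pos
  have ht : 2 * θ / Real.pi ∈ Ioo (0 : ℝ) 1 := by
    constructor
    · positivity
    · rw [div_lt_one hpi]; linarith
  have e : Real.pi * (2 * θ / Real.pi) / 2 = θ := by field_simp
  have hc : 0 < Real.cos θ := Real.cos_arctan_pos _
  have hs : Real.sin θ = β / α * Real.cos θ := by
    rw [← Real.tan_arctan (β / α), ← hθ, Real.tan_eq_sin_div_cos]; field_simp
  refine ⟨_, ht, ?_⟩
  have := sameSurface_bonnet ht (lam := α / (2 * Real.cos θ)) (by positivity)
  rw [e] at this
  convert this using 2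
  · field_simp
  · rw [hs]; field_simp

/-! Continuity of the deformation -/

theorem continuous_dslope_of_differentiable {f : ℂ → ℂ} (hf : Differentiable ℂ f) :
    Continuous (dslope f 0) := by
  rw [← continuousOn_univ]
  exact (continuousOn_dslope univ_mem).2 ⟨hf.continuous.continuousOn, hf 0⟩

theorem mul_dslope_exp (w : ℂ) : w * dslope Complex.exp 0 w = Complex.exp w - 1 := by
  simpa using sub_smul_dslope Complex.exp 0 w

theorem mul_dslope_sinh (w : ℂ) : w * dslope Complex.sinh 0 w = Complex.sinh w := by
  simpa using sub_smul_dslope Complex.sinh 0 w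

/-- The entire function `(e^{-2 c z} (c + 1) - s) / c`, `(c, s) = (cos θ, sin θ)`, without the
singularity at `c = 0`. -/
def stageOneFactor (θ : ℝ) (z : ℂ) : ℂ :=
  -2 * z * dslope Complex.exp 0 (-(2 * Real.cos θ * z)) + Complex.exp (-(2 * Real.cos θ * z))
    + Real.cos θ / (1 + Real.sin θ)

/-- The two singular terms are `(e^{-2cz} - 1)/c`, a difference quotient of `exp`, and `(1 - s)/c =
c/(1 + s)`. -/
theorem cos_mul_stageOneFactor {θ : ℝ} (hs : 1 + Real.sin θ ≠ 0) (z : ℂ) :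
    Real.cos θ * stageOneFactor θ z
      = Complex.exp (-(2 * Real.cos θ * z)) * (Real.cos θ + 1) - Real.sin θ := by
  have h1 := mul_dslope_exp (-(2 * Real.cos θ * z))
  have h2 : (1 + Real.sin θ : ℂ) ≠ 0 := by exact_mod_cast hs
  have h3 : (Real.sin θ : ℂ) ^ 2 + Real.cos θ ^ 2 = 1 := by
    exact_mod_cast Real.sin_sq_add_cos_sq θ
  have h4 : (Real.cos θ : ℂ) * (Real.cos θ / (1 + Real.sin θ)) = 1 - Real.sin θ := by
    field_simp
    linear_combination h3
  rw [stageOneFactor]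
  linear_combination h1 + h4

theorem stageOneEta_eq_factor {θ : ℝ} (hs : 1 + Real.sin θ ≠ 0) (hc : Real.cos θ ≠ 0)
    (hc1 : Real.cos θ + 1 ≠ 0) (z : ℂ) :
    stageOneEta 2 θ z = -(Complex.exp (-(2 * Complex.I * θ)) * Complex.exp (2 * Real.cos θ * z)
      * stageOneFactor θ z ^ 2) / (4 * (Real.cos θ + 1)) := by
  have h := cos_mul_stageOneFactor hs z
  have h1 : (Real.cos θ : ℂ) ≠ 0 := by exact_mod_cast hc
  have h2 : (Real.cos θ : ℂ) + 1 ≠ 0 := by exact_mod_cast hc1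
  have e1 : (Real.cos θ + 1 : ℂ) * Complex.exp (-(Real.cos θ * z))
      - Real.sin θ * Complex.exp (Real.cos θ * z)
      = Complex.exp (Real.cos θ * z) * (Real.cos θ * stageOneFactor θ z) := by
    have e3 : Complex.exp (Real.cos θ * z) * Complex.exp (-(2 * Real.cos θ * z))
        = Complex.exp (-(Real.cos θ * z)) := by rw [← Complex.exp_add]; ring_nf
    rw [h, ← e3]; ring
  have e2 : Complex.exp (2 * Real.cos θ * z) = Complex.exp (Real.cos θ * z) ^ 2 := by
    rw [← Complex.exp_nat_mul]; push_cast; ring_nf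
  rw [stageOneEta_eq hc hc1, e1, e2]
  field_simp

theorem stageOneH_mul_eq_factor {θ : ℝ} (hs : 1 + Real.sin θ ≠ 0) (hc : Real.cos θ ≠ 0)
    (hc1 : Real.cos θ + 1 ≠ 0) (z : ℂ) :
    stageOneH 2 θ z * stageOneEta 2 θ z
      = -(Complex.exp (2 * Real.cos θ * z) * stageOneFactor θ z) / (2 * (Real.cos θ + 1)) := by
  have h := cos_mul_stageOneFactor hs z
  have h1 : (Real.cos θ : ℂ) ≠ 0 := by exact_mod_cast hc
  have h2 : (Real.cos θ : ℂ) + 1 ≠ 0 := by exact_mod_cast hc1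
  have e4 : Complex.exp (2 * Complex.I * θ) * Complex.exp (-(2 * Complex.I * θ)) = 1 := by
    rw [← Complex.exp_add]; simp
  rw [stageOneEta_eq_factor hs hc hc1, stageOneH]
  push_cast [-Complex.ofReal_cos, -Complex.ofReal_sin]
  rw [← h]
  -- A zero of the factor is a zero of `η`, so both sides vanish whatever value `h` has there.
  by_cases h0 : stageOneFactor θ z = 0
  · simp [h0]
  · generalize Complex.exp (-(2 * Complex.I * θ)) = A at *
    generalize Complex.exp (2 * Complex.I * θ) = A' at *
    field_simp
    linear_combination -4 * e4

theorem continuousOn_stageOneFactor : ContinuousOn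
    (fun p : ℝ × ℂ => stageOneFactor (Real.pi * p.1 / 2) p.2) (Icc (0 : ℝ) 1 ×ˢ univ) := by
  have h := continuous_dslope_of_differentiable Complex.differentiable_exp
  unfold stageOneFactor
  refine ContinuousOn.add (Continuous.continuousOn ?_) (ContinuousOn.div ?_ ?_ ?_)
  · fun_prop
  · fun_prop
  · fun_prop
  · intro p hp
    have : 0 ≤ Real.sin (Real.pi * p.1 / 2) := by
      have := Real.pi_pos
      apply Real.sin_nonneg_of_nonneg_of_le_pi <;> nlinarith [hp.1.1, hp.1.2]
    have h2 : 1 + Real.sin (Real.pi * p.1 / 2) ≠ 0 := by linarith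
    exact_mod_cast h2

theorem cos_sin_mem_of_mem_Icc {t : ℝ} (ht : t ∈ Icc (0 : ℝ) 1) :
    0 ≤ Real.cos (Real.pi * t / 2) ∧ 0 ≤ Real.sin (Real.pi * t / 2) := by
  have := Real.pi_pos
  constructor
  · apply Real.cos_nonneg_of_neg_pi_div_two_le_of_le <;> nlinarith [ht.1, ht.2]
  · apply Real.sin_nonneg_of_nonneg_of_le_pi <;> nlinarith [ht.1, ht.2]

theorem stageOneFactor_pi_div_two (z : ℂ) : stageOneFactor (Real.pi / 2) z = 1 - 2 * z := by
  simp [stageOneFactor]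
  ring

/-- The formula remains valid at `t = 1`, where `cos θ = 0` and the factor is `1 - 2z`; this gives
continuity on the closed first stage. -/
theorem deformationEta_eq_factor {t : ℝ} (ht : t ∈ Icc (0 : ℝ) 1) (z : ℂ) :
    deformationEta t z = -(Complex.exp (-(2 * Complex.I * (Real.pi * t / 2 : ℝ)))
      * Complex.exp (2 * Real.cos (Real.pi * t / 2) * z)
      * stageOneFactor (Real.pi * t / 2) z ^ 2) / (4 * (Real.cos (Real.pi * t / 2) + 1)) := by
  obtain ⟨h1, h2⟩ := cos_sin_mem_of_mem_Icc ht
  rcases ht.2.lt_or_eq with h | rfl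
  · rw [deformationEta_of_lt h]
    exact stageOneEta_eq_factor (by linarith) (cos_pos_of_mem ⟨ht.1, h⟩).ne' (by linarith) z
  · have : -(2 * Complex.I * ((Real.pi / 2 : ℝ) : ℂ)) = -(Real.pi * Complex.I) := by
      push_cast; ring
    rw [deformationEta_one, mul_one, stageOneFactor_pi_div_two, this, Complex.exp_neg,
      Complex.exp_pi_mul_I, Real.cos_pi_div_two]
    simp; ring

theorem deformationH_mul_eq_factor {t : ℝ} (ht : t ∈ Icc (0 : ℝ) 1) (z : ℂ) :
    deformationH t z * deformationEta t z
      = -(Complex.exp (2 * Real.cos (Real.pi * t / 2) * z) * stageOneFactor (Real.pi * t / 2) z)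
        / (2 * (Real.cos (Real.pi * t / 2) + 1)) := by
  obtain ⟨h1, h2⟩ := cos_sin_mem_of_mem_Icc ht
  rcases ht.2.lt_or_eq with h | rfl
  · rw [deformationEta_of_lt h, deformationH_of_lt h]
    exact stageOneH_mul_eq_factor (by linarith) (cos_pos_of_mem ⟨ht.1, h⟩).ne' (by linarith) z
  · rw [deformationEta_one, deformationH_one, mul_one, stageOneFactor_pi_div_two,
      Real.cos_pi_div_two]
    by_cases h0 : 2 * z - 1 = 0
    · have : 1 - 2 * z = 0 := by linear_combination -h0
      simp [h0, this]
    · field_simp; simp; ring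

/-- `(2 / α) sinh (α w / 2)`, extended to `α = 0`. -/
def sinhFactor (α : ℝ) (w : ℂ) : ℂ := w * dslope Complex.sinh 0 (α * w / 2)

theorem sinhFactor_eq {α : ℝ} (hα : α ≠ 0) (w : ℂ) :
    sinhFactor α w = 2 / α * Complex.sinh (α * w / 2) := by
  have hα' : (α : ℂ) ≠ 0 := by exact_mod_cast hα
  rw [← mul_dslope_sinh, sinhFactor]
  field_simp

theorem sinhFactor_zero (w : ℂ) : sinhFactor 0 w = w := by
  simp [sinhFactor]

theorem deformation_second_stage {t : ℝ} (ht : t ∈ Icc (1 : ℝ) 2) (z : ℂ) :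
    deformationEta t z = sinhFactor (2 * (t - 1)) (z - centre t) ^ 2 ∧
    deformationH t z * deformationEta t z = sinhFactor (2 * (t - 1)) (z - centre t)
      * Complex.cosh ((2 * (t - 1) : ℝ) * (z - centre t) / 2) := by
  rcases ht.1.eq_or_lt with rfl | h
  · have : centre 1 = 1 / 2 := by simp only [centre]; push_cast; ring
    rw [deformationEta_one, deformationH_one, sub_self, mul_zero, sinhFactor_zero, this]
    constructor
    · ring
    · by_cases h0 : 2 * z - 1 = 0
      · have : z - 1 / 2 = 0 := by linear_combination h0 / 2
        beta_reduce
        rw [h0, this]; simp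
      · simp; field_simp; norm_num
  · have hα : 2 * (t - 1) ≠ 0 := by linarith
    rw [deformationEta_of_mem_Ioc ⟨h, ht.2⟩, deformationH_of_mem_Ioc ⟨h, ht.2⟩, sinhFactor_eq hα]
    generalize 2 * (t - 1) = α at *
    have hα' : (α : ℂ) ≠ 0 := by exact_mod_cast hα
    simp only [bonnetH, bonnetEta]
    constructor
    · push_cast; ring
    · by_cases h0 : Complex.sinh (α * (z - centre t) / 2) = 0
      · simp [h0]
      · push_cast; field_simp

theorem deformation_third_stage {t : ℝ} (ht : t ∈ Icc (2 : ℝ) 3) (z : ℂ) :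
    deformationEta t z = -Complex.cosh ((2 * (3 - t) : ℝ) * z / 2) ^ 2 ∧
    deformationH t z * deformationEta t z = -(sinhFactor (2 * (3 - t)) z
      * Complex.cosh ((2 * (3 - t) : ℝ) * z / 2)) := by
  rcases ht.2.eq_or_lt with rfl | h
  · rw [deformationEta_three, deformationH_three, sub_self, mul_zero, sinhFactor_zero]
    simp
  · have hα : 2 * (3 - t) ≠ 0 := by linarith
    rw [deformationEta_of_mem_Ico ⟨ht.1, h⟩, deformationH_of_mem_Ico ⟨ht.1, h⟩, sinhFactor_eq hα]
    generalize 2 * (3 - t) = α at *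
    simp only [stageThreeH, stageThreeEta, Complex.tanh_eq_sinh_div_cosh, true_and]
    by_cases h0 : Complex.cosh (α * z / 2) = 0
    · simp [h0]
    · field_simp

theorem continuousOn_of_stages {G : ℝ × ℂ → ℂ} (h1 : ContinuousOn G (Icc (0 : ℝ) 1 ×ˢ univ))
    (h2 : ContinuousOn G (Icc (1 : ℝ) 2 ×ˢ univ)) (h3 : ContinuousOn G (Icc (2 : ℝ) 3 ×ˢ univ)) :
    ContinuousOn G (Icc (0 : ℝ) 3 ×ˢ univ) := by
  have := (h1.union_of_isClosed h2 (isClosed_Icc.prod isClosed_univ)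
    (isClosed_Icc.prod isClosed_univ)).union_of_isClosed h3
    ((isClosed_Icc.prod isClosed_univ).union (isClosed_Icc.prod isClosed_univ))
    (isClosed_Icc.prod isClosed_univ)
  refine this.mono ?_
  rintro ⟨t, z⟩ ⟨ht, -⟩
  simp only [mem_union, mem_prod, mem_univ, and_true, mem_Icc] at ht ⊢
  rcases le_total t 1 with h | h
  · exact Or.inl (Or.inl ⟨ht.1, h⟩)
  · rcases le_total t 2 with h' | h'
    · exact Or.inl (Or.inr ⟨h, h'⟩)
    · exact Or.inr ⟨h', ht.2⟩

theorem continuous_sinhFactor : Continuous fun p : ℝ × ℂ => sinhFactor p.1 p.2 := by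
  have h := continuous_dslope_of_differentiable Complex.differentiable_sinh
  unfold sinhFactor
  fun_prop

theorem continuous_centre : Continuous centre := by
  unfold centre
  fun_prop

theorem continuousOn_deformationEta :
    ContinuousOn (fun p : ℝ × ℂ => deformationEta p.1 p.2) (Icc (0 : ℝ) 3 ×ˢ univ) := by
  have hc := continuous_centre
  have hS := continuous_sinhFactor
  apply continuousOn_of_stages
  · refine ContinuousOn.congr ?_ fun p hp => deformationEta_eq_factor hp.1 p.2
    have h := continuousOn_stageOneFactor
    refine ContinuousOn.div (ContinuousOn.neg (ContinuousOn.mul (Continuous.continuousOn ?_)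
      (h.pow 2))) (Continuous.continuousOn ?_) ?_
    · fun_prop
    · fun_prop
    · intro p hp
      have h1 : 4 * (Real.cos (Real.pi * p.1 / 2) + 1) ≠ 0 := by
        linarith [(cos_sin_mem_of_mem_Icc hp.1).1]
      exact_mod_cast h1
  · refine ContinuousOn.congr ?_ fun p hp => (deformation_second_stage hp.1 p.2).1
    have h : Continuous fun p : ℝ × ℂ => sinhFactor (2 * (p.1 - 1)) (p.2 - centre p.1) :=
      hS.comp (f := fun p : ℝ × ℂ => (2 * (p.1 - 1), p.2 - centre p.1)) (by fun_prop)
    exact (h.pow 2).continuousOn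
  · refine ContinuousOn.congr ?_ fun p hp => (deformation_third_stage hp.1 p.2).1
    fun_prop

theorem continuousOn_deformationH_mul :
    ContinuousOn (fun p : ℝ × ℂ => deformationH p.1 p.2 * deformationEta p.1 p.2)
      (Icc (0 : ℝ) 3 ×ˢ univ) := by
  have hc := continuous_centre
  have hS := continuous_sinhFactor
  apply continuousOn_of_stages
  · refine ContinuousOn.congr ?_ fun p hp => deformationH_mul_eq_factor hp.1 p.2
    have h := continuousOn_stageOneFactor
    refine ContinuousOn.div (ContinuousOn.neg (ContinuousOn.mul (Continuous.continuousOn ?_)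
      h)) (Continuous.continuousOn ?_) ?_
    · fun_prop
    · fun_prop
    · intro p hp
      have h1 : 2 * (Real.cos (Real.pi * p.1 / 2) + 1) ≠ 0 := by
        linarith [(cos_sin_mem_of_mem_Icc hp.1).1]
      exact_mod_cast h1
  · refine ContinuousOn.congr ?_ fun p hp => (deformation_second_stage hp.1 p.2).2
    have h : Continuous fun p : ℝ × ℂ => sinhFactor (2 * (p.1 - 1)) (p.2 - centre p.1) :=
      hS.comp (f := fun p : ℝ × ℂ => (2 * (p.1 - 1), p.2 - centre p.1)) (by fun_prop)
    exact (h.mul (by fun_prop)).continuousOn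
  · refine ContinuousOn.congr ?_ fun p hp => (deformation_third_stage hp.1 p.2).2
    have h : Continuous fun p : ℝ × ℂ => sinhFactor (2 * (3 - p.1)) p.2 :=
      hS.comp (f := fun p : ℝ × ℂ => (2 * (3 - p.1), p.2)) (by fun_prop)
    exact (h.mul (by fun_prop)).neg.continuousOn

theorem continuousOn_segmentIntegral {T : Set ℝ} {G : ℝ → ℂ → ℂ}
    (hG : ContinuousOn (fun p : ℝ × ℂ => G p.1 p.2) (T ×ˢ univ)) :
    ContinuousOn (fun p : ℝ × ℂ => segmentIntegral (G p.1) p.2) (T ×ˢ univ) := by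
  rw [continuousOn_iff_continuous_domRestrict]
  apply intervalIntegral.continuous_parametric_intervalIntegral_of_continuous'
  refine Continuous.mul ?_ (by fun_prop)
  exact hG.comp_continuous (f := fun q : (T ×ˢ (univ : Set ℂ) : Set (ℝ × ℂ)) × ℝ =>
    (q.1.1.1, (q.2 : ℂ) * q.1.1.2)) (by fun_prop) fun q => ⟨q.1.2.1, mem_univ _⟩

theorem continuousOn_deformation :
    ContinuousOn (Function.uncurry deformation) (Icc (0 : ℝ) 3 ×ˢ univ) := by
  have e : Function.uncurry deformation = fun p : ℝ × ℂ =>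
      surf (segmentIntegral fun z => deformationH p.1 z * deformationEta p.1 z)
        (segmentIntegral (deformationEta p.1)) p.2 := by
    funext p
    exact congrFun (IsSpinorial.weierstrassSurface_eq _ _) p.2
  have h1 := continuousOn_segmentIntegral
    (G := fun t z => deformationH t z * deformationEta t z) continuousOn_deformationH_mul
  have h2 := continuousOn_segmentIntegral (G := deformationEta) continuousOn_deformationEta
  rw [e, continuousOn_pi]
  intro i
  fin_cases i
  · exact Complex.continuous_re.comp_continuousOn h1
  · exact Complex.continuous_re.comp_continuousOn h2
  · exact Complex.continuous_im.comp_continuousOn h2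

/-- Joint continuity and compactness of `K` give uniformity in `z`, as in the tube lemma. -/
theorem tendstoUniformlyOn_of_continuousOn {f : ℝ → ℂ → I3} {T : Set ℝ}
    (hf : ContinuousOn f.uncurry (T ×ˢ univ)) {t₀ : ℝ} (ht₀ : t₀ ∈ T) {K : Set ℂ}
    (hK : IsCompact K) : TendstoUniformlyOn f (f t₀) (𝓝[T] t₀) K := by
  intro u hu
  obtain ⟨v, hv, h⟩ := hK.mem_uniformity_of_prod
    (hf.mono (prod_mono_right (subset_univ K))) ht₀ (symm_le_uniformity hu)
  filter_upwards [hv] with t ht z hz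
  exact h t ht z hz

theorem tendstoUniformlyOn_deformation {t₀ : ℝ} (ht₀ : t₀ ∈ Icc (0 : ℝ) 3) {K : Set ℂ}
    (hK : IsCompact K) :
    TendstoUniformlyOn deformation (deformation t₀) (𝓝[Icc (0 : ℝ) 3] t₀) K :=
  tendstoUniformlyOn_of_continuousOn continuousOn_deformation ht₀ hK

/-! Spacelike immersions as graphs over the `(x, y)`-plane -/

/-- Serves both over `ℝ`, for the projection of the surface, and over `ℂ`, for the canonical
coordinate. The image is a whole ball so that theorems about functions on discs apply. -/
theorem exists_local_inverse {𝕂 E : Type*} [RCLike 𝕂] [NormedAddCommGroup E] [NormedSpace 𝕂 E]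
    [CompleteSpace E] {S : Set E} (hS : IsOpen S) {f : E → E} (hf : ContDiffOn 𝕂 ∞ f S)
    (hinv : ∀ z ∈ S, ∃ A : E ≃L[𝕂] E, HasFDerivAt f (A : E →L[𝕂] E) z) {p : E} (hp : p ∈ S) :
    ∃ (V : Set E) (r : ℝ) (g : E → E), IsOpen V ∧ p ∈ V ∧ V ⊆ S ∧ 0 < r ∧
      (∀ z ∈ V, f z ∈ Metric.ball (f p) r ∧ g (f z) = z) ∧
      (∀ w ∈ Metric.ball (f p) r, g w ∈ V ∧ f (g w) = w) ∧
      ContDiffOn 𝕂 ∞ g (Metric.ball (f p) r) := by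
  obtain ⟨A, hA⟩ := hinv p hp
  have hfp : ContDiffAt 𝕂 ∞ f p := hf.contDiffAt (hS.mem_nhds hp)
  set e := (hfp.toOpenPartialHomeomorph f hA (by simp)).restrOpen S hS with he
  have hes : p ∈ e.source := ⟨hfp.mem_toOpenPartialHomeomorph_source hA (by simp), hp⟩
  have hef : ∀ z, e z = f z := fun z => rfl
  have hsub : e.source ⊆ S := fun z hz => hz.2
  obtain ⟨r, hr, hball⟩ := Metric.isOpen_iff.1 e.open_target (f p) (e.map_source hes)
  refine ⟨e.source ∩ e ⁻¹' Metric.ball (f p) r, r, e.symm,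
    e.isOpen_inter_preimage Metric.isOpen_ball, ⟨hes, Metric.mem_ball_self hr⟩,
    fun z hz => hsub hz.1, hr, fun z hz => ⟨hz.2, e.left_inv hz.1⟩, fun w hw => ?_, fun w hw => ?_⟩
  · have h1 := e.right_inv (hball hw)
    refine ⟨⟨e.map_target (hball hw), ?_⟩, h1⟩
    rw [mem_preimage, h1]
    exact hw
  · obtain ⟨A', hA'⟩ := hinv (e.symm w) (hsub (e.map_target (hball hw)))
    exact (e.contDiffAt_symm (hball hw) hA'
      (hf.contDiffAt (hS.mem_nhds (hsub (e.map_target (hball hw)))))).contDiffWithinAt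

/-- `proj` as a continuous linear map. -/
def projCLM : I3 →L[ℝ] ℂ :=
  (ContinuousLinearMap.proj (R := ℝ) (φ := fun _ : Fin 3 => ℝ) 1).smulRight (1 : ℂ)
    + (ContinuousLinearMap.proj (R := ℝ) (φ := fun _ : Fin 3 => ℝ) 2).smulRight Complex.I

theorem projCLM_apply (P : I3) : projCLM P = proj P := by
  apply Complex.ext <;> simp [projCLM, proj]

theorem hasFDerivAt_proj {X : ℂ → I3} {z : ℂ} (hX : DifferentiableAt ℝ X z) :
    HasFDerivAt (fun z => proj (X z)) (projCLM ∘L fderiv ℝ X z) z := by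
  have := projCLM.hasFDerivAt.comp z hX.hasFDerivAt
  refine this.congr_of_eventuallyEq (Eventually.of_forall fun w => ?_)
  simp [projCLM_apply]

theorem firstForm_eq_proj (X : ℂ → I3) (z ξ ζ : ℂ) :
    firstForm X z ξ ζ = (proj (fderiv ℝ X z ξ)).re * (proj (fderiv ℝ X z ζ)).re
      + (proj (fderiv ℝ X z ξ)).im * (proj (fderiv ℝ X z ζ)).im := by
  rw [firstForm, lorentz_toMinkowski]; rfl

theorem proj_fderiv_ne_zero {X : ℂ → I3} {z : ℂ} (h : ∀ ξ : ℂ, ξ ≠ 0 → 0 < firstForm X z ξ ξ)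
    {ξ : ℂ} (hξ : ξ ≠ 0) : proj (fderiv ℝ X z ξ) ≠ 0 := by
  intro h0
  have := h ξ hξ
  rw [firstForm_eq_proj, h0] at this
  simp at this

/-- Positivity of the metric means that the projected differential is injective, hence invertible
between planes. -/
theorem exists_equiv_proj {X : ℂ → I3} {z : ℂ} (hX : DifferentiableAt ℝ X z)
    (h : ∀ ξ : ℂ, ξ ≠ 0 → 0 < firstForm X z ξ ξ) :
    ∃ A : ℂ ≃L[ℝ] ℂ, HasFDerivAt (fun z => proj (X z)) (A : ℂ →L[ℝ] ℂ) z ∧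
      ∀ ξ, A ξ = proj (fderiv ℝ X z ξ) := by
  set T : ℂ →L[ℝ] ℂ := projCLM ∘L fderiv ℝ X z with hT
  have hTξ : ∀ ξ, T ξ = proj (fderiv ℝ X z ξ) := fun ξ => by simp [hT, projCLM_apply]
  have hinj : Function.Injective (T : ℂ →ₗ[ℝ] ℂ) := by
    rw [← LinearMap.ker_eq_bot, LinearMap.ker_eq_bot']
    intro ξ hξ
    by_contra hne
    exact proj_fderiv_ne_zero h hne ((hTξ ξ).symm.trans hξ)
  refine ⟨(LinearEquiv.ofInjectiveEndo (T : ℂ →ₗ[ℝ] ℂ) hinj).toContinuousLinearEquiv, ?_, hTξ⟩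
  refine (hasFDerivAt_proj hX).congr_fderiv ?_
  ext ξ; rfl

/-- The second fundamental form of a graph is the Hessian of the height function. -/
theorem secondForm_graph {X : ℂ → I3} {u : ℂ → ℝ} {z : ℂ} (hX : ContDiffAt ℝ 2 X z)
    (hpos : ∀ ξ : ℂ, ξ ≠ 0 → 0 < firstForm X z ξ ξ) (hu : ContDiffAt ℝ 2 u (proj (X z)))
    (he : ∀ᶠ w in 𝓝 z, X w 0 = u (proj (X w))) (ξ ζ : ℂ) :
    secondForm X z ξ ζ = fderiv ℝ (fderiv ℝ u) (proj (X z)) (proj (fderiv ℝ X z ζ))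
      (proj (fderiv ℝ X z ξ)) := by
  have hX1 : ∀ᶠ w in 𝓝 z, DifferentiableAt ℝ X w :=
    (hX.eventually (by simp)).mono fun w hw => hw.differentiableAt (by simp)
  have hπ : ContinuousAt (fun z => proj (X z)) z :=
    (hasFDerivAt_proj hX1.self_of_nhds).continuousAt
  have hu1 : ∀ᶠ w in 𝓝 z, DifferentiableAt ℝ u (proj (X w)) :=
    hπ.eventually ((hu.eventually (by simp)).mono fun w hw => hw.differentiableAt (by simp))
  have hcomp : ∀ {w : ℂ}, DifferentiableAt ℝ X w → ∀ i : Fin 3, ∀ v,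
      fderiv ℝ (fun y => X y i) w v = fderiv ℝ X w v i := by
    intro w hw i v
    rw [(hasFDerivAt_pi'.1 hw.hasFDerivAt i).fderiv]; rfl
  have key : ∀ᶠ w in 𝓝 z, ∀ v, fderiv ℝ X w v 0
      = fderiv ℝ u (proj (X w)) (proj (fderiv ℝ X w v)) := by
    filter_upwards [hX1, hu1, he.eventually_nhds] with w h1 h2 h3 v
    have e1 : HasFDerivAt (fun w => u (proj (X w)))
        (fderiv ℝ u (proj (X w)) ∘L (projCLM ∘L fderiv ℝ X w)) w :=
      h2.hasFDerivAt.comp w (hasFDerivAt_proj h1)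
    have e2 : fderiv ℝ (fun w => X w 0) w v = fderiv ℝ (fun w => u (proj (X w))) w v := by
      rw [EventuallyEq.fderiv_eq h3]
    rw [hcomp h1, e1.fderiv] at e2
    simpa [projCLM_apply] using e2
  have hV : DifferentiableAt ℝ (fun w => fderiv ℝ X w ξ) z := by
    have : DifferentiableAt ℝ (fderiv ℝ X) z :=
      (hX.fderiv_right (m := 1) (by norm_num)).differentiableAt (by simp)
    exact this.clm_apply (differentiableAt_const _)
  have hDu : DifferentiableAt ℝ (fderiv ℝ u) (proj (X z)) :=
    (hu.fderiv_right (m := 1) (by norm_num)).differentiableAt (by simp)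
  have h0 : fderiv ℝ (fun w => fderiv ℝ X w ξ) z ζ 0
      = fderiv ℝ (fderiv ℝ u) (proj (X z)) (proj (fderiv ℝ X z ζ)) (proj (fderiv ℝ X z ξ))
        + fderiv ℝ u (proj (X z)) (proj (fderiv ℝ (fun w => fderiv ℝ X w ξ) z ζ)) := by
    have e1 : HasFDerivAt (fun w => fderiv ℝ u (proj (X w)))
        (fderiv ℝ (fderiv ℝ u) (proj (X z)) ∘L (projCLM ∘L fderiv ℝ X z)) z :=
      hDu.hasFDerivAt.comp z (hasFDerivAt_proj hX1.self_of_nhds)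
    have e2 := e1.clm_apply (hasFDerivAt_proj hV)
    have e3 : (fun w => fderiv ℝ X w ξ 0) =ᶠ[𝓝 z]
        fun w => fderiv ℝ u (proj (X w)) (proj (fderiv ℝ X w ξ)) := key.mono fun w hw => hw ξ
    have e4 : fderiv ℝ (fun w => fderiv ℝ X w ξ 0) z ζ = fderiv ℝ (fun w => fderiv ℝ X w ξ) z ζ 0 := by
      rw [(hasFDerivAt_pi'.1 hV.hasFDerivAt 0).fderiv]; rfl
    rw [← e4, e3.fderiv_eq, e2.fderiv]
    simp [projCLM_apply]
    ring
  have hlin : ∀ (T : ℂ →L[ℝ] ℝ) (P : I3), T (proj P) = P 1 * T 1 + P 2 * T Complex.I := by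
    intro T P
    have : proj P = P 1 • (1 : ℂ) + P 2 • Complex.I := by
      apply Complex.ext <;> simp [proj]
    rw [this, map_add, map_smul, map_smul]; rfl
  -- The Gauss map has tangential part `-∇u`. Pairing with it removes the term in which `du` acts on
  -- the second derivative of the projection and leaves the Hessian.
  rw [secondForm, lorentz_gaussMap hpos (ν₁ := -fderiv ℝ u (proj (X z)) 1)
    (ν₂ := -fderiv ℝ u (proj (X z)) Complex.I), h0, hlin (fderiv ℝ u (proj (X z)))]
  · ring
  · intro v
    rw [key.self_of_nhds, hlin]
    ring

/-- The projection carries the first fundamental form to the Euclidean metric and the second to the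
Hessian of `u`, so the trace defining the mean curvature is the Laplacian of `u`. -/
theorem laplacian_eq_zero_of_meanCurvature {X : ℂ → I3} {u : ℂ → ℝ} {z : ℂ}
    (hX : ContDiffAt ℝ 2 X z) (hpos : ∀ ξ : ℂ, ξ ≠ 0 → 0 < firstForm X z ξ ξ)
    (hu : ContDiffAt ℝ 2 u (proj (X z))) (he : ∀ᶠ w in 𝓝 z, X w 0 = u (proj (X w)))
    (hH : meanCurvature X z = 0) : Laplacian.laplacian u (proj (X z)) = 0 := by
  rw [congrFun (InnerProductSpace.laplacian_eq_iteratedFDeriv_complexPlane u) (proj (X z)),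
    iteratedFDeriv_two_apply, iteratedFDeriv_two_apply]
  have hsymm : fderiv ℝ (fderiv ℝ u) (proj (X z)) 1 Complex.I
      = fderiv ℝ (fderiv ℝ u) (proj (X z)) Complex.I 1 :=
    (hu.isSymmSndFDerivAt (by simp)).eq _ _
  have hdet := projDet_ne_zero hpos
  have hII := secondForm_graph hX hpos hu he
  rw [meanCurvature] at hH
  simp only [hII, firstForm_eq_proj] at hH
  set B := fderiv ℝ (fderiv ℝ u) (proj (X z)) with hB
  have hlin : ∀ v w : ℂ, B v w = v.re * w.re * B 1 1 + (v.re * w.im + v.im * w.re) * B 1 Complex.I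
      + v.im * w.im * B Complex.I Complex.I := by
    intro v w
    have e : ∀ v : ℂ, v = v.re • (1 : ℂ) + v.im • Complex.I := fun v => by
      apply Complex.ext <;> simp
    conv_lhs => rw [e v, e w]
    simp only [map_add, map_smul, add_apply, smul_apply,
      smul_eq_mul]
    rw [← hsymm]
    ring
  rw [projDet] at hdet
  simp only [hlin (proj _)] at hH
  simp only [proj] at hH
  set a := fderiv ℝ X z 1 1
  set b := fderiv ℝ X z 1 2
  set c := fderiv ℝ X z Complex.I 1
  set d := fderiv ℝ X z Complex.I 2
  have hden : 2 * ((a * a + b * b) * (c * c + d * d) - (a * c + b * d) ^ 2)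
      = 2 * (a * d - c * b) ^ 2 := by ring
  rw [hden, div_eq_zero_iff] at hH
  have hH' := hH.resolve_right (mul_ne_zero two_ne_zero (pow_ne_zero 2 hdet))
  have : (a * d - c * b) ^ 2 * (B 1 1 + B Complex.I Complex.I) = 0 := by
    rw [← hH']; ring
  simpa [pow_ne_zero 2 hdet] using! this

theorem fderiv_fderiv_re {H H' : ℂ → ℂ} {w c : ℂ} (h : ∀ᶠ y in 𝓝 w, HasDerivAt H (H' y) y)
    (h' : HasDerivAt H' c w) (v₁ v₂ : ℂ) :
    fderiv ℝ (fderiv ℝ fun y => (H y).re) w v₁ v₂ = (c * v₁ * v₂).re := by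
  have e : fderiv ℝ (fun y => (H y).re) =ᶠ[𝓝 w]
      fun y => Complex.reCLM ∘L (ContinuousLinearMap.mul ℝ ℂ (H' y)) := by
    filter_upwards [h] with y hy
    refine (Complex.reCLM.hasFDerivAt.comp y (hy.hasFDerivAt.restrictScalars ℝ)).fderiv.trans ?_
    ext v; simp; ring
  rw [e.fderiv_eq]
  have h1 := ((ContinuousLinearMap.compL ℝ ℂ ℂ ℝ Complex.reCLM) ∘L
    (ContinuousLinearMap.mul ℝ ℂ)).hasFDerivAt.comp w (h'.hasFDerivAt.restrictScalars ℝ)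
  have h2 : (fun y => Complex.reCLM ∘L (ContinuousLinearMap.mul ℝ ℂ (H' y)))
      = ((ContinuousLinearMap.compL ℝ ℂ ℂ ℝ Complex.reCLM) ∘L (ContinuousLinearMap.mul ℝ ℂ)) ∘ H' :=
    rfl
  rw [h2, h1.fderiv]
  simp
  ring

/-- A chart in which `X` is the graph of the real part of the holomorphic function `H` over
a disc. -/
structure IsGraphChart (S : Set ℂ) (X : ℂ → I3) (V : Set ℂ) (w₀ : ℂ) (r : ℝ) (σ : ℂ → ℂ)
    (H : ℂ → ℂ) : Prop where
  isOpen : IsOpen V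
  subset : V ⊆ S
  pos : 0 < r
  left_inv : ∀ z ∈ V, proj (X z) ∈ Metric.ball w₀ r ∧ σ (proj (X z)) = z
  right_inv : ∀ w ∈ Metric.ball w₀ r, σ w ∈ V ∧ proj (X (σ w)) = w
  smooth : ContDiffOn ℝ ∞ σ (Metric.ball w₀ r)
  holo : DifferentiableOn ℂ H (Metric.ball w₀ r)
  height : ∀ z ∈ V, X z 0 = (H (proj (X z))).re

theorem two_le_infty : (2 : WithTop ℕ∞) ≤ ∞ := WithTop.coe_le_coe.2 le_top

theorem exists_graph_chart {S : Set ℂ} {X : ℂ → I3} (hS : IsOpen S)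
    (hX : IsSpacelikeImmersion S X) (hH : ∀ z ∈ S, meanCurvature X z = 0) {p : ℂ} (hp : p ∈ S) :
    ∃ (V : Set ℂ) (r : ℝ) (σ H : ℂ → ℂ), p ∈ V ∧ IsGraphChart S X V (proj (X p)) r σ H := by
  have hXd : ∀ z ∈ S, ContDiffAt ℝ ∞ X z := fun z hz => hX.1.contDiffAt (hS.mem_nhds hz)
  have hπ : ContDiffOn ℝ ∞ (fun z => proj (X z)) S := by
    refine (projCLM.contDiff.comp_contDiffOn hX.1).congr fun z _ => ?_
    simp [projCLM_apply]
  obtain ⟨V, r, σ, hV, hpV, hVS, hr, h1, h2, h3⟩ := exists_local_inverse hS hπ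
    (fun z hz => (exists_equiv_proj ((hXd z hz).differentiableAt (by simp))
      (hX.2 z hz)).imp fun A hA => hA.1) hp
  set u : ℂ → ℝ := fun w => X (σ w) 0 with hu
  have huX : ∀ z ∈ V, X z 0 = u (proj (X z)) := fun z hz => by
    rw [hu]; simp only [(h1 z hz).2]
  have hus : ∀ w ∈ Metric.ball (proj (X p)) r, ContDiffAt ℝ 2 u w := fun w hw => by
    have hσ : ContDiffAt ℝ ∞ σ w := h3.contDiffAt (Metric.isOpen_ball.mem_nhds hw)
    have := (hXd (σ w) (hVS (h2 w hw).1)).comp w hσ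
    exact ((contDiffAt_pi.1 this 0).of_le two_le_infty)
  have hharm : InnerProductSpace.HarmonicOnNhd u (Metric.ball (proj (X p)) r) := by
    intro w hw
    refine ⟨hus w hw, ?_⟩
    filter_upwards [Metric.isOpen_ball.mem_nhds hw] with w' hw'
    obtain ⟨hz, hzw⟩ := h2 w' hw'
    have := laplacian_eq_zero_of_meanCurvature (u := u) (z := σ w')
      ((hXd _ (hVS hz)).of_le two_le_infty) (hX.2 _ (hVS hz))
      (by rw [hzw]; exact hus w' hw') (eventually_of_mem (hV.mem_nhds hz) huX) (hH _ (hVS hz))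
    rw [hzw] at this
    exact this
  obtain ⟨H, hHa, hHu⟩ := hharm.exists_analyticOnNhd_ball_re_eq
  refine ⟨V, r, σ, H, hpV, hV, hVS, hr, h1, h2, h3, hHa.differentiableOn, fun z hz => ?_⟩
  rw [huX z hz]
  exact (hHu (h1 z hz).1).symm

/-- `Re(cvw)` is trace-free, so it is a multiple of the Euclidean metric only if it is zero; thus
the umbilics are the zeros of `H''`. -/
theorem eq_zero_of_re_mul_eq {c : ℂ} {κ : ℝ}
    (h : ∀ v w : ℂ, (c * v * w).re = κ * (v.re * w.re + v.im * w.im)) : c = 0 := by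
  have h1 := h 1 1
  have h2 := h 1 Complex.I
  have h3 := h Complex.I Complex.I
  simp at h1 h2 h3
  apply Complex.ext
  · simp; linarith
  · simp; linarith

namespace IsGraphChart

variable {S V : Set ℂ} {X : ℂ → I3} {w₀ : ℂ} {r : ℝ} {σ H : ℂ → ℂ}

theorem secondForm_eq (h : IsGraphChart S X V w₀ r σ H) (hS : IsOpen S)
    (hX : IsSpacelikeImmersion S X) {z : ℂ} (hz : z ∈ V) (ξ ζ : ℂ) :
    secondForm X z ξ ζ = (deriv (deriv H) (proj (X z)) * proj (fderiv ℝ X z ξ)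
      * proj (fderiv ℝ X z ζ)).re := by
  have hw := (h.left_inv z hz).1
  have hball := Metric.isOpen_ball.mem_nhds hw
  have hH : ContDiffAt ℝ 2 (fun w => (H w).re) (proj (X z)) :=
    Complex.reCLM.contDiff.contDiffAt.comp _
      ((h.holo.analyticOnNhd Metric.isOpen_ball _ hw).contDiffAt.restrict_scalars ℝ)
  rw [secondForm_graph ((hX.1.contDiffAt (hS.mem_nhds (h.subset hz))).of_le two_le_infty)
    (hX.2 z (h.subset hz)) hH (eventually_of_mem (h.isOpen.mem_nhds hz) h.height),
    fderiv_fderiv_re (H' := deriv H) (c := deriv (deriv H) (proj (X z)))]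
  · ring_nf
  · filter_upwards [hball] with y hy
    exact (h.holo.differentiableAt (Metric.isOpen_ball.mem_nhds hy)).hasDerivAt
  · exact ((h.holo.deriv Metric.isOpen_ball).differentiableAt hball).hasDerivAt

theorem isUmbilic_iff (h : IsGraphChart S X V w₀ r σ H) (hS : IsOpen S)
    (hX : IsSpacelikeImmersion S X) {z : ℂ} (hz : z ∈ V) :
    IsUmbilic X z ↔ deriv (deriv H) (proj (X z)) = 0 := by
  constructor
  · rintro ⟨κ, hκ⟩
    obtain ⟨A, -, hA⟩ := exists_equiv_proj ((hX.1.contDiffAt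
      (hS.mem_nhds (h.subset hz))).differentiableAt (by simp)) (hX.2 z (h.subset hz))
    have key : ∀ v w : ℂ, (deriv (deriv H) (proj (X z)) * v * w).re
        = κ * (v.re * w.re + v.im * w.im) := by
      intro v w
      have := hκ (A.symm v) (A.symm w)
      rw [h.secondForm_eq hS hX hz, firstForm_eq_proj, ← hA, ← hA, A.apply_symm_apply,
        A.apply_symm_apply] at this
      exact this
    exact eq_zero_of_re_mul_eq key
  · intro h0
    exact ⟨0, fun ξ ζ => by rw [h.secondForm_eq hS hX hz, h0]; simp⟩

end IsGraphChart

/-! ### Canonical coordinates and the planarity condition. -/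

/-- Near a point where `q` does not vanish there is a coordinate `Z` with `Z'² = q`; its inverse
`υ` has the derivative `φ²` with `φ⁴ q = 1`. -/
theorem exists_canonical_coordinate {B : Set ℂ} (hB : IsOpen B) {q : ℂ → ℂ}
    (hq : DifferentiableOn ℂ q B) {w₀ : ℂ} (hw₀ : w₀ ∈ B) (h0 : q w₀ ≠ 0) :
    ∃ (V : Set ℂ) (ρ : ℝ) (Z υ φ : ℂ → ℂ), IsOpen V ∧ w₀ ∈ V ∧ V ⊆ B ∧ 0 < ρ ∧
      (∀ w ∈ V, Z w ∈ Metric.ball 0 ρ ∧ υ (Z w) = w) ∧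
      (∀ ζ ∈ Metric.ball 0 ρ, υ ζ ∈ V ∧ Z (υ ζ) = ζ) ∧ ContDiffOn ℂ ∞ Z V ∧
      (∀ ζ ∈ Metric.ball 0 ρ, HasDerivAt υ (φ ζ ^ 2) ζ) ∧
      DifferentiableOn ℂ φ (Metric.ball 0 ρ) ∧ ∀ ζ ∈ Metric.ball 0 ρ, φ ζ ^ 4 * q (υ ζ) = 1 := by
  -- The fourth root `f` of `1/q` is built from a root `C` of its value at `w₀` and the logarithm of
  -- `q/q(w₀)`, which is near `1` and so avoids the branch cut.
  obtain ⟨C, hC⟩ := IsAlgClosed.exists_pow_nat_eq (q w₀)⁻¹ (n := 4) (by norm_num)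
  have hcont : ContinuousAt (fun w => q w / q w₀) w₀ :=
    (hq.continuousOn.continuousAt (hB.mem_nhds hw₀)).div_const _
  have hslit : ∀ᶠ w in 𝓝 w₀, q w / q w₀ ∈ Complex.slitPlane := by
    apply hcont.eventually_mem
    apply Complex.isOpen_slitPlane.mem_nhds
    rw [div_self h0]
    exact Complex.one_mem_slitPlane
  obtain ⟨r, hr, hball⟩ := Metric.eventually_nhds_iff_ball.1 ((hB.eventually_mem hw₀).and hslit)
  set f : ℂ → ℂ := fun w => C * Complex.exp (-(Complex.log (q w / q w₀) / 4)) with hf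
  have hf4 : ∀ w ∈ Metric.ball w₀ r, f w ^ 4 * q w = 1 := by
    intro w hw
    have hne : q w / q w₀ ≠ 0 := Complex.slitPlane_ne_zero (hball w hw).2
    have hqw : q w ≠ 0 := fun h => hne (by rw [h, zero_div])
    rw [hf]
    simp only [mul_pow]
    rw [hC, ← Complex.exp_nat_mul, show ((4 : ℕ) : ℂ) * -(Complex.log (q w / q w₀) / 4)
      = -Complex.log (q w / q w₀) by push_cast; ring, Complex.exp_neg, Complex.exp_log hne]
    field_simp
  have hf0 : ∀ w ∈ Metric.ball w₀ r, f w ≠ 0 := fun w hw h => by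
    have := hf4 w hw
    rw [h] at this
    simp at this
  have hfd : DifferentiableOn ℂ f (Metric.ball w₀ r) := by
    intro w hw
    have h1 : DifferentiableAt ℂ q w := hq.differentiableAt (hB.mem_nhds (hball w hw).1)
    exact ((((h1.div_const _).clog (hball w hw).2).div_const 4).neg.cexp.const_mul
      C).differentiableWithinAt
  -- `Z` is a primitive of `f⁻²`, a square root of `q`; its inverse then has derivative `f²`.
  obtain ⟨Z, hZ0, hZ⟩ := (hfd.pow 2).inv (fun w hw => pow_ne_zero 2 (hf0 w hw))
    |>.isExactOn_ball.with_val_at w₀ 0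
  have hZd : DifferentiableOn ℂ Z (Metric.ball w₀ r) := fun w hw =>
    (hZ w hw).differentiableAt.differentiableWithinAt
  have hZc : ContDiffOn ℂ ∞ Z (Metric.ball w₀ r) := hZd.contDiffOn Metric.isOpen_ball
  obtain ⟨V, ρ, υ, hV, hwV, hVB, hρ, h1, h2, h3⟩ := exists_local_inverse Metric.isOpen_ball hZc
    (fun w hw => ⟨_, (hZ w hw).hasFDerivAt_equiv (inv_ne_zero (pow_ne_zero 2 (hf0 w hw)))⟩)
    (Metric.mem_ball_self hr)
  rw [hZ0] at h1 h2 h3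
  have hυ : ∀ ζ ∈ Metric.ball (0 : ℂ) ρ, HasDerivAt υ (f (υ ζ) ^ 2) ζ := by
    intro ζ hζ
    have hmem := Metric.isOpen_ball.mem_nhds hζ
    have d1 : HasDerivAt υ (deriv υ ζ) ζ :=
      ((h3.differentiableOn (by simp)).differentiableAt hmem).hasDerivAt
    have d2 := (hZ _ (hVB (h2 ζ hζ).1)).comp ζ d1
    have d3 : HasDerivAt (Z ∘ υ) 1 ζ :=
      (hasDerivAt_id ζ).congr_of_eventuallyEq (eventually_of_mem hmem fun ζ hζ => (h2 ζ hζ).2)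
    have := d2.unique d3
    have hne := hf0 _ (hVB (h2 ζ hζ).1)
    have e : deriv υ ζ = f (υ ζ) ^ 2 := by
      simp only [Pi.inv_apply, Pi.pow_apply] at this
      field_simp at this
      exact this
    rwa [e] at d1
  refine ⟨V, ρ, Z, υ, fun ζ => f (υ ζ), hV, hwV, fun w hw => (hball w (hVB hw)).1, hρ, h1, h2,
    hZc.mono hVB, hυ, fun ζ hζ => ?_, fun ζ hζ => hf4 _ (hVB (h2 ζ hζ).1)⟩
  exact ((hfd.differentiableAt (Metric.isOpen_ball.mem_nhds (hVB (h2 ζ hζ).1))).comp ζ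
    (hυ ζ hζ).differentiableAt).differentiableWithinAt

/-- A chart of the surface `X` in which the coordinate lines are the curvature lines. -/
structure IsCanonicalChart (S : Set ℂ) (X : ℂ → I3) (N : Set ℂ) (ρ : ℝ) (χ τ : ℂ → ℂ)
    (φ F L W : ℂ → ℂ) : Prop where
  isOpen : IsOpen N
  subset : N ⊆ S
  pos : 0 < ρ
  left_inv : ∀ z ∈ N, χ z ∈ Metric.ball 0 ρ ∧ τ (χ z) = z
  right_inv : ∀ ζ ∈ Metric.ball 0 ρ, τ ζ ∈ N ∧ χ (τ ζ) = ζ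
  smooth : ContDiffOn ℝ ∞ χ N
  smooth_symm : ContDiffOn ℝ ∞ τ (Metric.ball 0 ρ)
  param : ∀ ζ ∈ Metric.ball 0 ρ, X (τ ζ) = surf L W ζ
  holo : DifferentiableOn ℂ φ (Metric.ball 0 ρ)
  ne_zero : ∀ ζ ∈ Metric.ball 0 ρ, φ ζ ≠ 0
  hasDerivAt_height : ∀ ζ ∈ Metric.ball 0 ρ, HasDerivAt L (F ζ) ζ
  hasDerivAt_proj : ∀ ζ ∈ Metric.ball 0 ρ, HasDerivAt W (φ ζ ^ 2) ζ
  isCanonical : IsCanonical (Metric.ball 0 ρ) (-1) F fun ζ => φ ζ ^ 2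
  second : ∀ ζ ∈ Metric.ball 0 ρ, ∀ ξ ξ', secondForm X (τ ζ) ξ ξ'
    = -((φ ζ ^ 4)⁻¹ * proj (fderiv ℝ X (τ ζ) ξ) * proj (fderiv ℝ X (τ ζ) ξ')).re

/-- Apply the canonical coordinate to `q = -H''`; the sign gives the Hopf differential `-1`, as for
the members of the deformation. The relations between `W`, `φ` and `H''` are recorded for the
equation satisfied by `H''`. -/
theorem IsGraphChart.exists_canonicalChart {S V : Set ℂ} {X : ℂ → I3} {w₀ : ℂ} {r : ℝ}
    {σ H : ℂ → ℂ} (h : IsGraphChart S X V w₀ r σ H) (hS : IsOpen S)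
    (hX : IsSpacelikeImmersion S X) {p : ℂ} (hp : p ∈ V)
    (h0 : deriv (deriv H) (proj (X p)) ≠ 0) :
    ∃ (N : Set ℂ) (ρ : ℝ) (χ τ φ F L W : ℂ → ℂ), p ∈ N ∧ N ⊆ V ∧
      IsCanonicalChart S X N ρ χ τ φ F L W ∧ (∀ z ∈ N, W (χ z) = proj (X z)) ∧
      ∀ ζ ∈ Metric.ball 0 ρ, W ζ ∈ Metric.ball w₀ r ∧ φ ζ ^ 4 * -deriv (deriv H) (W ζ) = 1 := by
  have hB := Metric.isOpen_ball (x := w₀) (ε := r)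
  have hH1 : DifferentiableOn ℂ (deriv H) (Metric.ball w₀ r) := h.holo.deriv hB
  have hH2 : DifferentiableOn ℂ (deriv (deriv H)) (Metric.ball w₀ r) := hH1.deriv hB
  obtain ⟨V', ρ, Z, υ, φ, hV', hpV', hV'B, hρ, h1, h2, hZ, hυ, hφ, hφ4⟩ :=
    exists_canonical_coordinate hB (q := fun w => -deriv (deriv H) w) hH2.neg (h.left_inv p hp).1
      (neg_ne_zero.2 h0)
  have hπ : ContDiffOn ℝ ∞ (fun z => proj (X z)) V := by
    refine (projCLM.contDiff.comp_contDiffOn (hX.1.mono h.subset)).congr fun z _ => ?_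
    simp [projCLM_apply]
  have hφ0 : ∀ ζ ∈ Metric.ball 0 ρ, φ ζ ≠ 0 := fun ζ hζ h => by
    have := hφ4 ζ hζ
    rw [h] at this
    simp at this
  have hυB : ∀ ζ ∈ Metric.ball 0 ρ, υ ζ ∈ Metric.ball w₀ r := fun ζ hζ => hV'B (h2 ζ hζ).1
  have hL : ∀ ζ ∈ Metric.ball 0 ρ, HasDerivAt (fun ζ => H (υ ζ)) (deriv H (υ ζ) * φ ζ ^ 2) ζ :=
    fun ζ hζ => ((h.holo.differentiableAt (hB.mem_nhds (hυB ζ hζ))).hasDerivAt).comp ζ (hυ ζ hζ)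
  have hH1υ : ∀ ζ ∈ Metric.ball 0 ρ,
      HasDerivAt (fun ζ => deriv H (υ ζ)) (deriv (deriv H) (υ ζ) * φ ζ ^ 2) ζ := fun ζ hζ =>
    ((hH1.differentiableAt (hB.mem_nhds (hυB ζ hζ))).hasDerivAt).comp ζ (hυ ζ hζ)
  have hφd : ∀ ζ ∈ Metric.ball 0 ρ, HasDerivAt (fun ζ => φ ζ ^ 2) (2 * φ ζ * deriv φ ζ) ζ :=
    fun ζ hζ => by
      simpa using! (hφ.differentiableAt (Metric.isOpen_ball.mem_nhds hζ)).hasDerivAt.fun_pow 2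
  refine ⟨V ∩ (fun z => proj (X z)) ⁻¹' V', ρ, fun z => Z (proj (X z)), fun ζ => σ (υ ζ), φ,
    fun ζ => deriv H (υ ζ) * φ ζ ^ 2, fun ζ => H (υ ζ), υ, ⟨hp, hpV'⟩, inter_subset_left, ?_,
    fun z hz => (h1 _ hz.2).2, fun ζ hζ => ⟨hυB ζ hζ, hφ4 ζ hζ⟩⟩
  refine ⟨hπ.continuousOn.isOpen_inter_preimage h.isOpen hV', inter_subset_left.trans h.subset, hρ,
    fun z hz => ⟨(h1 _ hz.2).1, ?_⟩, fun ζ hζ => ?_, ?_, ?_, fun ζ hζ => ?_, hφ, hφ0, hL, hυ, ?_,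
    fun ζ hζ ξ ξ' => ?_⟩
  · simp only [(h1 _ hz.2).2]
    exact (h.left_inv z hz.1).2
  · obtain ⟨g1, g2⟩ := h.right_inv _ (hυB ζ hζ)
    refine ⟨⟨g1, ?_⟩, ?_⟩
    · rw [mem_preimage, g2]; exact (h2 ζ hζ).1
    · simp only [g2]; exact (h2 ζ hζ).2
  · exact (hZ.restrict_scalars ℝ).comp (hπ.mono inter_subset_left) fun z hz => hz.2
  · have hυd : DifferentiableOn ℂ υ (Metric.ball 0 ρ) := fun ζ hζ =>
      (hυ ζ hζ).differentiableAt.differentiableWithinAt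
    exact h.smooth.comp ((hυd.contDiffOn Metric.isOpen_ball).restrict_scalars ℝ) hυB
  · obtain ⟨g1, g2⟩ := h.right_inv _ (hυB ζ hζ)
    have g3 := h.height _ g1
    rw [g2] at g3
    funext i
    fin_cases i
    · exact g3
    · exact congrArg Complex.re g2
    · exact congrArg Complex.im g2
  · refine ⟨fun ζ hζ => ((hH1υ ζ hζ).mul (hφd ζ hζ)).differentiableAt.differentiableWithinAt,
      fun ζ hζ => (hφd ζ hζ).differentiableAt.differentiableWithinAt, fun ζ hζ => ?_⟩
    rw [((hH1υ ζ hζ).fun_mul (hφd ζ hζ)).deriv, (hφd ζ hζ).deriv]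
    push_cast
    linear_combination (-φ ζ ^ 2) * hφ4 ζ hζ
  · obtain ⟨g1, g2⟩ := h.right_inv _ (hυB ζ hζ)
    rw [h.secondForm_eq hS hX g1, g2]
    have : deriv (deriv H) (υ ζ) = -(φ ζ ^ 4)⁻¹ := by
      have := hφ4 ζ hζ
      have := hφ0 ζ hζ
      field_simp
      linear_combination -hφ4 ζ hζ
    rw [this]
    simp [neg_mul]

/-- Passes from a function to its derivative along a horizontal segment; it is iterated to
differentiate the equation of the plane three times. -/
theorem re_deriv_eq_zero {G G' : ℂ → ℂ} {ζ₀ : ℂ} {δ d : ℝ}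
    (hG : ∀ s ∈ Ioo (-δ) δ, HasDerivAt G (G' (ζ₀ + (s : ℝ))) (ζ₀ + (s : ℝ)))
    (h : ∀ s ∈ Ioo (-δ) δ, (G (ζ₀ + (s : ℝ))).re = d) :
    ∀ s ∈ Ioo (-δ) δ, (G' (ζ₀ + (s : ℝ))).re = 0 := by
  intro s hs
  have h1 : HasDerivAt (fun s : ℝ => ζ₀ + (s : ℂ)) 1 s := by
    simpa using (Complex.ofRealCLM.hasDerivAt (x := s)).const_add ζ₀
  have h2 : HasDerivAt (fun s : ℝ => (G (ζ₀ + (s : ℂ))).re) (G' (ζ₀ + s)).re s := by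
    simpa using! hasDerivAt_re_comp ((hG s hs).comp s h1)
  exact h2.unique ((hasDerivAt_const s d).congr_of_eventuallyEq
    (eventually_of_mem (isOpen_Ioo.mem_nhds hs) h))

namespace IsCanonicalChart

variable {S N : Set ℂ} {X : ℂ → I3} {ρ : ℝ} {χ τ φ F L W : ℂ → ℂ}

theorem differentiableAt (h : IsCanonicalChart S X N ρ χ τ φ F L W) (hS : IsOpen S)
    (hX : IsSpacelikeImmersion S X) {ζ : ℂ} (hζ : ζ ∈ Metric.ball 0 ρ) :
    DifferentiableAt ℝ X (τ ζ) :=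
  (hX.1.contDiffAt (hS.mem_nhds (h.subset (h.right_inv ζ hζ).1))).differentiableAt (by simp)

/-- The coordinate lines are curvature lines. -/
theorem isCurvatureLine (h : IsCanonicalChart S X N ρ χ τ φ F L W) (hS : IsOpen S)
    (hX : IsSpacelikeImmersion S X) {ζ₀ : ℂ} {δ : ℝ}
    (hδ : ∀ s ∈ Ioo (-δ) δ, ζ₀ + (s : ℝ) ∈ Metric.ball (0 : ℂ) ρ) :
    IsCurvatureLine S X (fun s => τ (ζ₀ + s)) (-δ) δ := by
  have hγ : ContDiffOn ℝ ∞ (fun s : ℝ => τ (ζ₀ + s)) (Ioo (-δ) δ) := by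
    refine h.smooth_symm.comp (ContDiff.contDiffOn ?_) hδ
    exact contDiff_const.add Complex.ofRealCLM.contDiff
  refine ⟨hγ, fun s hs => ?_⟩
  have hζ := hδ s hs
  have hz := h.subset (h.right_inv _ hζ).1
  have hXd := h.differentiableAt hS hX hζ
  have hne := h.ne_zero _ hζ
  obtain ⟨A, -, hA⟩ := exists_equiv_proj hXd (hX.2 _ hz)
  have hvel : proj (fderiv ℝ X (τ (ζ₀ + s)) (deriv (fun s : ℝ => τ (ζ₀ + s)) s))
      = φ (ζ₀ + s) ^ 2 := by
    have d1 : HasDerivAt (fun s : ℝ => τ (ζ₀ + s)) (deriv (fun s : ℝ => τ (ζ₀ + s)) s) s :=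
      ((hγ.differentiableOn (by simp)).differentiableAt (isOpen_Ioo.mem_nhds hs)).hasDerivAt
    have d2 := (hasFDerivAt_proj hXd).comp_hasDerivAt s d1
    have d3 : HasDerivAt (fun s : ℝ => ζ₀ + (s : ℂ)) 1 s := by
      simpa using (Complex.ofRealCLM.hasDerivAt (x := s)).const_add ζ₀
    have d4 := (h.hasDerivAt_proj _ hζ).comp s d3
    have e : (fun s : ℝ => W (ζ₀ + s)) =ᶠ[𝓝 s] fun s => proj (X (τ (ζ₀ + s))) := by
      filter_upwards [isOpen_Ioo.mem_nhds hs] with t ht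
      rw [h.param _ (hδ t ht)]
      simp [proj, surf]
    have := (d2.congr_of_eventuallyEq e).unique d4
    simpa [projCLM_apply] using this
  refine ⟨hz, ?_, ?_, -(Complex.normSq (φ (ζ₀ + s) ^ 2))⁻¹, fun ξ => ?_⟩
  · rintro ⟨κ, hκ⟩
    have := eq_zero_of_re_mul_eq (c := -(φ (ζ₀ + s) ^ 4)⁻¹) (κ := κ) fun v w => by
      have := hκ (A.symm v) (A.symm w)
      rw [h.second _ hζ, firstForm_eq_proj, ← hA, ← hA, A.apply_symm_apply,
        A.apply_symm_apply] at this
      rw [← this]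
      simp [neg_mul]
    simp [hne] at this
  · intro h0
    rw [h0, map_zero] at hvel
    exact pow_ne_zero 2 hne (hvel.symm.trans (by apply Complex.ext <;> simp [proj]))
  · rw [h.second _ hζ, firstForm_eq_proj, hvel]
    generalize proj (fderiv ℝ X (τ (ζ₀ + s)) ξ) = w
    have hv : φ (ζ₀ + s) ^ 2 ≠ 0 := pow_ne_zero 2 hne
    have e : (φ (ζ₀ + s) ^ 4)⁻¹ * φ (ζ₀ + s) ^ 2 = (φ (ζ₀ + s) ^ 2)⁻¹ := by
      field_simp
    rw [e]
    generalize φ (ζ₀ + s) ^ 2 = v at hv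
    rw [Complex.mul_re, Complex.inv_re, Complex.inv_im]
    have := Complex.normSq_pos.2 hv
    field_simp
    ring

/-- Planarity of the coordinate lines forces `φ'' / φ` to be real. -/
theorem im_eq_zero (h : IsCanonicalChart S X N ρ χ τ φ F L W) (hS : IsOpen S)
    (hX : IsSpacelikeImmersion S X) (hpl : HasPlanarCurvatureLines S X) {ζ₀ : ℂ}
    (hζ₀ : ζ₀ ∈ Metric.ball (0 : ℂ) ρ) : (deriv (deriv φ) ζ₀ / φ ζ₀).im = 0 := by
  have hB := Metric.isOpen_ball (x := (0 : ℂ)) (ε := ρ)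
  have hδ0 : 0 < ρ - ‖ζ₀‖ := by
    rw [mem_ball_zero_iff] at hζ₀; linarith
  obtain ⟨δ, hδ⟩ : ∃ δ, δ = ρ - ‖ζ₀‖ := ⟨_, rfl⟩
  rw [← hδ] at hδ0
  have hline : ∀ s ∈ Ioo (-δ) δ, ζ₀ + (s : ℝ) ∈ Metric.ball (0 : ℂ) ρ := by
    intro s hs
    rw [mem_ball_zero_iff]
    have h1 := norm_add_le ζ₀ (s : ℂ)
    have h2 : |s| < δ := abs_lt.2 hs
    rw [Complex.norm_real, Real.norm_eq_abs] at h1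
    linarith
  obtain ⟨c₀, c, d, hc, hP⟩ := (hpl _ _ _ (h.isCurvatureLine hS hX hline)).exists_re
  have r0 : ∀ s ∈ Ioo (-δ) δ, (c₀ * L (ζ₀ + (s : ℝ)) + c * W (ζ₀ + (s : ℝ))).re = d := by
    intro s hs
    rw [← hP _ ⟨s, hs, rfl⟩]
    simp only
    rw [h.param _ (hline s hs)]
    simp [surf, proj]
  obtain ⟨P, hPdef⟩ : ∃ P : ℂ → ℂ, P = fun ζ => c₀ * F ζ + c * φ ζ ^ 2 := ⟨_, rfl⟩
  have dφ : ∀ ζ ∈ Metric.ball (0 : ℂ) ρ, HasDerivAt φ (deriv φ ζ) ζ := fun ζ hζ =>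
    (h.holo.differentiableAt (hB.mem_nhds hζ)).hasDerivAt
  have dφ' : ∀ ζ ∈ Metric.ball (0 : ℂ) ρ, HasDerivAt (deriv φ) (deriv (deriv φ) ζ) ζ := fun ζ hζ =>
    ((h.holo.deriv hB).differentiableAt (hB.mem_nhds hζ)).hasDerivAt
  have hPd : DifferentiableOn ℂ P (Metric.ball 0 ρ) :=
    hPdef ▸ (h.isCanonical.diffF.const_mul _).add (h.isCanonical.diffη.const_mul c)
  have dP : ∀ ζ ∈ Metric.ball (0 : ℂ) ρ, HasDerivAt P (deriv P ζ) ζ := fun ζ hζ =>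
    (hPd.differentiableAt (hB.mem_nhds hζ)).hasDerivAt
  have dP' : ∀ ζ ∈ Metric.ball (0 : ℂ) ρ, HasDerivAt (deriv P) (deriv (deriv P) ζ) ζ := fun ζ hζ =>
    ((hPd.deriv hB).differentiableAt (hB.mem_nhds hζ)).hasDerivAt
  have r1 := re_deriv_eq_zero (G := fun ζ => c₀ * L ζ + c * W ζ) (G' := P) (fun s hs => by
    rw [hPdef]
    exact ((h.hasDerivAt_height _ (hline s hs)).const_mul (c₀ : ℂ)).fun_add
      ((h.hasDerivAt_proj _ (hline s hs)).const_mul c)) r0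
  have r2 := re_deriv_eq_zero (fun s hs => dP _ (hline s hs)) r1
  have r3 := re_deriv_eq_zero (fun s hs => dP' _ (hline s hs)) r2
  have hz : (0 : ℝ) ∈ Ioo (-δ) δ := ⟨by linarith, hδ0⟩
  replace r1 := r1 0 hz
  replace r2 := r2 0 hz
  replace r3 := r3 0 hz
  rw [Complex.ofReal_zero, add_zero] at r1 r2 r3
  have e1 : ∀ ζ ∈ Metric.ball (0 : ℂ) ρ, deriv P ζ * φ ζ = 2 * deriv φ ζ * P ζ - c₀ * φ ζ := by
    intro ζ hζ
    have hw := h.isCanonical.wronskian ζ hζ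
    have d1 : HasDerivAt (fun ζ => φ ζ ^ 2) (2 * φ ζ * deriv φ ζ) ζ := by
      simpa using! (dφ ζ hζ).fun_pow 2
    have d2 : HasDerivAt F (deriv F ζ) ζ :=
      (h.isCanonical.diffF.differentiableAt (hB.mem_nhds hζ)).hasDerivAt
    rw [d1.deriv] at hw
    apply mul_right_cancel₀ (h.ne_zero ζ hζ)
    rw [hPdef, ((d2.const_mul (c₀ : ℂ)).fun_add (d1.const_mul c)).deriv]
    push_cast at hw
    linear_combination c₀ * hw
  have e2 : deriv (deriv P) ζ₀ * φ ζ₀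
      = 2 * deriv (deriv φ) ζ₀ * P ζ₀ + deriv φ ζ₀ * deriv P ζ₀ - c₀ * deriv φ ζ₀ := by
    have d1 := (dP' ζ₀ hζ₀).fun_mul (dφ ζ₀ hζ₀)
    have d2 := (((dφ' ζ₀ hζ₀).const_mul 2).fun_mul (dP ζ₀ hζ₀)).fun_sub
      ((dφ ζ₀ hζ₀).const_mul (c₀ : ℂ))
    have := (d1.congr_of_eventuallyEq (eventually_of_mem (hB.mem_nhds hζ₀)
      fun ζ hζ => (e1 ζ hζ).symm)).unique d2
    linear_combination this
  have hne := h.ne_zero ζ₀ hζ₀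
  set a := (P ζ₀).im with ha
  have hPa : P ζ₀ = Complex.I * a := by
    apply Complex.ext <;> simp [r1, ha]
  set x := deriv φ ζ₀ / φ ζ₀ with hx
  set y := deriv (deriv φ) ζ₀ / φ ζ₀ with hy
  have f1 : deriv P ζ₀ = 2 * x * (Complex.I * a) - c₀ := by
    apply mul_right_cancel₀ hne
    rw [e1 ζ₀ hζ₀, hPa, hx]
    field_simp
  have f2 : deriv (deriv P) ζ₀ = 2 * y * (Complex.I * a) + 2 * x * x * (Complex.I * a)
      - 2 * c₀ * x := by
    apply mul_right_cancel₀ hne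
    rw [e2, f1, hPa, hx, hy]
    field_simp
    ring
  rw [f1] at r2
  rw [f2] at r3
  simp at r2 r3
  -- `Re P' = 0` determines `c₀`; inserted into `Re P'' = 0` it cancels every term with `φ'/φ`,
  -- leaving `a Im(φ''/φ) = 0`.
  have hc₀ : c₀ = -(2 * x.im * a) := by linarith
  have hya : a * y.im = 0 := by
    rw [hc₀] at r3
    linarith
  -- If `a = 0`, then `c₀ = 0` and `P ζ₀ = 0`, hence `c = 0`, contrary to the equation of a plane.
  refine (mul_eq_zero.1 hya).resolve_left fun ha0 => ?_
  have hc00 : c₀ = 0 := by rw [hc₀, ha0]; ring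
  have hP0 : P ζ₀ = 0 := by rw [hPa, ha0]; simp
  rw [hPdef, hc00] at hP0
  simp [hne] at hP0
  exact hc.elim (fun h => h hc00) (fun h => h hP0)

end IsCanonicalChart

/-! ### The equation `φ'' = κ φ` and its solutions. -/

theorem deriv_eq_zero_of_re_eq {U : Set ℂ} (hU : IsOpen U) {G G' : ℂ → ℂ} {d : ℝ}
    (hG : ∀ z ∈ U, HasDerivAt G (G' z) z) (h : ∀ z ∈ U, (G z).re = d) : ∀ z ∈ U, G' z = 0 := by
  intro z hz
  have h1 := Complex.reCLM.hasFDerivAt.comp z ((hG z hz).hasFDerivAt.restrictScalars ℝ)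
  have h2 : HasFDerivAt (fun _ : ℂ => d) (0 : ℂ →L[ℝ] ℝ) z := hasFDerivAt_const d z
  have h3 := h1.unique (h2.congr_of_eventuallyEq (eventually_of_mem (hU.mem_nhds hz) h))
  have h4 := DFunLike.congr_fun h3 1
  have h5 := DFunLike.congr_fun h3 Complex.I
  apply Complex.ext
  · simpa using h4
  · simpa using h5

theorem exists_const_of_im_eq_zero {U : Set ℂ} (hU : IsOpen U) (hc : IsPreconnected U) {G : ℂ → ℂ}
    (hG : DifferentiableOn ℂ G U) (h : ∀ z ∈ U, (G z).im = 0) : ∃ κ : ℝ, ∀ z ∈ U, G z = κ := by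
  have hd : ∀ z ∈ U, HasDerivAt G (deriv G z) z := fun z hz =>
    (hG.differentiableAt (hU.mem_nhds hz)).hasDerivAt
  have h0 : ∀ z ∈ U, Complex.I * deriv G z = 0 :=
    deriv_eq_zero_of_re_eq hU (G := fun z => Complex.I * G z) (d := 0)
      (fun z hz => (hd z hz).const_mul _) (fun z hz => by simp [h z hz])
  obtain ⟨c, hc⟩ := hU.exists_is_const_of_deriv_eq_zero hc hG fun z hz => by
    simpa using h0 z hz
  rcases U.eq_empty_or_nonempty with rfl | ⟨z₀, hz₀⟩
  · exact ⟨0, by simp⟩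
  · refine ⟨c.re, fun z hz => ?_⟩
    have h1 := h z₀ hz₀
    rw [hc z₀ hz₀] at h1
    rw [hc z hz]
    apply Complex.ext <;> simp [h1]

/-- `φ''/φ` is holomorphic and, by `im_eq_zero`, real-valued, hence constant. -/
theorem IsCanonicalChart.exists_deriv2_eq {S N : Set ℂ} {X : ℂ → I3} {ρ : ℝ}
    {χ τ φ F L W : ℂ → ℂ} (h : IsCanonicalChart S X N ρ χ τ φ F L W) (hS : IsOpen S)
    (hX : IsSpacelikeImmersion S X) (hpl : HasPlanarCurvatureLines S X) :
    ∃ κ : ℝ, ∀ ζ ∈ Metric.ball (0 : ℂ) ρ, deriv (deriv φ) ζ = κ * φ ζ := by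
  have hB := Metric.isOpen_ball (x := (0 : ℂ)) (ε := ρ)
  obtain ⟨κ, hκ⟩ := exists_const_of_im_eq_zero hB (convex_ball _ _).isPreconnected
    (((h.holo.deriv hB).deriv hB).div h.holo h.ne_zero) fun ζ hζ => h.im_eq_zero hS hX hpl hζ
  refine ⟨κ, fun ζ hζ => ?_⟩
  rw [← hκ ζ hζ]
  exact (div_mul_cancel₀ _ (h.ne_zero ζ hζ)).symm

theorem exists_const_of_hasDerivAt_zero {U : Set ℂ} (hU : IsOpen U) (hc : IsPreconnected U)
    {G : ℂ → ℂ} (h : ∀ z ∈ U, HasDerivAt G 0 z) : ∃ c : ℂ, ∀ z ∈ U, G z = c :=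
  hU.exists_is_const_of_deriv_eq_zero hc
    (fun z hz => (h z hz).differentiableAt.differentiableWithinAt) fun z hz => (h z hz).deriv

/-- `(φ' + kφ)e^{-kz}` is a first integral for `k = m` and for `k = -m`; the two constants recover
`φ`. -/
theorem exists_exp_of_deriv2 {U : Set ℂ} (hU : IsOpen U) (hc : IsPreconnected U) {φ φ' : ℂ → ℂ}
    {m : ℂ} (hm : m ≠ 0) (h : ∀ z ∈ U, HasDerivAt φ (φ' z) z)
    (h' : ∀ z ∈ U, HasDerivAt φ' (m ^ 2 * φ z) z) :
    ∃ A B : ℂ, ∀ z ∈ U, φ z = A * Complex.exp (m * z) + B * Complex.exp (-m * z) := by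
  have hexp : ∀ k z : ℂ, HasDerivAt (fun z => Complex.exp (k * z)) (k * Complex.exp (k * z)) z :=
    fun k z => by
      refine (((hasDerivAt_id z).const_mul k).cexp).congr_deriv ?_
      simp; ring
  have key : ∀ k : ℂ, k ^ 2 = m ^ 2 →
      ∃ c : ℂ, ∀ z ∈ U, (φ' z + k * φ z) * Complex.exp (-k * z) = c := fun k hk =>
    exists_const_of_hasDerivAt_zero hU hc fun z hz => by
      refine (((h' z hz).fun_add ((h z hz).const_mul k)).fun_mul (hexp (-k) z)).congr_deriv ?_
      linear_combination -φ z * Complex.exp (-k * z) * hk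
  obtain ⟨c₁, h₁⟩ := key m rfl
  obtain ⟨c₂, h₂⟩ := key (-m) (by ring)
  refine ⟨c₁ / (2 * m), -c₂ / (2 * m), fun z hz => ?_⟩
  have e1 := h₁ z hz
  have e2 := h₂ z hz
  rw [neg_neg] at e2
  have e3 : Complex.exp (m * z) * Complex.exp (-m * z) = 1 := by
    rw [← Complex.exp_add]; simp
  have e4 : c₁ / (2 * m) * Complex.exp (m * z) + -c₂ / (2 * m) * Complex.exp (-m * z)
      = φ z * (Complex.exp (m * z) * Complex.exp (-m * z)) := by
    rw [← e1, ← e2]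
    generalize Complex.exp (m * z) = E
    generalize Complex.exp (-m * z) = E'
    field_simp
    ring
  rw [e4, e3, mul_one]

/-- Every solution of `φ'' = κ φ` is, up to a factor and an affine change of the parameter,
the function of a member of the deformation. -/
theorem exists_member {U : Set ℂ} (hU : IsOpen U) (hc : IsPreconnected U) {φ φ' : ℂ → ℂ} {κ : ℝ}
    (h : ∀ z ∈ U, HasDerivAt φ (φ' z) z) (h' : ∀ z ∈ U, HasDerivAt φ' (κ * φ z) z)
    (hne : ∃ z ∈ U, φ z ≠ 0) :
    ∃ t ∈ Icc (0 : ℝ) 3, ∃ a b ν : ℂ, a ≠ 0 ∧ (a ^ 2).im = 0 ∧ ‖ν‖ * ‖a‖ = 1 ∧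
      ∀ z ∈ U, φ z ^ 2 = ν * deformationEta t (a * z + b) := by
  obtain ⟨m, hm⟩ := IsAlgClosed.exists_pow_nat_eq (κ : ℂ) (n := 2) (by norm_num)
  have hreal : ∀ r : ℝ, ((r : ℂ) ^ 2).im = 0 := fun r => by
    rw [← Complex.ofReal_pow, Complex.ofReal_im]
  by_cases hm0 : m = 0
  · have hκ : (κ : ℂ) = 0 := by rw [← hm, hm0]; simp
    obtain ⟨B, hB⟩ := exists_const_of_hasDerivAt_zero hU hc (G := φ') fun z hz => by
      simpa [hκ] using h' z hz
    obtain ⟨A, hA⟩ := exists_const_of_hasDerivAt_zero hU hc (G := fun z => φ z - B * z)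
      fun z hz => by
        refine ((h z hz).fun_sub ((hasDerivAt_id z).const_mul B)).congr_deriv ?_
        rw [hB z hz]; simp
    have hφ : ∀ z ∈ U, φ z = B * z + A := fun z hz => by rw [← hA z hz]; ring
    by_cases hB0 : B = 0
    · have hA0 : A ≠ 0 := by
        rintro rfl
        obtain ⟨z, hz, hz0⟩ := hne
        exact hz0 (by rw [hφ z hz, hB0]; simp)
      have hA' : 0 < ‖A‖ := norm_pos_iff.2 hA0
      -- In each case `a` and `ν` are fixed by two requirements: `φ² = ν η_t(az + b)` and `|ν||a| =
      -- 1`, the latter equating the scalings of height and projection.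
      refine ⟨3, by norm_num, ((‖A‖ ^ 2)⁻¹ : ℝ), 0, -A ^ 2, ?_, hreal _, ?_, fun z hz => ?_⟩
      · exact_mod_cast (inv_pos.2 (pow_pos hA' 2)).ne'
      · rw [norm_neg, norm_pow, Complex.norm_real, Real.norm_of_nonneg (by positivity)]
        field_simp
      · rw [hφ z hz, hB0, deformationEta_three]; ring
    · have hB' : 0 < ‖B‖ := norm_pos_iff.2 hB0
      have hBc : (‖B‖ : ℂ) ≠ 0 := by exact_mod_cast hB'.ne'
      refine ⟨1, by norm_num, (‖B‖ ^ 2 : ℝ), 1 / 2 + (‖B‖ ^ 2 : ℝ) * A / B,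
        B ^ 2 / ((‖B‖ ^ 2 : ℝ) : ℂ) ^ 2, ?_, hreal _, ?_, fun z hz => ?_⟩
      · exact_mod_cast (pow_pos hB' 2).ne'
      · rw [norm_div, norm_pow, norm_pow, Complex.norm_real, Real.norm_of_nonneg (by positivity)]
        field_simp
      · rw [hφ z hz, deformationEta_one]
        push_cast
        field_simp
        ring
  · obtain ⟨A, B, hAB⟩ := exists_exp_of_deriv2 hU hc hm0 h fun z hz => by
      rw [hm]; exact h' z hz
    have single : ∀ k A : ℂ, k ≠ 0 → k ^ 2 = κ → (∀ z ∈ U, φ z = A * Complex.exp (k * z)) →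
        ∃ t ∈ Icc (0 : ℝ) 3, ∃ a b ν : ℂ, a ≠ 0 ∧ (a ^ 2).im = 0 ∧ ‖ν‖ * ‖a‖ = 1 ∧
          ∀ z ∈ U, φ z ^ 2 = ν * deformationEta t (a * z + b) := by
      intro k A hk hkκ hφ
      have hA0 : A ≠ 0 := by
        rintro rfl
        obtain ⟨z, hz, hz0⟩ := hne
        exact hz0 (by rw [hφ z hz]; simp)
      have hA' : 0 < ‖A‖ := norm_pos_iff.2 hA0
      have hk' : 0 < ‖k‖ := norm_pos_iff.2 hk
      -- A real translation of the catenoid's parameter multiplies `η` by a positive factor; `x` is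
      -- the factor that gives `|ν||a| = 1`.
      set x : ℝ := 2 * ‖k‖ * ‖A‖ ^ 2 with hx
      have hx0 : 0 < x := by positivity
      have hxc : (x : ℂ) ≠ 0 := by exact_mod_cast hx0.ne'
      refine ⟨0, by norm_num, -k, (-(Real.log x / 2) : ℝ), -(2 * A ^ 2 / x), neg_ne_zero.2 hk, ?_,
        ?_, fun z hz => ?_⟩
      · rw [neg_sq, hkκ, Complex.ofReal_im]
      · rw [norm_neg, norm_neg, norm_div, norm_mul, norm_pow, Complex.norm_real,
          Real.norm_of_nonneg hx0.le, hx]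
        simp
        field_simp
      · have e : Complex.exp (-(-k * z + (-(Real.log x / 2) : ℝ))) ^ 2
            = Complex.exp (k * z) ^ 2 * x := by
          have : (x : ℂ) = Complex.exp (Real.log x) := by
            rw [← Complex.ofReal_exp, Real.exp_log hx0]
          conv_rhs => rw [this]
          rw [← Complex.exp_nat_mul, ← Complex.exp_nat_mul, ← Complex.exp_add]
          push_cast
          ring_nf
        rw [hφ z hz, deformationEta_of_lt (by norm_num), stageOneEta_eq (by simp) (by norm_num)]
        simp only [mul_zero, zero_div, Real.cos_zero, Real.sin_zero, Complex.ofReal_zero,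
          Complex.ofReal_one, zero_mul, sub_zero, one_mul, neg_zero, Complex.exp_zero, mul_pow]
        rw [e]
        field_simp
        norm_num
    by_cases hB0 : B = 0
    · exact single m A hm0 hm fun z hz => by rw [hAB z hz, hB0]; ring
    by_cases hA0 : A = 0
    · exact single (-m) B (neg_ne_zero.2 hm0) (by rw [neg_sq, hm]) fun z hz => by
        rw [hAB z hz, hA0]; ring
    have hA' : 0 < ‖A‖ := norm_pos_iff.2 hA0
    have hB' : 0 < ‖B‖ := norm_pos_iff.2 hB0
    have hm' : 0 < ‖m‖ := norm_pos_iff.2 hm0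
    -- With `a = m/cos θ`, the condition `|ν||a| = 1` becomes `tan θ = 4|A||B||m|`, which selects
    -- the member.
    set y : ℝ := 4 * ‖A‖ * ‖B‖ * ‖m‖ with hy
    have hy0 : 0 < y := by positivity
    set θ := Real.arctan y with hθ
    have h1 : 0 < θ := Real.arctan_pos.2 hy0
    have h2 : θ < Real.pi / 2 := Real.arctan_lt_pi_div_two _
    have hpi := Real.pi_pos
    have ht : 2 * θ / Real.pi ∈ Ioo (0 : ℝ) 1 := by
      constructor
      · positivity
      · rw [div_lt_one hpi]; linarith
    have e : Real.pi * (2 * θ / Real.pi) / 2 = θ := by field_simp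
    have hcos : 0 < Real.cos θ := Real.cos_arctan_pos _
    have hs : Real.sin θ = y * Real.cos θ := by
      rw [← Real.tan_arctan y, ← hθ, Real.tan_eq_sin_div_cos]; field_simp
    have hs0 : 0 < Real.sin θ := by rw [hs]; positivity
    have hcc : (Real.cos θ : ℂ) ≠ 0 := by exact_mod_cast hcos.ne'
    have hsc : (Real.sin θ : ℂ) ≠ 0 := by exact_mod_cast hs0.ne'
    set l : ℝ := Real.log ((Real.cos θ + 1) / Real.sin θ) / 2 with hl
    -- Chosen with `e^{2b₀} = -B/A`, so that `A e^{mz} + B e^{-mz} = 2A e^{b₀} sinh(mz - b₀)`.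
    set b₀ : ℂ := Complex.log (-B / A) / 2 with hb₀
    have hb : Complex.exp b₀ ^ 2 = -B / A := by
      rw [← Complex.exp_nat_mul, hb₀, show ((2 : ℕ) : ℂ) * (Complex.log (-B / A) / 2)
        = Complex.log (-B / A) by push_cast; ring,
        Complex.exp_log (div_ne_zero (neg_ne_zero.2 hB0) hA0)]
    refine ⟨2 * θ / Real.pi, ⟨ht.1.le, by linarith [ht.2]⟩, m / Real.cos θ,
      (l - b₀) / Real.cos θ,
      4 * A * B * Real.cos θ ^ 2 / (Complex.exp (-(2 * Complex.I * θ)) * Real.sin θ),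
      div_ne_zero hm0 hcc, ?_, ?_, fun z hz => ?_⟩
    · rw [div_pow, hm, ← Complex.ofReal_pow, ← Complex.ofReal_div, Complex.ofReal_im]
    · have he : ‖Complex.exp (-(2 * Complex.I * θ))‖ = 1 := by
        rw [show -(2 * Complex.I * (θ : ℂ)) = ((-2 * θ : ℝ) : ℂ) * Complex.I by push_cast; ring]
        exact Complex.norm_exp_ofReal_mul_I _
      rw [norm_div, norm_div, norm_mul, norm_mul, norm_mul, norm_mul, he, norm_pow,
        Complex.norm_real, Complex.norm_real, Real.norm_of_nonneg hcos.le,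
        Real.norm_of_nonneg hs0.le, hs, hy]
      simp
      field_simp
    · rw [deformationEta_of_lt ht.2, e, stageOneEta_eq_sinh hcos hs0]
      have e2 : Real.cos θ * (m / Real.cos θ * z + (l - b₀) / Real.cos θ) - l = m * z - b₀ := by
        field_simp
        ring
      rw [e2, hAB z hz, Complex.sinh, neg_sub, Complex.exp_sub, Complex.exp_sub]
      have e3 : Complex.exp (m * z) * Complex.exp (-m * z) = 1 := by
        rw [← Complex.exp_add]; simp
      have e4 : Complex.exp (-m * z) = (Complex.exp (m * z))⁻¹ := by
        rw [← Complex.exp_neg, neg_mul]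
      rw [e4]
      have g1 := Complex.exp_ne_zero (m * z)
      have g2 := Complex.exp_ne_zero b₀
      have g3 := Complex.exp_ne_zero (-(2 * Complex.I * θ))
      have hB1 : B = -A * Complex.exp b₀ ^ 2 := by rw [hb]; field_simp
      generalize Complex.exp (m * z) = E at *
      generalize Complex.exp b₀ = x at *
      generalize Complex.exp (-(2 * Complex.I * θ)) = T at *
      generalize (Real.cos θ : ℂ) = c at *
      generalize (Real.sin θ : ℂ) = s at *
      rw [hB1]
      field_simp
      ring

/-! ### Absence of umbilics. -/

/-- Suppose `q` has a zero of finite order `m ≥ 1`. Then `7q'² - 4qq''` vanishes only to order `2m -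
2`, so its quotient into `q³` is holomorphic with a zero at `w₁`. But this quotient is real-valued,
hence constant, hence `0`, while the hypothesis makes it nonzero off `w₁`. The number `κ` may vary
with the point. -/
theorem eventually_eq_zero_of_real_eq {q : ℂ → ℂ} {w₁ : ℂ} (hq : AnalyticAt ℂ q w₁)
    (h0 : q w₁ = 0) (h : ∀ᶠ w in 𝓝 w₁, q w ≠ 0 → ∃ κ : ℝ,
      16 * κ * q w ^ 3 = 7 * deriv q w ^ 2 - 4 * q w * deriv (deriv q) w) :
    ∀ᶠ w in 𝓝 w₁, q w = 0 := by
  by_contra hne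
  obtain ⟨m, g, hg, hg0, hm⟩ := hq.exists_eventuallyEq_pow_smul_nonzero_iff.2 hne
  simp only [smul_eq_mul] at hm
  have hm0 : m ≠ 0 := by
    rintro rfl
    have := hm.self_of_nhds
    rw [h0, pow_zero, one_mul] at this
    exact hg0 this.symm
  -- the Euler operator applied to `u ^ m * k`, where `u = w - w₁`
  have euler : ∀ {f k : ℂ → ℂ}, AnalyticAt ℂ k w₁ → (∀ᶠ w in 𝓝 w₁, f w = (w - w₁) ^ m * k w) →
      ∀ᶠ w in 𝓝 w₁, (w - w₁) * deriv f w
        = (w - w₁) ^ m * (m * k w + (w - w₁) * deriv k w) := by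
    intro f k hk hf
    filter_upwards [hf.eventually_nhds, hk.eventually_analyticAt] with w hw hkw
    have d1 : HasDerivAt (fun w => (w - w₁) ^ m * k w)
        (m * (w - w₁) ^ (m - 1) * k w + (w - w₁) ^ m * deriv k w) w := by
      simpa using! (((hasDerivAt_id w).sub_const w₁).fun_pow m).fun_mul
        hkw.differentiableAt.hasDerivAt
    rw [Filter.EventuallyEq.deriv_eq hw, d1.deriv]
    obtain ⟨n, rfl⟩ := Nat.exists_eq_succ_of_ne_zero hm0
    simp only [Nat.succ_eq_add_one, Nat.add_sub_cancel]
    ring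
  set g₁ : ℂ → ℂ := fun w => m * g w + (w - w₁) * deriv g w with hg₁
  have hu : AnalyticAt ℂ (fun w : ℂ => w - w₁) w₁ := analyticAt_id.sub analyticAt_const
  have hg₁a : AnalyticAt ℂ g₁ w₁ := (analyticAt_const.mul hg).add (hu.mul hg.deriv)
  have e1 := euler hg hm
  have e2 := euler hg₁a e1
  -- With `u = w - w₁` and `q = u^m g`, one has `u²(7q'² - 4qq'') = u^{2m} D`; multiplying
  -- derivatives by powers of `u` avoids negative exponents.
  set D : ℂ → ℂ := fun w => 7 * g₁ w ^ 2
    - 4 * g w * (m * g₁ w + (w - w₁) * deriv g₁ w - g₁ w) with hD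
  have hDa : AnalyticAt ℂ D w₁ := (analyticAt_const.mul (hg₁a.pow 2)).sub
    ((analyticAt_const.mul hg).mul
      (((analyticAt_const.mul hg₁a).add (hu.mul hg₁a.deriv)).sub hg₁a))
  have hD0 : D w₁ ≠ 0 := by
    -- The leading coefficient is `7m² - 4m(m - 1) = 3m² + 4m`, positive for `m ≥ 1`.
    have : D w₁ = ((3 * m ^ 2 + 4 * m : ℕ) : ℂ) * g w₁ ^ 2 := by
      simp only [hD, hg₁, sub_self, zero_mul, add_zero]
      push_cast
      ring
    rw [this]
    refine mul_ne_zero (Nat.cast_ne_zero.2 ?_) (pow_ne_zero _ hg0)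
    have := Nat.pos_of_ne_zero hm0
    positivity
  have hT : ∀ᶠ w in 𝓝 w₁, w ≠ w₁ → ∃ κ : ℝ,
      κ * ((w - w₁) ^ (m + 2) * g w ^ 3 / D w) = 1 := by
    filter_upwards [h, hm, e1, e2, hDa.continuousAt.eventually_ne hD0,
      hg.continuousAt.eventually_ne hg0, hq.deriv.eventually_analyticAt]
      with w hw hmw h1 h2 hDw hgw hqa hne
    have hu0 : w - w₁ ≠ 0 := sub_ne_zero.2 hne
    obtain ⟨κ, hκ⟩ := hw (by rw [hmw]; exact mul_ne_zero (pow_ne_zero _ hu0) hgw)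
    have h3 : HasDerivAt (fun w => (w - w₁) * deriv q w)
        (deriv q w + (w - w₁) * deriv (deriv q) w) w := by
      simpa using! ((hasDerivAt_id w).sub_const w₁).fun_mul hqa.differentiableAt.hasDerivAt
    rw [h3.deriv] at h2
    refine ⟨16 * κ, ?_⟩
    rw [mul_div_assoc', div_eq_one_iff_eq hDw]
    refine mul_left_cancel₀ (pow_ne_zero (2 * m) hu0) ?_
    push_cast
    rw [hD]
    have h4 : (w - w₁) ^ 2 * deriv (deriv q) w
        = (w - w₁) ^ m * (m * g₁ w + (w - w₁) * deriv g₁ w - g₁ w) := by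
      linear_combination h2 - h1
    have h5 : (w - w₁) ^ 2 * (16 * κ * q w ^ 3)
        = 7 * ((w - w₁) * deriv q w) ^ 2
          - 4 * q w * ((w - w₁) ^ 2 * deriv (deriv q) w) := by
      linear_combination (w - w₁) ^ 2 * hκ
    rw [h4, h1, hmw] at h5
    linear_combination h5
  obtain ⟨ε, hε, hball⟩ := Metric.eventually_nhds_iff_ball.1
    (hT.and ((hg.eventually_analyticAt.and hDa.eventually_analyticAt).and
      (hDa.continuousAt.eventually_ne hD0)))
  have hreal : ∀ w ∈ Metric.ball w₁ ε, ((w - w₁) ^ (m + 2) * g w ^ 3 / D w).im = 0 := by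
    intro w hw
    by_cases hww : w = w₁
    · simp [hww]
    · obtain ⟨κ, hκ⟩ := (hball w hw).1 hww
      rw [eq_inv_of_mul_eq_one_right hκ, ← Complex.ofReal_inv, Complex.ofReal_im]
  obtain ⟨c, hc⟩ := exists_const_of_im_eq_zero Metric.isOpen_ball
    (convex_ball w₁ ε).isPreconnected (fun w hw => by
      have := (hball w hw).2
      exact (((differentiableAt_id.sub_const w₁).pow (m + 2)).mul
        (this.1.1.differentiableAt.pow 3)).div this.1.2.differentiableAt this.2
        |>.differentiableWithinAt) hreal
  have hc0 := hc w₁ (Metric.mem_ball_self hε)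
  have hw : w₁ + ((ε / 2 : ℝ) : ℂ) ∈ Metric.ball w₁ ε := by
    rw [Metric.mem_ball, dist_self_add_left, Complex.norm_real, Real.norm_of_nonneg (half_pos hε).le]
    exact half_lt_self hε
  obtain ⟨κ, hκ⟩ := (hball _ hw).1 (by simp [hε.ne'])
  rw [hc _ hw, ← hc0] at hκ
  simp at hκ

/-- Two real parts of holomorphic functions that agree near a point agree everywhere. -/
theorem re_eq_of_eventually_re_eq {U : Set ℂ} (hU : IsOpen U) (hc : IsPreconnected U)
    {G : ℂ → ℂ} (hG : DifferentiableOn ℂ G U) {z₁ : ℂ} (hz₁ : z₁ ∈ U) {d : ℝ}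
    (h : ∀ᶠ z in 𝓝 z₁, (G z).re = d) : ∀ z ∈ U, (G z).re = d := by
  obtain ⟨V, hV, hVo, hzV⟩ := eventually_nhds_iff.1 h
  have h1 : deriv G =ᶠ[𝓝 z₁] 0 := by
    filter_upwards [(hVo.inter hU).mem_nhds ⟨hzV, hz₁⟩] with z hz
    exact deriv_eq_zero_of_re_eq (hVo.inter hU) (G' := deriv G)
      (fun z hz => (hG.differentiableAt (hU.mem_nhds hz.2)).hasDerivAt) (fun z hz => hV z hz.1) z hz
  have h2 := ((hG.deriv hU).analyticOnNhd hU).eqOn_zero_of_preconnected_of_eventuallyEq_zero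
    hc hz₁ h1
  obtain ⟨c, hc⟩ := hU.exists_is_const_of_deriv_eq_zero hc hG h2
  intro z hz
  rw [hc z hz, ← hc z₁ hz₁]
  exact h.self_of_nhds

/-- Continuation principle: if `P` holds everywhere or nowhere on a neighbourhood of each point, the
set where it holds and its complement are both relatively open. -/
theorem forall_of_exists_of_isPreconnected {S : Set ℂ} (hS : IsPreconnected S) {P : ℂ → Prop}
    (h : ∀ p ∈ S, ∃ N : Set ℂ, IsOpen N ∧ p ∈ N ∧ ((∃ z ∈ N, P z) → ∀ z ∈ N, P z))
    (he : ∃ z ∈ S, P z) : ∀ z ∈ S, P z := by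
  obtain ⟨z₀, hz₀, hP₀⟩ := he
  by_contra! hne
  obtain ⟨z₁, hz₁, hP₁⟩ := hne
  have key : ∀ p ∈ S, p ∈ interior {z | P z} ∨ p ∈ interior {z | ¬ P z} := fun p hp => by
    obtain ⟨N, hN, hpN, hPN⟩ := h p hp
    by_cases hx : ∃ z ∈ N, P z
    · exact Or.inl (mem_interior.2 ⟨N, hPN hx, hN, hpN⟩)
    · exact Or.inr (mem_interior.2 ⟨N, fun z hz hPz => hx ⟨z, hz, hPz⟩, hN, hpN⟩)
  obtain ⟨z, -, hz, hz'⟩ := hS _ _ isOpen_interior isOpen_interior key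
    ⟨z₀, hz₀, (key z₀ hz₀).resolve_right fun h => interior_subset h hP₀⟩
    ⟨z₁, hz₁, (key z₁ hz₁).resolve_left fun h => hP₁ (interior_subset h)⟩
  exact interior_subset hz' (interior_subset hz)

namespace IsGraphChart

variable {S V : Set ℂ} {X : ℂ → I3} {w₀ : ℂ} {r : ℝ} {σ H : ℂ → ℂ}

/-- The differential equation that planar curvature lines impose on the function `H''`. -/
theorem exists_real_eq (h : IsGraphChart S X V w₀ r σ H) (hS : IsOpen S)
    (hX : IsSpacelikeImmersion S X) (hpl : HasPlanarCurvatureLines S X) {q : ℂ → ℂ}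
    (hq : q = fun w => -deriv (deriv H) w) {w : ℂ}
    (hw : w ∈ Metric.ball w₀ r) (hqw : q w ≠ 0) :
    ∃ κ : ℝ, 16 * κ * q w ^ 3 = 7 * deriv q w ^ 2 - 4 * q w * deriv (deriv q) w := by
  obtain ⟨hp, hpw⟩ := h.right_inv w hw
  obtain ⟨N, ρ, χ, τ, φ, F, L, W, hpN, -, hc, hW, hφ⟩ := h.exists_canonicalChart hS hX hp
    (by rw [hpw]; exact fun h0 => hqw (by simp [hq, h0]))
  obtain ⟨κ, hκ⟩ := hc.exists_deriv2_eq hS hX hpl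
  have hB := Metric.isOpen_ball (x := (0 : ℂ)) (ε := ρ)
  have hB' := Metric.isOpen_ball (x := w₀) (ε := r)
  have hqd : DifferentiableOn ℂ q (Metric.ball w₀ r) := by
    rw [hq]; exact ((h.holo.deriv hB').deriv hB').neg
  have hφd : ∀ ζ ∈ Metric.ball 0 ρ, HasDerivAt φ (deriv φ ζ) ζ := fun ζ hζ =>
    (hc.holo.differentiableAt (hB.mem_nhds hζ)).hasDerivAt
  have hφd' : ∀ ζ ∈ Metric.ball 0 ρ, HasDerivAt (deriv φ) (κ * φ ζ) ζ := fun ζ hζ => by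
    rw [← hκ ζ hζ]
    exact ((hc.holo.deriv hB).differentiableAt (hB.mem_nhds hζ)).hasDerivAt
  have hcomp : ∀ {f : ℂ → ℂ}, DifferentiableOn ℂ f (Metric.ball w₀ r) → ∀ ζ ∈ Metric.ball 0 ρ,
      HasDerivAt (fun ζ => f (W ζ)) (deriv f (W ζ) * φ ζ ^ 2) ζ := fun hf ζ hζ =>
    (hf.differentiableAt (hB'.mem_nhds (hφ ζ hζ).1)).hasDerivAt.comp ζ (hc.hasDerivAt_proj ζ hζ)
  have hzero : ∀ {f : ℂ → ℂ} {f' c ζ : ℂ}, ζ ∈ Metric.ball 0 ρ →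
      (∀ ζ ∈ Metric.ball 0 ρ, f ζ = c) → HasDerivAt f f' ζ → f' = 0 := fun hζ hf hd =>
    hd.unique ((hasDerivAt_const _ _).congr_of_eventuallyEq
      (eventually_of_mem (hB.mem_nhds hζ) hf))
  -- The equation for `q` results from differentiating `φ⁴ q(W) = 1` twice, with `W' = φ²` and `φ''
  -- = κφ`, and eliminating `φ` and `φ'`.
  have e0 : ∀ ζ ∈ Metric.ball 0 ρ, φ ζ ^ 4 * q (W ζ) = 1 := fun ζ hζ => by
    rw [hq]; exact (hφ ζ hζ).2
  have e1 : ∀ ζ ∈ Metric.ball 0 ρ,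
      4 * deriv φ ζ * q (W ζ) + φ ζ ^ 3 * deriv q (W ζ) = 0 := fun ζ hζ => by
    have := hzero hζ e0 (((hφd ζ hζ).fun_pow 4).fun_mul (hcomp hqd ζ hζ))
    refine mul_left_cancel₀ (pow_ne_zero 3 (hc.ne_zero ζ hζ)) ?_
    norm_num at this
    linear_combination this
  have hζ := (hc.left_inv _ hpN).1
  have hWζ : W (χ (σ w)) = w := by rw [hW _ hpN, hpw]
  generalize χ (σ w) = ζ at hζ hWζ
  have e2 := hzero hζ e1 ((((hφd' ζ hζ).const_mul 4).fun_mul (hcomp hqd ζ hζ)).fun_add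
    (((hφd ζ hζ).fun_pow 3).fun_mul (hcomp (hqd.deriv hB') ζ hζ)))
  have e1ζ := e1 ζ hζ
  have e0ζ := e0 ζ hζ
  have hne := hc.ne_zero ζ hζ
  norm_num at e2
  rw [hWζ] at e0ζ e1ζ e2
  refine ⟨κ, mul_left_cancel₀ hne ?_⟩
  generalize q w = a at *
  generalize deriv q w = b at *
  generalize deriv (deriv q) w = c at *
  generalize deriv φ ζ = ψ at *
  generalize φ ζ = f at *
  linear_combination 4 * a ^ 2 * e2 - 7 * f ^ 2 * b * a * e1ζ
    + (7 * f * b ^ 2 - 4 * f * a * c) * e0ζ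

/-- A zero of `H''` is not isolated by `eventually_eq_zero_of_real_eq`, and the identity theorem
spreads it over the disc. -/
theorem deriv2_eq_zero (h : IsGraphChart S X V w₀ r σ H) (hS : IsOpen S)
    (hX : IsSpacelikeImmersion S X) (hpl : HasPlanarCurvatureLines S X) {w₁ : ℂ}
    (hw₁ : w₁ ∈ Metric.ball w₀ r) (h0 : deriv (deriv H) w₁ = 0) :
    ∀ w ∈ Metric.ball w₀ r, deriv (deriv H) w = 0 := by
  have hB := Metric.isOpen_ball (x := w₀) (ε := r)
  have ha : AnalyticOnNhd ℂ (deriv (deriv H)) (Metric.ball w₀ r) :=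
    ((h.holo.deriv hB).deriv hB).analyticOnNhd hB
  have h1 := eventually_eq_zero_of_real_eq (ha w₁ hw₁).neg (by simpa using h0)
    (eventually_of_mem (hB.mem_nhds hw₁) fun w hw hne =>
      h.exists_real_eq hS hX hpl rfl hw hne)
  exact ha.eqOn_zero_of_preconnected_of_eventuallyEq_zero (convex_ball _ _).isPreconnected hw₁
    (h1.mono fun w hw => by simpa using hw)

/-- A chart that contains an umbilic is planar. -/
theorem exists_plane_of_isUmbilic (h : IsGraphChart S X V w₀ r σ H) (hS : IsOpen S)
    (hX : IsSpacelikeImmersion S X) (hpl : HasPlanarCurvatureLines S X) {z : ℂ} (hz : z ∈ V)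
    (hu : IsUmbilic X z) : ∃ (c : ℂ) (d : ℝ), ∀ z ∈ V, X z 0 = (c * proj (X z)).re + d := by
  have hB := Metric.isOpen_ball (x := w₀) (ε := r)
  have h2 := h.deriv2_eq_zero hS hX hpl (h.left_inv z hz).1 ((h.isUmbilic_iff hS hX hz).1 hu)
  have hH : ∀ w ∈ Metric.ball w₀ r, HasDerivAt H (deriv H w) w := fun w hw =>
    (h.holo.differentiableAt (hB.mem_nhds hw)).hasDerivAt
  obtain ⟨c, hc⟩ := hB.exists_is_const_of_deriv_eq_zero (convex_ball _ _).isPreconnected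
    (h.holo.deriv hB) h2
  obtain ⟨d, hd⟩ := exists_const_of_hasDerivAt_zero hB (convex_ball _ _).isPreconnected
    (G := fun w => H w - c * w) fun w hw => by
      refine ((hH w hw).fun_sub ((hasDerivAt_id w).const_mul c)).congr_deriv ?_
      rw [hc w hw]
      simp
  refine ⟨c, d.re, fun z hz => ?_⟩
  rw [h.height z hz, ← hd _ (h.left_inv z hz).1, Complex.sub_re]
  ring

/-- A chart lies in a plane as soon as a part of it does. -/
theorem forall_mem_plane (h : IsGraphChart S X V w₀ r σ H) {c : ℂ} {d : ℝ} {z₁ : ℂ}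
    (hz₁ : z₁ ∈ V) (hz : ∀ᶠ z in 𝓝 z₁, X z 0 = (c * proj (X z)).re + d) :
    ∀ z ∈ V, X z 0 = (c * proj (X z)).re + d := by
  have hB := Metric.isOpen_ball (x := w₀) (ε := r)
  obtain ⟨hw₁, hσ⟩ := h.left_inv z₁ hz₁
  have hcont : Tendsto σ (𝓝 (proj (X z₁))) (𝓝 z₁) := by
    have := (h.smooth.continuousOn.continuousAt (hB.mem_nhds hw₁)).tendsto
    rwa [hσ] at this
  have h1 : ∀ᶠ w in 𝓝 (proj (X z₁)), (H w - c * w).re = d := by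
    filter_upwards [hcont.eventually hz, hB.mem_nhds hw₁] with w hw hwB
    obtain ⟨hV, hpw⟩ := h.right_inv w hwB
    rw [h.height _ hV, hpw] at hw
    rw [Complex.sub_re, hw]
    ring
  have h2 := re_eq_of_eventually_re_eq hB (convex_ball _ _).isPreconnected
    (h.holo.sub (differentiableOn_id.const_mul c)) hw₁ h1
  intro z hz
  have h3 := h2 _ (h.left_inv z hz).1
  rw [h.height z hz]
  simp only [Pi.sub_apply, Complex.sub_re] at h3
  linarith

end IsGraphChart

/-- An umbilic makes its chart planar; a plane containing part of a chart contains all of it, so by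
connectedness the whole surface would lie in that plane. -/
theorem IsZMCWithPlanarLines.not_isUmbilic {S : Set ℂ} {X : ℂ → I3}
    (h : IsZMCWithPlanarLines S X) {z : ℂ} (hz : z ∈ S) : ¬ IsUmbilic X z := by
  intro hu
  obtain ⟨V, r, σ, H, hzV, hV⟩ := exists_graph_chart h.isOpen h.spacelike h.zeroMeanCurvature hz
  obtain ⟨c, d, hcd⟩ := hV.exists_plane_of_isUmbilic h.isOpen h.spacelike h.planarLines hzV hu
  have hall := forall_of_exists_of_isPreconnected h.isConnected.isPreconnected
    (P := fun z => ∀ᶠ z' in 𝓝 z, X z' 0 = (c * proj (X z')).re + d) (fun p hp => by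
      obtain ⟨V, r, σ, H, hpV, hV⟩ :=
        exists_graph_chart h.isOpen h.spacelike h.zeroMeanCurvature hp
      refine ⟨V, hV.isOpen, hpV, fun ⟨z₁, hz₁, hP⟩ z hz => ?_⟩
      exact eventually_of_mem (hV.isOpen.mem_nhds hz) (hV.forall_mem_plane hz₁ hP))
    ⟨z, hz, eventually_of_mem (hV.isOpen.mem_nhds hzV) hcd⟩
  refine h.notPlanar ⟨![1, -c.re, c.im], fun h0 => by simpa using congrFun h0 0, d, ?_⟩
  rintro _ ⟨z, hz, rfl⟩
  have := (hall z hz).self_of_nhds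
  rw [Complex.mul_re] at this
  simp only [proj] at this
  simp only [Fin.sum_univ_three, Matrix.cons_val_zero, Matrix.cons_val_one, Matrix.cons_val]
  linarith

/-! ### One member and one similarity for the whole surface. -/

/-- Near `p`, the surface `X` on `S` is a reparametrization of a part of `Φ ∘ Y` on `T`. -/
def IsPieceAt (S : Set ℂ) (X : ℂ → I3) (T : Set ℂ) (Y : ℂ → I3) (Φ : I3 → I3) (p : ℂ) : Prop :=
  ∃ U : Set ℂ, IsOpen U ∧ p ∈ U ∧ U ⊆ S ∧
    ∃ ψ : ℂ → ℂ, ContDiffOn ℝ ∞ ψ U ∧ (∀ z ∈ U, Function.Injective (fderiv ℝ ψ z)) ∧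
      MapsTo ψ U T ∧ ∀ z ∈ U, X z = Φ (Y (ψ z))

/-- A real differentiable map that a holomorphic map with nonvanishing derivative turns into a
holomorphic map is holomorphic. -/
theorem hasDerivAt_of_comp {θ g f : ℂ → ℂ} {ζ g' f' : ℂ} (hθ : DifferentiableAt ℝ θ ζ)
    (hg : HasDerivAt g g' (θ ζ)) (hg' : g' ≠ 0) (hf : HasDerivAt f f' ζ)
    (h : f =ᶠ[𝓝 ζ] fun ζ => g (θ ζ)) : HasDerivAt θ (f' / g') ζ := by
  have h1 := (hg.hasFDerivAt.restrictScalars ℝ).comp ζ hθ.hasFDerivAt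
  have h2 := (h1.congr_of_eventuallyEq h).unique (hf.hasFDerivAt.restrictScalars ℝ)
  refine hasFDerivAt_of_restrictScalars ℝ hθ.hasFDerivAt ?_
  ext ξ
  have h3 := DFunLike.congr_fun h2 ξ
  simp at h3 ⊢
  rw [mul_div_assoc', ← h3, mul_div_cancel_right₀ _ hg']

/-- A change of parameters between a canonical chart and a surface with the same constant Hopf
differential is affine. -/
theorem exists_affine_of_comp {U : Set ℂ} (hU : IsOpen U) (hc : IsPreconnected U)
    (hne : U.Nonempty) {ε : ℝ} (hε : ε ≠ 0) {F η L W F₁ η₁ L₁ W₁ θ : ℂ → ℂ} {k d : ℝ} {c μ e : ℂ}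
    (hk : k ≠ 0) (hμ : μ ≠ 0)
    (h : IsCanonical U ε F η) (h₁ : IsCanonical univ ε F₁ η₁)
    (hL : ∀ z ∈ U, HasDerivAt L (F z) z) (hW : ∀ z ∈ U, HasDerivAt W (η z) z)
    (hL₁ : ∀ z, HasDerivAt L₁ (F₁ z) z) (hW₁ : ∀ z, HasDerivAt W₁ (η₁ z) z)
    (hθ : DifferentiableOn ℝ θ U) (hη : ∀ z ∈ U, η z ≠ 0) (hη₁ : ∀ z ∈ U, η₁ (θ z) ≠ 0)
    (hWθ : ∀ z ∈ U, W z = μ * W₁ (θ z) + e)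
    (hLθ : ∀ z ∈ U, (L z - k * L₁ (θ z) - c * W₁ (θ z)).re = d) :
    ∃ a b : ℂ, a ≠ 0 ∧ ∀ z ∈ U, θ z = a * z + b := by
  have hkc : (k : ℂ) ≠ 0 := by exact_mod_cast hk
  have hεc : (ε : ℂ) ≠ 0 := by exact_mod_cast hε
  -- `θ` is only known to be real differentiable; the relation between the projections makes it
  -- holomorphic.
  have hθ' : ∀ z ∈ U, HasDerivAt θ (η z / (μ * η₁ (θ z))) z := fun z hz =>
    hasDerivAt_of_comp (hθ.differentiableAt (hU.mem_nhds hz))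
      (((hW₁ (θ z)).const_mul μ).add_const e) (mul_ne_zero hμ (hη₁ z hz)) (hW z hz)
      (eventually_of_mem (hU.mem_nhds hz) hWθ)
  have hm : ∀ z ∈ U, η z = μ * deriv θ z * η₁ (θ z) := fun z hz => by
    have := hη₁ z hz
    rw [(hθ' z hz).deriv]
    field_simp
  have hθd : ∀ z ∈ U, HasDerivAt θ (deriv θ z) z := fun z hz =>
    (hθ' z hz).differentiableAt.hasDerivAt
  have hF := deriv_eq_zero_of_re_eq hU (G := fun z => L z - k * L₁ (θ z) - c * W₁ (θ z))
    (fun z hz => ((hL z hz).fun_sub (((hL₁ (θ z)).comp z (hθd z hz)).const_mul (k : ℂ))).fun_sub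
      (((hW₁ (θ z)).comp z (hθd z hz)).const_mul c)) hLθ
  have hE : ∀ z ∈ U, F z * (μ * η₁ (θ z)) - η z * (k * F₁ (θ z) + c * η₁ (θ z)) = 0 :=
    fun z hz => by
      linear_combination μ * η₁ (θ z) * hF z hz - (k * F₁ (θ z) + c * η₁ (θ z)) * hm z hz
  -- `hE` says that `h` and `h₁ ∘ θ` are related by a real affine scaling up to the factor `μ`;
  -- comparing Hopf differentials gives `ε = kεθ'²`. Thus `θ'` has constant square and is itself
  -- constant.
  have hsq : ∀ z ∈ U, k * deriv θ z ^ 2 = 1 := fun z hz => by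
    have dF := (h.diffF.differentiableAt (hU.mem_nhds hz)).hasDerivAt
    have dη := (h.diffη.differentiableAt (hU.mem_nhds hz)).hasDerivAt
    have dF₁ := (h₁.diffF.differentiableAt (univ_mem (f := 𝓝 (θ z)))).hasDerivAt.comp z (hθd z hz)
    have dη₁ := (h₁.diffη.differentiableAt (univ_mem (f := 𝓝 (θ z)))).hasDerivAt.comp z (hθd z hz)
    have dE := (dF.fun_mul (dη₁.const_mul μ)).fun_sub
      (dη.fun_mul ((dF₁.const_mul (k : ℂ)).fun_add (dη₁.const_mul c)))
    have e1 := dE.unique ((hasDerivAt_const z (0 : ℂ)).congr_of_eventuallyEq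
      (eventually_of_mem (hU.mem_nhds hz) hE))
    simp only [Function.comp_apply] at e1
    have e2 := h.wronskian z hz
    have e3 := h₁.wronskian (θ z) (mem_univ _)
    have e4 := hE z hz
    have e5 := hm z hz
    have n1 := hη z hz
    have n2 := hη₁ z hz
    refine mul_left_cancel₀ (mul_ne_zero (mul_ne_zero hεc (mul_ne_zero hμ n1)) (pow_ne_zero 2 n2)) ?_
    linear_combination -(η z * η₁ (θ z)) * e1 + μ * η₁ (θ z) ^ 2 * e2
      + (deriv η₁ (θ z) * deriv θ z * η z + η₁ (θ z) * deriv η z) * e4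
      - η z ^ 2 * deriv θ z * k * e3 - η z * deriv θ z * k * ε * η₁ (θ z) * e5
  obtain ⟨z₀, hz₀⟩ := hne
  have hd2 : ∀ z ∈ U, HasDerivAt (deriv θ) 0 z := fun z hz => by
    have hd : DifferentiableOn ℂ θ U := fun z hz =>
      (hθ' z hz).differentiableAt.differentiableWithinAt
    have d1 := ((hd.deriv hU).differentiableAt (hU.mem_nhds hz)).hasDerivAt
    have d2 := ((d1.fun_pow 2).const_mul (k : ℂ)).unique
      ((hasDerivAt_const z (1 : ℂ)).congr_of_eventuallyEq
        (eventually_of_mem (hU.mem_nhds hz) hsq))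
    have n1 : deriv θ z ≠ 0 := fun h0 => by simpa [h0] using hsq z hz
    have : deriv (deriv θ) z = 0 := by simpa [hkc, n1] using d2
    rwa [this] at d1
  obtain ⟨a, ha⟩ := exists_const_of_hasDerivAt_zero hU hc hd2
  obtain ⟨b, hb⟩ := exists_eq_add_const hU hc (P := θ) (Q := fun z => a * z)
    (P' := fun _ => a) (fun z hz => ha z hz ▸ hθd z hz) (fun z _ => by simpa using (hasDerivAt_id z).const_mul a)
  exact ⟨a, b, fun h0 => by simpa [ha z₀ hz₀, h0] using hsq z₀ hz₀, hb⟩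

namespace IsCanonicalChart

variable {S N : Set ℂ} {X : ℂ → I3} {ρ : ℝ} {χ τ φ F L W : ℂ → ℂ}

theorem isPieceAt (h : IsCanonicalChart S X N ρ χ τ φ F L W) {Y : ℂ → I3} {T : Set ℂ}
    {Φ : I3 → I3} {a b : ℂ} (ha : a ≠ 0)
    (hY : ∀ ζ ∈ Metric.ball 0 ρ, surf L W ζ = Φ (Y (a * ζ + b)))
    (hT : ∀ ζ ∈ Metric.ball 0 ρ, a * ζ + b ∈ T) : ∀ z ∈ N, IsPieceAt S X T Y Φ z := by
  intro z hz
  refine ⟨N, h.isOpen, hz, h.subset, fun z => a * χ z + b,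
    (contDiffOn_const.mul h.smooth).add contDiffOn_const, fun y hy => ?_,
    fun y hy => hT _ (h.left_inv y hy).1, fun y hy => ?_⟩
  · have hχ := (h.smooth.differentiableOn (by simp)).differentiableAt (h.isOpen.mem_nhds hy)
    have hτ := (h.smooth_symm.differentiableOn (by simp)).differentiableAt
      (Metric.isOpen_ball.mem_nhds (h.left_inv y hy).1)
    have h1 : HasFDerivAt (fun z => τ (χ z)) _ y := hτ.hasFDerivAt.comp y hχ.hasFDerivAt
    have h2 := h1.unique ((hasFDerivAt_id y).congr_of_eventuallyEq
      (eventually_of_mem (h.isOpen.mem_nhds hy) fun z hz => (h.left_inv z hz).2))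
    rw [((hχ.hasFDerivAt.const_mul a).add_const b).fderiv]
    intro ξ ξ' hξ
    have h3 : fderiv ℝ χ y ξ = fderiv ℝ χ y ξ' := by simpa [ha] using hξ
    have h4 := DFunLike.congr_fun h2 ξ
    have h5 := DFunLike.congr_fun h2 ξ'
    simp only [ContinuousLinearMap.comp_apply, ContinuousLinearMap.id_apply] at h4 h5
    rw [← h4, ← h5, h3]
  · have := h.param _ (h.left_inv y hy).1
    rw [(h.left_inv y hy).2] at this
    rw [this, hY _ (h.left_inv y hy).1]

/-- Near one point the change of parameters is affine by `exists_affine_of_comp`. Both sides then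
make sense on the whole disc and agree there by analyticity; `η₁` cannot vanish at the image points
because `W' = φ²` does not. -/
theorem exists_affine_of_isPieceAt (h : IsCanonicalChart S X N ρ χ τ φ F L W)
    {F₁ η₁ L₁ W₁ : ℂ → ℂ} {k d : ℝ} {c μ e : ℂ} (hk : k ≠ 0) (hμ : ‖μ‖ = |k|)
    (h₁ : IsCanonical univ (-1) F₁ η₁)
    (hL₁ : ∀ z, HasDerivAt L₁ (F₁ z) z) (hW₁ : ∀ z, HasDerivAt W₁ (η₁ z) z) {z₁ : ℂ} (hz₁ : z₁ ∈ N)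
    (hp : IsPieceAt S X {z | η₁ z ≠ 0} (surf L₁ W₁) (simMap k c d μ e) z₁) :
    ∃ a b : ℂ, a ≠ 0 ∧ ∀ ζ ∈ Metric.ball 0 ρ,
      surf L W ζ = simMap k c d μ e (surf L₁ W₁ (a * ζ + b)) ∧ η₁ (a * ζ + b) ≠ 0 := by
  have hμ0 : μ ≠ 0 := by
    rw [← norm_ne_zero_iff, hμ]
    exact abs_ne_zero.2 hk
  obtain ⟨U, hU, hzU, -, ψ, hψ, -, hψT, hXψ⟩ := hp
  have hB := Metric.isOpen_ball (x := (0 : ℂ)) (ε := ρ)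
  obtain ⟨hζ₁, hτζ₁⟩ := h.left_inv z₁ hz₁
  have hcont : Tendsto τ (𝓝 (χ z₁)) (𝓝 z₁) := by
    have := (h.smooth_symm.continuousOn.continuousAt (hB.mem_nhds hζ₁)).tendsto
    rwa [hτζ₁] at this
  obtain ⟨δ, hδ, hball⟩ := Metric.eventually_nhds_iff_ball.1
    ((hcont.eventually (hU.mem_nhds hzU)).and (hB.mem_nhds hζ₁))
  have heq : ∀ ζ ∈ Metric.ball (χ z₁) δ,
      surf L W ζ = simMap k c d μ e (surf L₁ W₁ (ψ (τ ζ))) := fun ζ hζ => by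
    rw [← h.param ζ (hball ζ hζ).2, hXψ _ (hball ζ hζ).1]
  have split : ∀ {ζ y : ℂ}, surf L W ζ = simMap k c d μ e (surf L₁ W₁ y) ↔
      W ζ = μ * W₁ y + e ∧ (L ζ - k * L₁ y - c * W₁ y).re = d := by
    intro ζ y
    rw [simMap_surf]
    constructor
    · intro hs
      have h0 : (L ζ).re = (k * L₁ y + c * W₁ y + d).re := congrFun hs 0
      refine ⟨Complex.ext (congrFun hs 1) (congrFun hs 2), ?_⟩
      simp only [Complex.add_re, Complex.sub_re, Complex.ofReal_re] at h0 ⊢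
      linarith
    · rintro ⟨hw, hl⟩
      simp only [Complex.sub_re] at hl
      have h0 : (L ζ).re = (k * L₁ y + c * W₁ y + d).re := by
        simp only [Complex.add_re, Complex.ofReal_re]
        linarith
      simp only [surf, hw, h0]
  obtain ⟨a, b, ha, hab⟩ := exists_affine_of_comp Metric.isOpen_ball
    (convex_ball (χ z₁) δ).isPreconnected ⟨_, Metric.mem_ball_self hδ⟩ (by norm_num) hk hμ0
    (η := fun ζ => φ ζ ^ 2) (θ := fun ζ => ψ (τ ζ))
    ⟨h.isCanonical.diffF.mono fun ζ hζ => (hball ζ hζ).2,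
      h.isCanonical.diffη.mono fun ζ hζ => (hball ζ hζ).2,
      fun ζ hζ => h.isCanonical.wronskian ζ (hball ζ hζ).2⟩ h₁
    (fun ζ hζ => h.hasDerivAt_height ζ (hball ζ hζ).2)
    (fun ζ hζ => h.hasDerivAt_proj ζ (hball ζ hζ).2) hL₁ hW₁
    (fun ζ hζ => (((hψ.differentiableOn (by simp)).differentiableAt
      (hU.mem_nhds (hball ζ hζ).1)).comp ζ ((h.smooth_symm.differentiableOn
        (by simp)).differentiableAt (hB.mem_nhds (hball ζ hζ).2))).differentiableWithinAt)
    (fun ζ hζ => pow_ne_zero 2 (h.ne_zero ζ (hball ζ hζ).2))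
    (fun ζ hζ => hψT (hball ζ hζ).1)
    (fun ζ hζ => (split.1 (heq ζ hζ)).1) (fun ζ hζ => (split.1 (heq ζ hζ)).2)
  have hnear : ∀ᶠ ζ in 𝓝 (χ z₁), W ζ = μ * W₁ (a * ζ + b) + e ∧
      (L ζ - k * L₁ (a * ζ + b) - c * W₁ (a * ζ + b)).re = d := by
    filter_upwards [Metric.ball_mem_nhds _ hδ] with ζ hζ
    rw [← split, heq ζ hζ, hab ζ hζ]
  have haff : ∀ ζ : ℂ, HasDerivAt (fun ζ => a * ζ + b) a ζ := fun ζ => by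
    simpa using ((hasDerivAt_id ζ).const_mul a).add_const b
  have hWa : ∀ ζ, HasDerivAt (fun ζ => W₁ (a * ζ + b)) (η₁ (a * ζ + b) * a) ζ := fun ζ =>
    (hW₁ (a * ζ + b)).comp ζ (haff ζ)
  have hLa : ∀ ζ, HasDerivAt (fun ζ => L₁ (a * ζ + b)) (F₁ (a * ζ + b) * a) ζ := fun ζ =>
    (hL₁ (a * ζ + b)).comp ζ (haff ζ)
  have hWd : DifferentiableOn ℂ (fun ζ => μ * W₁ (a * ζ + b) + e) (Metric.ball 0 ρ) := fun ζ _ =>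
    (((hWa ζ).const_mul μ).add_const e).differentiableAt.differentiableWithinAt
  have hWall : ∀ ζ ∈ Metric.ball 0 ρ, W ζ = μ * W₁ (a * ζ + b) + e :=
    (DifferentiableOn.analyticOnNhd (fun ζ hζ =>
      (h.hasDerivAt_proj ζ hζ).differentiableAt.differentiableWithinAt)
        hB).eqOn_of_preconnected_of_eventuallyEq (hWd.analyticOnNhd hB)
      (convex_ball _ _).isPreconnected hζ₁ (hnear.mono fun ζ hζ => hζ.1)
  have hLall := re_eq_of_eventually_re_eq hB (convex_ball _ _).isPreconnected
    (G := fun ζ => L ζ - k * L₁ (a * ζ + b) - c * W₁ (a * ζ + b))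
    (fun ζ hζ => (((h.hasDerivAt_height ζ hζ).fun_sub ((hLa ζ).const_mul (k : ℂ))).fun_sub
      ((hWa ζ).const_mul c)).differentiableAt.differentiableWithinAt) hζ₁
    (hnear.mono fun ζ hζ => hζ.2)
  refine ⟨a, b, ha, fun ζ hζ => ⟨split.2 ⟨hWall ζ hζ, hLall ζ hζ⟩, fun h0 => ?_⟩⟩
  have h1 := (h.hasDerivAt_proj ζ hζ).unique ((((hWa ζ).const_mul μ).add_const e).congr_of_eventuallyEq
    (eventually_of_mem (hB.mem_nhds hζ) hWall))
  rw [h0] at h1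
  exact pow_ne_zero 2 (h.ne_zero ζ hζ) (by simpa using h1)

/-- A canonical chart of a surface with planar curvature lines is a piece of a member of the
deformation. -/
theorem exists_isPieceAt_deformation (h : IsCanonicalChart S X N ρ χ τ φ F L W) (hS : IsOpen S)
    (hX : IsSpacelikeImmersion S X) (hpl : HasPlanarCurvatureLines S X) :
    ∃ t ∈ Icc (0 : ℝ) 3, ∃ Φ, IsSimilarity Φ ∧
      ∀ z ∈ N, IsPieceAt S X (regularSet t) (deformation t) Φ z := by
  have hB := Metric.isOpen_ball (x := (0 : ℂ)) (ε := ρ)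
  have hBc := (convex_ball (0 : ℂ) ρ).isPreconnected
  obtain ⟨κ, hκ⟩ := h.exists_deriv2_eq hS hX hpl
  have h0 := Metric.mem_ball_self (x := (0 : ℂ)) h.pos
  obtain ⟨t, ht, a, b, ν, ha, ha2, hν, hη⟩ := exists_member hB hBc (φ' := deriv φ)
    (fun ζ hζ => (h.holo.differentiableAt (hB.mem_nhds hζ)).hasDerivAt)
    (fun ζ hζ => by
      rw [← hκ ζ hζ]
      exact ((h.holo.deriv hB).differentiableAt (hB.mem_nhds hζ)).hasDerivAt)
    ⟨0, h0, h.ne_zero 0 h0⟩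
  obtain ⟨κ', hs⟩ := isSpinorial_deformation ht
  obtain ⟨Φ, hΦ, hΦX⟩ := h.isCanonical.exists_similarity hB hBc (by norm_num) (by norm_num)
    hs.isCanonical ha ha2 (by simpa using hν) hη ⟨0, h0, pow_ne_zero 2 (h.ne_zero 0 h0)⟩
    h.hasDerivAt_height h.hasDerivAt_proj hs.hasDerivAt_height hs.hasDerivAt_proj
  refine ⟨t, ht, Φ, hΦ, h.isPieceAt (b := b) ha (fun ζ hζ => ?_) fun ζ hζ h1 => ?_⟩
  · rw [hΦX ζ hζ, deformation, IsSpinorial.weierstrassSurface_eq]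
  · exact pow_ne_zero 2 (h.ne_zero ζ hζ) (by rw [hη ζ hζ, h1, mul_zero])

end IsCanonicalChart

/-- The zero mean curvature surfaces with planar curvature lines are, up to similarities, pieces of
the members of the deformation. -/
theorem IsZMCWithPlanarLines.exists_isPieceOf {S : Set ℂ} {X : ℂ → I3}
    (h : IsZMCWithPlanarLines S X) :
    ∃ t ∈ Icc (0 : ℝ) 3, IsPieceOf S X (regularSet t) (deformation t) := by
  have hchart : ∀ p ∈ S, ∃ (N : Set ℂ) (ρ : ℝ) (χ τ φ F L W : ℂ → ℂ), p ∈ N ∧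
      IsCanonicalChart S X N ρ χ τ φ F L W := fun p hp => by
    obtain ⟨V, r, σ, H, hpV, hV⟩ := exists_graph_chart h.isOpen h.spacelike h.zeroMeanCurvature hp
    obtain ⟨N, ρ, χ, τ, φ, F, L, W, hpN, -, hc, -, -⟩ := hV.exists_canonicalChart h.isOpen
      h.spacelike hpV fun h0 =>
        h.not_isUmbilic hp ((hV.isUmbilic_iff h.isOpen h.spacelike hpV).2 h0)
    exact ⟨N, ρ, χ, τ, φ, F, L, W, hpN, hc⟩
  obtain ⟨p₀, hp₀⟩ := h.isConnected.nonempty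
  obtain ⟨N₀, ρ₀, χ₀, τ₀, φ₀, F₀, L₀, W₀, hpN₀, hc₀⟩ := hchart p₀ hp₀
  obtain ⟨t, ht, Φ, hΦ, hpiece⟩ :=
    hc₀.exists_isPieceAt_deformation h.isOpen h.spacelike h.planarLines
  -- `t` and `Φ` come from a single chart; being a piece of this fixed surface spreads from one
  -- point of a canonical chart to all of it, hence over `S`.
  refine ⟨t, ht, Φ, hΦ, forall_of_exists_of_isPreconnected h.isConnected.isPreconnected
    (P := IsPieceAt S X (regularSet t) (deformation t) Φ) (fun p hp => ?_)
    ⟨p₀, hp₀, hpiece p₀ hpN₀⟩⟩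
  obtain ⟨N, ρ, χ, τ, φ, F, L, W, hpN, hc⟩ := hchart p hp
  refine ⟨N, hc.isOpen, hpN, fun ⟨z₁, hz₁, hP⟩ => ?_⟩
  obtain ⟨k, c, d, μ, e, hk, hμ, rfl⟩ := hΦ.exists_simMap
  obtain ⟨κ, hs⟩ := isSpinorial_deformation ht
  rw [deformation, IsSpinorial.weierstrassSurface_eq] at hP ⊢
  obtain ⟨a, b, ha, hab⟩ := hc.exists_affine_of_isPieceAt hk hμ hs.isCanonical
    hs.hasDerivAt_height hs.hasDerivAt_proj hz₁ hP
  exact hc.isPieceAt ha (fun ζ hζ => (hab ζ hζ).1) fun ζ hζ => (hab ζ hζ).2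

end Isotropic

end

theorem theorem5p2 :
    -- the deformation is given by Weierstrass data
    (∀ t ∈ Icc (0 : ℝ) 3,
      Isotropic.IsWeierstrassData (Isotropic.deformationH t) (Isotropic.deformationEta t)) ∧
    -- it is continuous: uniform convergence on compact sets
    (∀ t₀ ∈ Icc (0 : ℝ) 3, ∀ K : Set ℂ, IsCompact K →
      TendstoUniformlyOn Isotropic.deformation (Isotropic.deformation t₀)
        (𝓝[Icc (0 : ℝ) 3] t₀) K) ∧
    -- every member is a zero mean curvature surface with planar curvature lines
    (∀ t ∈ Icc (0 : ℝ) 3,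
      Isotropic.IsZMCWithPlanarLines (Isotropic.regularSet t) (Isotropic.deformation t)) ∧
    -- every such surface is a piece of a member, up to isometries and homotheties
    (∀ (S : Set ℂ) (X : ℂ → Isotropic.I3), Isotropic.IsZMCWithPlanarLines S X →
      ∃ t ∈ Icc (0 : ℝ) 3,
        Isotropic.IsPieceOf S X (Isotropic.regularSet t) (Isotropic.deformation t)) ∧
    -- the surfaces which it connects
    Isotropic.SameSurface (Isotropic.deformation 0) Isotropic.catenoid ∧
    (∀ t ∈ Ioo (0 : ℝ) 1, Isotropic.SameSurface (Isotropic.deformation t)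
      (Isotropic.bonnetType (2 * Real.cos (Real.pi * t / 2)) (2 * Real.sin (Real.pi * t / 2)))) ∧
    Isotropic.SameSurface (Isotropic.deformation 1) Isotropic.enneperType ∧
    (∀ t ∈ Ioc (1 : ℝ) 2, Isotropic.SameSurface (Isotropic.deformation t)
      (Isotropic.bonnetType (2 * (t - 1)) 2)) ∧
    (∀ t ∈ Ico (2 : ℝ) 3, Isotropic.SameSurface (Isotropic.deformation t)
      (Isotropic.bonnetType (2 * (3 - t)) ((2 * (3 - t)) ^ 2 / 2))) ∧
    Isotropic.SameSurface (Isotropic.deformation 3) Isotropic.trivialEnneper ∧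
    (∀ α β : ℝ, 0 < α → 0 < β → ∃ t ∈ Ioo (0 : ℝ) 1,
      Isotropic.SameSurface (Isotropic.deformation t) (Isotropic.bonnetType α β)) := by
  refine ⟨fun t ht => ?_, fun t₀ ht₀ K hK => Isotropic.tendstoUniformlyOn_deformation ht₀ hK,
    fun t ht => ?_, fun S X h => h.exists_isPieceOf, Isotropic.sameSurface_zero_catenoid,
    fun t ht => ?_, Isotropic.sameSurface_one_enneperType,
    fun t ht => Isotropic.sameSurface_second_stage ht,
    fun t ht => Isotropic.sameSurface_third_stage ht, Isotropic.sameSurface_three_trivialEnneper,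
    fun α β hα hβ => Isotropic.exists_sameSurface_bonnet hα hβ⟩
  · obtain ⟨κ, hs⟩ := Isotropic.isSpinorial_deformation ht
    exact hs.isWeierstrassData (by norm_num)
  · obtain ⟨κ, hs⟩ := Isotropic.isSpinorial_deformation ht
    exact hs.isZMCWithPlanarLines (by norm_num)
  · simpa using Isotropic.sameSurface_bonnet ht one_pos
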